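/- Let $M$ be a smooth 3-manifold and let $\xi,\tilde\xi$ be a pair of transverse smooth contact distributions on $M$. Write $(M,\xi,\tilde\xi)_+$ if they induce the same orientation of $M$ (the orientation induced by $\xi$ is given locally by $\alpha\wedge d\alpha$, for $\alpha$ a contact form with $\ker\alpha=\xi$), and $(M,\xi,\tilde\xi)_-$ if they induce opposite orientations. Suppose that the axis $A=\xi\cap\tilde\xi$ is oriented. Around every point there are local contact forms $\alpha,\tilde\alpha$ with $\ker\alpha=\xi$, $\ker\tilde\alpha=\tilde\xi$ which are balanced, $\alpha\wedge d\alpha=\pm\,\tilde\alpha\wedge d\tilde\alpha$, and such that the vector field $X$ along $A$ defined by $i_X(\alpha\wedge d\alpha)=\alpha\wedge\tilde\alpha$ is positive for the orientation of $A$. The generating invariant of $(M,\xi,\tilde\xi)_\pm$ is the function $I:M\to\mathbb{R}$ given, independently of the choice of such forms, by \[ I=\frac{\alpha\wedge d\tilde\alpha+\tilde\alpha\wedge d\alpha}{\alpha\wedge d\alpha}. \] Proposition. Suppose that the generating invariant $I$ of $(M,\xi,\tilde\xi)_\pm$ is constant. Then around every point of $M$ there are smooth local coordinates $(x,y,p)$,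 with $p+I\neq 0$, in which \[ \xi=\{dy=p\,dx\},\qquad \tilde\xi=\Big\{dy\pm\frac{dx}{p+I}=0\Big\}, \] where the sign $\pm$ is that of the pair. -/

import Mathlib

open scoped Manifold ContDiff Topology

noncomputable section

/-- The model space `ℝ³`; its coordinates `0, 1, 2` play the roles of `x, y, p`. -/
abbrev E3 : Type := EuclideanSpace ℝ (Fin 3)

section

variable {M : Type*} [TopologicalSpace M] [ChartedSpace E3 M]

/-- The coordinate expression of a 1-form `α` on `M` in the preferred chart at `m`,
i.e. the pullback of `α` by the inverse of the chart. -/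
def formInChart (α : ∀ m : M, TangentSpace 𝓘(ℝ, E3) m →L[ℝ] ℝ) (m : M) (z : E3) : E3 →L[ℝ] ℝ :=
  (α ((extChartAt 𝓘(ℝ, E3) m).symm z)).comp
    (mfderiv 𝓘(ℝ, E3) 𝓘(ℝ, E3) (extChartAt 𝓘(ℝ, E3) m).symm z)

/-- A 1-form is smooth on the open set `U` if its coordinate expressions are smooth. -/
def IsSmoothForm (α : ∀ m : M, TangentSpace 𝓘(ℝ, E3) m →L[ℝ] ℝ) (U : Set M) : Prop :=
  ∀ m ∈ U, ContDiffAt ℝ ∞ (formInChart α m) (extChartAt 𝓘(ℝ, E3) m m)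

/-- The exterior derivative `dα` of a 1-form `α` on `M`, at `m`, as a function of two tangent
vectors: the exterior derivative of the coordinate expression of `α`, pulled back by the chart. -/
def dForm (α : ∀ m : M, TangentSpace 𝓘(ℝ, E3) m →L[ℝ] ℝ) (m : M)
    (v w : TangentSpace 𝓘(ℝ, E3) m) : ℝ :=
  let D : TangentSpace 𝓘(ℝ, E3) m → E3 :=
    fun u => mfderiv 𝓘(ℝ, E3) 𝓘(ℝ, E3) (extChartAt 𝓘(ℝ, E3) m) m u
  extDeriv (fun z => ContinuousAlternatingMap.ofSubsingleton ℝ E3 ℝ (0 : Fin 1) (formInChart α m z))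
    (extChartAt 𝓘(ℝ, E3) m m) ![D v, D w]

/-- The 2-form `(α ∧ γ)ₘ` for 1-forms `α, γ`, as a function of two tangent vectors. -/
def wedge₁₁ (α γ : ∀ m : M, TangentSpace 𝓘(ℝ, E3) m →L[ℝ] ℝ) (m : M) :
    TangentSpace 𝓘(ℝ, E3) m → TangentSpace 𝓘(ℝ, E3) m → ℝ :=
  fun u v => α m u * γ m v - α m v * γ m u

/-- The 3-form `(α ∧ dγ)ₘ` for 1-forms `α, γ`, as a function of three tangent vectors. -/
def wedgeD (α γ : ∀ m : M, TangentSpace 𝓘(ℝ, E3) m →L[ℝ] ℝ) (m : M) :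
    TangentSpace 𝓘(ℝ, E3) m → TangentSpace 𝓘(ℝ, E3) m → TangentSpace 𝓘(ℝ, E3) m → ℝ :=
  fun u v w => α m u * dForm γ m v w + α m v * dForm γ m w u + α m w * dForm γ m u v

/-- `α` is a (smooth) contact form on the open set `U` for the distribution `ξ`:
`ξ = ker α` and `α ∧ dα` vanishes nowhere on `U`. -/
structure IsContactForm (ξ : ∀ m : M, Submodule ℝ (TangentSpace 𝓘(ℝ, E3) m))
    (α : ∀ m : M, TangentSpace 𝓘(ℝ, E3) m →L[ℝ] ℝ) (U : Set M) : Prop where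
  smooth : IsSmoothForm α U
  ker_eq : ∀ m ∈ U, ∀ v : TangentSpace 𝓘(ℝ, E3) m, v ∈ ξ m ↔ α m v = 0
  nondeg : ∀ m ∈ U, wedgeD α α m ≠ 0

/-- `ξ` is a contact distribution: around each point it is the kernel of a contact form. -/
def IsContactDistribution (ξ : ∀ m : M, Submodule ℝ (TangentSpace 𝓘(ℝ, E3) m)) : Prop :=
  ∀ m : M, ∃ U : Set M, IsOpen U ∧ m ∈ U ∧
    ∃ α : ∀ m : M, TangentSpace 𝓘(ℝ, E3) m →L[ℝ] ℝ, IsContactForm ξ α U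

/-- `(M, ξ, ξ')_ε` is a pair of transverse contact distributions on `M`, commonly oriented when
`ε = 1` and oppositely oriented when `ε = -1`; the orientation of `M` induced by a contact
distribution is the one given locally by `α ∧ dα`, for `α` a local contact form. -/
structure IsTransverseContactPair (ε : ℝ)
    (ξ ξ' : ∀ m : M, Submodule ℝ (TangentSpace 𝓘(ℝ, E3) m)) : Prop where
  contact : IsContactDistribution ξ
  contact' : IsContactDistribution ξ'
  transverse : ∀ m : M, ξ m ⊔ ξ' m = ⊤
  orientation : ∀ (U : Set M) (α α' : ∀ m : M, TangentSpace 𝓘(ℝ, E3) m →L[ℝ] ℝ), IsOpen U →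
    IsContactForm ξ α U → IsContactForm ξ' α' U →
    ∀ m ∈ U, ∃ r : ℝ, 0 < r ∧ wedgeD α α m = (ε * r) • wedgeD α' α' m

/-- The continuous vector field `X` orients the axis: `ξ ∩ ξ' = span {X}`.
(Only the ray spanned by `X m` matters below.) -/
structure OrientsAxis [IsManifold 𝓘(ℝ, E3) ∞ M]
    (ξ ξ' : ∀ m : M, Submodule ℝ (TangentSpace 𝓘(ℝ, E3) m))
    (X : ∀ m : M, TangentSpace 𝓘(ℝ, E3) m) : Prop where
  continuous : Continuous (fun m : M => (⟨m, X m⟩ : TangentBundle 𝓘(ℝ, E3) M))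
  span_eq : ∀ m : M, Submodule.span ℝ {X m} = ξ m ⊓ ξ' m

/-- `(α, α')` are balanced contact forms on `U` for `(M, ξ, ξ')_ε`, i.e. `α ∧ dα = ε α' ∧ dα'`,
such that the vector field `Z` along the axis with `i_Z (α ∧ dα) = α ∧ α'` is a positive multiple
of `X`. -/
structure IsBalanced (ε : ℝ) (ξ ξ' : ∀ m : M, Submodule ℝ (TangentSpace 𝓘(ℝ, E3) m))
    (X : ∀ m : M, TangentSpace 𝓘(ℝ, E3) m)
    (α α' : ∀ m : M, TangentSpace 𝓘(ℝ, E3) m →L[ℝ] ℝ) (U : Set M) : Prop where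
  contact : IsContactForm ξ α U
  contact' : IsContactForm ξ' α' U
  balanced : ∀ m ∈ U, wedgeD α α m = ε • wedgeD α' α' m
  normalized : ∀ m ∈ U, ∃ r : ℝ, 0 < r ∧ wedgeD α α m (r • X m) = wedge₁₁ α α' m

/-- `I` is the generating invariant of `(M, ξ, ξ')_ε`, with axis oriented by `X`:
`I = (α ∧ dα' + α' ∧ dα) / (α ∧ dα)` for balanced contact forms `(α, α')` adapted to the
orientation. Such forms exist around every point, and the quotient does not depend on them, so
this determines `I`. -/
def IsGeneratingInvariant (ε : ℝ) (ξ ξ' : ∀ m : M, Submodule ℝ (TangentSpace 𝓘(ℝ, E3) m))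
    (X : ∀ m : M, TangentSpace 𝓘(ℝ, E3) m) (I : M → ℝ) : Prop :=
  ∀ (U : Set M) (α α' : ∀ m : M, TangentSpace 𝓘(ℝ, E3) m →L[ℝ] ℝ), IsOpen U →
    IsBalanced ε ξ ξ' X α α' U →
    ∀ m ∈ U, wedgeD α α' m + wedgeD α' α m = I m • wedgeD α α m

/-- The differential at `m` of the `i`-th coordinate function of the chart `e`. -/
def coordDiff (e : OpenPartialHomeomorph M E3) (i : Fin 3) (m : M)
    (v : TangentSpace 𝓘(ℝ, E3) m) : ℝ :=
  (show E3 from mfderiv 𝓘(ℝ, E3) 𝓘(ℝ, E3) e m v) i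

end

end

/-!
Let `c` be the constant value of the generating invariant. A flow box straightening the axis puts
balanced forms in the shape `α = f₁ dx + f₂ dy`, `α' = g₁ dx + g₂ dy`, and after reparametrizing the
axis the balance condition and `I = c` say that `α` and `α'` together solve a linear system with
constant coefficients along the axis, with characteristic polynomial `κ² - c κ + ε`. The pair is
therefore obtained from a planar coframe by applying `exp (t B)`, and it only remains to choose the
coordinates `x, y` of the plane. If the roots `κ` are real and distinct, first integrals of the two
eigendirections will do; a double root is treated similarly. If they are complex, the eigenform is
a complex-valued coframe and one needs isothermal coordinates, that is, a local diffeomorphism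
solving the Beltrami equation `∂₁ F = σ ∂₀ F` with `σ` not real. After a localization that makes
`σ - σ₀` small and periodic, with `σ₀` the value of `σ` at the origin, the equation becomes a
Neumann series on Fourier coefficients; working in spaces of rapidly decreasing coefficients, it
converges together with all its derivatives.
-/

/-! ### Functions smooth near a point -/

section SmoothNear

variable {E F G : Type*} [NormedAddCommGroup E] [NormedSpace ℝ E] [NormedAddCommGroup F]
  [NormedSpace ℝ F] [NormedAddCommGroup G] [NormedSpace ℝ G]

/-- `f` is smooth in a neighbourhood of `a`. This is stronger than `ContDiffAt ℝ ∞ f a`, which only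
provides for each finite `n` a neighbourhood of `a` in which `f` is `Cⁿ`. -/
abbrev SmoothNear (f : E → F) (a : E) : Prop := ∀ᶠ x in 𝓝 a, ContDiffAt ℝ ∞ f x

namespace SmoothNear

variable {f g : E → F} {a : E}

theorem contDiffAt (hf : SmoothNear f a) : ContDiffAt ℝ ∞ f a :=
  hf.self_of_nhds

theorem continuousAt (hf : SmoothNear f a) : ContinuousAt f a :=
  hf.contDiffAt.continuousAt

theorem eventually_differentiableAt (hf : SmoothNear f a) :
    ∀ᶠ x in 𝓝 a, DifferentiableAt ℝ f x :=
  hf.mono fun _ hx => hx.differentiableAt (by simp)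

theorem of_contDiff (hf : ContDiff ℝ ∞ f) : SmoothNear f a :=
  .of_forall fun _ => hf.contDiffAt

theorem comp {g : F → G} (hg : SmoothNear g (f a)) (hf : SmoothNear f a) :
    SmoothNear (fun x => g (f x)) a := by
  filter_upwards [hf, hf.continuousAt.eventually hg] with x hx hy using hy.comp x hx

theorem add (hf : SmoothNear f a) (hg : SmoothNear g a) : SmoothNear (fun x => f x + g x) a := by
  filter_upwards [hf, hg] with x hx hy using hx.add hy

theorem sub (hf : SmoothNear f a) (hg : SmoothNear g a) : SmoothNear (fun x => f x - g x) a := by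
  filter_upwards [hf, hg] with x hx hy using hx.sub hy

theorem neg (hf : SmoothNear f a) : SmoothNear (fun x => -f x) a := by
  filter_upwards [hf] with x hx using hx.neg

theorem const (c : F) (a : E) : SmoothNear (fun _ => c) a :=
  of_contDiff contDiff_const

theorem mul {𝔸 : Type*} [NormedRing 𝔸] [NormedAlgebra ℝ 𝔸] {f g : E → 𝔸}
    (hf : SmoothNear f a) (hg : SmoothNear g a) : SmoothNear (fun x => f x * g x) a := by
  filter_upwards [hf, hg] with x hx hy using hx.mul hy

theorem div {𝕜 : Type*} [NormedField 𝕜] [NormedAlgebra ℝ 𝕜] [CompleteSpace 𝕜] {f g : E → 𝕜}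
    (hf : SmoothNear f a) (hg : SmoothNear g a) (h0 : g a ≠ 0) :
    SmoothNear (fun x => f x / g x) a := by
  filter_upwards [hf, hg, hg.continuousAt.eventually_ne h0] with x hx hy h
  simp only [div_eq_mul_inv]
  exact hx.mul (hy.inv h)

theorem fderiv_apply (hf : SmoothNear f a) (v : E) : SmoothNear (fun x => fderiv ℝ f x v) a := by
  filter_upwards [hf] with x hx
  exact (hx.fderiv_right (m := ∞) (by simp)).clm_apply contDiffAt_const

theorem exists_contDiff_eventuallyEq [FiniteDimensional ℝ E] (hf : SmoothNear f a) :
    ∃ g : E → F, ContDiff ℝ ∞ g ∧ g =ᶠ[𝓝 a] f := by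
  obtain ⟨r, hr, h⟩ := Metric.eventually_nhds_iff.1 hf
  let χ : ContDiffBump a := ⟨r / 4, r / 2, by positivity, by linarith⟩
  refine ⟨fun x => χ x • f x, contDiff_iff_contDiffAt.2 fun x => ?_, ?_⟩
  · by_cases hx : dist x a < r
    · exact χ.contDiffAt.smul (h hx)
    · have hx' : x ∉ tsupport χ := by
        rw [χ.tsupport_eq, Metric.mem_closedBall, show χ.rOut = r / 2 from rfl]
        linarith
      refine (contDiffAt_const (c := 0)).congr_of_eventuallyEq ?_
      filter_upwards [notMem_tsupport_iff_eventuallyEq.1 hx'] with y hy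
      simp [hy]
  · filter_upwards [χ.eventuallyEq_one] with x hx
    simp [hx]

end SmoothNear

end SmoothNear

/-! ### Inverse and implicit functions smooth near a point -/

section InverseFunction

variable {E F G : Type*} [NormedAddCommGroup E] [NormedSpace ℝ E] [NormedAddCommGroup F]
  [NormedSpace ℝ F] [NormedAddCommGroup G] [NormedSpace ℝ G]

/-- A smooth local diffeomorphism: a local homeomorphism smooth in both directions. -/
structure IsSmoothLocalDiffeo (e : OpenPartialHomeomorph E F) : Prop where
  contDiffAt : ∀ x ∈ e.source, ContDiffAt ℝ ∞ e x
  contDiffAt_symm : ∀ y ∈ e.target, ContDiffAt ℝ ∞ e.symm y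

theorem IsSmoothLocalDiffeo.exists_hasFDerivAt {e : OpenPartialHomeomorph E F}
    (he : IsSmoothLocalDiffeo e) {x : E} (hx : x ∈ e.source) :
    ∃ g : E ≃L[ℝ] F, HasFDerivAt e (g : E →L[ℝ] F) x := by
  have hd := ((he.contDiffAt x hx).differentiableAt (by simp)).hasFDerivAt
  have hd' := ((he.contDiffAt_symm _ (e.map_source hx)).differentiableAt (by simp)).hasFDerivAt
  have hleft : e.symm ∘ e =ᶠ[𝓝 x] id := e.eventually_left_inverse hx
  have hright : e ∘ e.symm =ᶠ[𝓝 (e x)] id := e.eventually_right_inverse' hx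
  have hde : HasFDerivAt e (fderiv ℝ e x) (e.symm (e x)) := by rwa [e.left_inv hx]
  exact ⟨.equivOfInverse _ _
    (DFunLike.congr_fun ((hd'.comp x hd).unique ((hasFDerivAt_id x).congr_of_eventuallyEq hleft)))
    (DFunLike.congr_fun ((hde.comp (e x) hd').unique
      ((hasFDerivAt_id (e x)).congr_of_eventuallyEq hright))), hd⟩

theorem IsSmoothLocalDiffeo.symm {e : OpenPartialHomeomorph E F} (he : IsSmoothLocalDiffeo e) :
    IsSmoothLocalDiffeo e.symm :=
  ⟨he.contDiffAt_symm, he.contDiffAt⟩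

theorem IsSmoothLocalDiffeo.trans {e : OpenPartialHomeomorph E F} {e' : OpenPartialHomeomorph F G}
    (he : IsSmoothLocalDiffeo e) (he' : IsSmoothLocalDiffeo e') :
    IsSmoothLocalDiffeo (e.trans e') := by
  refine ⟨fun x hx => ?_, fun z hz => ?_⟩
  · rw [OpenPartialHomeomorph.trans_source] at hx
    exact (he'.contDiffAt _ hx.2).comp x (he.contDiffAt x hx.1)
  · rw [OpenPartialHomeomorph.trans_target] at hz
    exact (he.contDiffAt_symm _ hz.2).comp z (he'.contDiffAt_symm z hz.1)

theorem SmoothNear.exists_isSmoothLocalDiffeo [CompleteSpace E] {f : E → F} {a : E}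
    (hf : SmoothNear f a) {f' : E ≃L[ℝ] F} (hf' : HasFDerivAt f (f' : E →L[ℝ] F) a) :
    ∃ e : OpenPartialHomeomorph E F, a ∈ e.source ∧ ⇑e = f ∧ IsSmoothLocalDiffeo e := by
  have hinv : ∀ᶠ x in 𝓝 a, ∃ g : E ≃L[ℝ] F, (g : E →L[ℝ] F) = fderiv ℝ f x :=
    (hf.contDiffAt.fderiv_right (m := 0) (by simp)).continuousAt (hf'.fderiv ▸ f'.nhds)
  obtain ⟨s, hs, hso, has⟩ := eventually_nhds_iff.1 (hf.and hinv)
  refine ⟨(hf.contDiffAt.toOpenPartialHomeomorph f hf' (by simp)).restrOpen s hso,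
    ⟨hf.contDiffAt.mem_toOpenPartialHomeomorph_source hf' (by simp), has⟩, rfl,
    fun x hx => (hs x hx.2).1, fun y hy => ?_⟩
  obtain ⟨hx, g, hg⟩ := hs _ (OpenPartialHomeomorph.map_target _ hy).2
  exact OpenPartialHomeomorph.contDiffAt_symm _ hy
    (hg ▸ (hx.differentiableAt (by simp)).hasFDerivAt) hx

theorem exists_smoothNear_implicitFunction [CompleteSpace E] [CompleteSpace F] {f : E × F → F}
    {a : E × F} (hf : SmoothNear f a) {f' : E →L[ℝ] F}
    (hf' : HasFDerivAt f (f'.coprod (.id ℝ F)) a) (ha : f a = 0) :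
    ∃ g : E → F, SmoothNear g a.1 ∧ ∀ᶠ z in 𝓝 a, f z = 0 ↔ z.2 = g z.1 := by
  let shear : (E × F) ≃L[ℝ] (E × F) := .equivOfInverse
    ((ContinuousLinearMap.fst ℝ E F).prod (f'.coprod (.id ℝ F)))
    ((ContinuousLinearMap.fst ℝ E F).prod ((-f').coprod (.id ℝ F)))
    (fun z => by simp) (fun z => by simp)
  have hF : SmoothNear (fun z => (z.1, f z)) a :=
    hf.mono fun z hz => contDiffAt_fst.prodMk hz
  obtain ⟨e, hae, he, hsmooth⟩ := hF.exists_isSmoothLocalDiffeo (f' := shear)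
    (hasFDerivAt_fst.prodMk hf')
  replace he (z) : e z = (z.1, f z) := congrFun he z
  have htarget : ∀ᶠ x in 𝓝 a.1, (x, (0 : F)) ∈ e.target :=
    (by fun_prop : Continuous fun x : E => (x, (0 : F))).continuousAt.eventually_mem
      (e.open_target.mem_nhds (by simpa only [he, ha] using e.map_source hae))
  refine ⟨fun x => (e.symm (x, 0)).2, htarget.mono fun x hx => ?_, ?_⟩
  · exact ((hsmooth.contDiffAt_symm _ hx).comp x
      (contDiffAt_id.prodMk contDiffAt_const)).snd
  · filter_upwards [e.open_source.mem_nhds hae, continuous_fst.continuousAt.eventually htarget]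
      with z hz hz'
    refine ⟨fun h => by rw [← h, ← he, e.left_inv hz], fun h => ?_⟩
    have hsymm := e.right_inv hz'
    rw [he] at hsymm
    rw [show z = e.symm (z.1, 0) from Prod.ext (congrArg Prod.fst hsymm).symm h]
    exact congrArg Prod.snd hsymm

end InverseFunction

/-! ### Composition operators on spaces of continuous functions -/

section Composition

universe u

variable {K : Type*} [TopologicalSpace K] [CompactSpace K]

/-- Pointwise application of a continuous family of linear maps to a continuous function. -/
noncomputable def pointwiseApplyCLM (K E F : Type*) [TopologicalSpace K] [CompactSpace K]
    [NormedAddCommGroup E] [NormedSpace ℝ E] [NormedAddCommGroup F] [NormedSpace ℝ F] :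
    C(K, E →L[ℝ] F) →L[ℝ] C(K, E) →L[ℝ] C(K, F) :=
  LinearMap.mkContinuous₂
    (LinearMap.mk₂ ℝ (fun (A : C(K, E →L[ℝ] F)) (h : C(K, E)) =>
      (⟨fun k => A k (h k), by fun_prop⟩ : C(K, F)))
      (by intros; ext; simp) (by intros; ext; simp) (by intros; ext; simp) (by intros; ext; simp))
    1 (by
      intro A h
      rw [one_mul, ContinuousMap.norm_le _ (by positivity)]
      intro k
      exact (A k).le_of_opNorm_le_of_le (A.norm_coe_le_norm k) (h.norm_coe_le_norm k))

theorem hasFDerivAt_continuousMap_comp {E F : Type*} [NormedAddCommGroup E] [NormedSpace ℝ E]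
    [NormedAddCommGroup F] [NormedSpace ℝ F] (v : C(E, F)) (v' : C(E, E →L[ℝ] F))
    (hv : ∀ x, HasFDerivAt v (v' x) x) (γ : C(K, E)) :
    HasFDerivAt (fun η : C(K, E) => v.comp η) (pointwiseApplyCLM K E F (v'.comp γ)) γ := by
  rw [hasFDerivAt_iff_isLittleO, Asymptotics.isLittleO_iff]
  intro ε hε
  obtain ⟨δ, hδ, h⟩ := Metric.mem_nhds_iff.1
    ((ContinuousMap.continuous_postcomp (X := K) v').continuousAt.preimage_mem_nhds
      (Metric.ball_mem_nhds (v'.comp γ) hε))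
  filter_upwards [Metric.ball_mem_nhds γ hδ] with η hη
  rw [ContinuousMap.norm_le _ (by positivity)]
  intro k
  have hk : ‖v (η k) - v (γ k) - v' (γ k) (η k - γ k)‖ ≤ ε * ‖η k - γ k‖ := by
    refine (convex_segment (γ k) (η k)).norm_image_sub_le_of_norm_hasFDerivWithin_le'
      (fun x _ => (hv x).hasFDerivWithinAt) ?_ (left_mem_segment ℝ _ _) (right_mem_segment ℝ _ _)
    intro x hx
    obtain ⟨s, hs, rfl⟩ := segment_eq_image' ℝ (γ k) (η k) ▸ hx
    have hd : γ + s • (η - γ) ∈ Metric.ball γ δ := by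
      rw [mem_ball_iff_norm] at hη ⊢
      rw [add_sub_cancel_left, norm_smul, Real.norm_of_nonneg hs.1]
      exact (mul_le_of_le_one_left (norm_nonneg _) hs.2).trans_lt hη
    have := (ContinuousMap.dist_apply_le_dist k).trans (Metric.mem_ball.1 (h hd)).le
    rwa [dist_eq_norm] at this
  exact hk.trans (mul_le_mul_of_nonneg_left ((η - γ).norm_coe_le_norm k) hε.le)

theorem contDiff_continuousMap_comp {E F : Type u} [NormedAddCommGroup E] [NormedSpace ℝ E]
    [NormedAddCommGroup F] [NormedSpace ℝ F] (v : C(E, F)) (hv : ContDiff ℝ ∞ v) :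
    ContDiff ℝ ∞ (fun η : C(K, E) => v.comp η) := by
  refine contDiff_infty.2 fun n => ?_
  induction n generalizing F with
  | zero => exact contDiff_zero.2 (ContinuousMap.continuous_postcomp v)
  | succ n ih =>
    have hv' : ContDiff ℝ ∞ (fderiv ℝ v) := hv.fderiv_right (by simp)
    let v' : C(E, E →L[ℝ] F) := ⟨fderiv ℝ v, hv'.continuous⟩
    push_cast
    exact contDiff_succ_iff_hasFDerivAt.2 ⟨fun γ => pointwiseApplyCLM K E F (v'.comp γ),
      ContDiff.comp (g := pointwiseApplyCLM K E F) (ContinuousLinearMap.contDiff _) (ih v' hv'),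
      hasFDerivAt_continuousMap_comp v v' fun x => (hv.differentiable (by simp) x).hasFDerivAt⟩

end Composition

/-! ### Smooth flows -/

section Flow

universe u

variable {E : Type u} [NormedAddCommGroup E] [NormedSpace ℝ E]

/-- Integration from `0` of continuous functions on `[-1, 1]`. -/
noncomputable def primitiveCLM (E : Type*) [NormedAddCommGroup E] [NormedSpace ℝ E] :
    C(Set.Icc (-1 : ℝ) 1, E) →L[ℝ] C(Set.Icc (-1 : ℝ) 1, E) :=
  LinearMap.mkContinuous
    { toFun := fun γ =>
        ⟨fun s => ∫ τ in (0 : ℝ)..s, γ.IccExtend (by norm_num : (-1 : ℝ) ≤ 1) τ,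
          (intervalIntegral.continuous_primitive
            (fun a b => (ContinuousMap.continuous _).intervalIntegrable a b) 0).comp
              continuous_subtype_val⟩
      map_add' := fun γ η => by
        ext s
        exact intervalIntegral.integral_add
          ((γ.IccExtend (by norm_num : (-1 : ℝ) ≤ 1)).continuous.intervalIntegrable _ _)
          ((η.IccExtend (by norm_num : (-1 : ℝ) ≤ 1)).continuous.intervalIntegrable _ _)
      map_smul' := fun c γ => by
        ext s
        exact intervalIntegral.integral_smul c _ }
    1 (fun γ => by
      rw [one_mul, ContinuousMap.norm_le _ (norm_nonneg _)]
      intro s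
      refine (intervalIntegral.norm_integral_le_of_norm_le_const (a := (0 : ℝ)) (b := s)
        (f := γ.IccExtend (by norm_num : (-1 : ℝ) ≤ 1))
        (fun τ _ => γ.norm_coe_le_norm _)).trans (mul_le_of_le_one_right (norm_nonneg _) ?_)
      rw [sub_zero]
      exact abs_le.2 s.2)

theorem primitiveCLM_apply (γ : C(Set.Icc (-1 : ℝ) 1, E)) (s : Set.Icc (-1 : ℝ) 1) :
    primitiveCLM E γ s = ∫ τ in (0 : ℝ)..s, γ.IccExtend (by norm_num : (-1 : ℝ) ≤ 1) τ := rfl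

/-- Multiplication by `s` as a self-map of `[-1, 1]`. -/
def scaleIcc (s : Set.Icc (-1 : ℝ) 1) : C(Set.Icc (-1 : ℝ) 1, Set.Icc (-1 : ℝ) 1) :=
  ⟨fun τ => ⟨s * τ, abs_le.1 (by
    rw [abs_mul]; exact mul_le_one₀ (abs_le.2 s.2) (abs_nonneg _) (abs_le.2 τ.2))⟩, by fun_prop⟩

theorem smul_primitiveCLM_comp_scaleIcc (γ : C(Set.Icc (-1 : ℝ) 1, E)) (s : Set.Icc (-1 : ℝ) 1) :
    (s : ℝ) • primitiveCLM E (γ.comp (scaleIcc s)) = (primitiveCLM E γ).comp (scaleIcc s) := by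
  ext τ
  have hsubst := intervalIntegral.smul_integral_comp_mul_left (a := 0) (b := τ)
    (γ.IccExtend (by norm_num : (-1 : ℝ) ≤ 1)) (s : ℝ)
  rw [mul_zero] at hsubst
  rw [ContinuousMap.smul_apply, ContinuousMap.comp_apply, primitiveCLM_apply, primitiveCLM_apply,
    show (scaleIcc s τ : ℝ) = s * τ from rfl, ← hsubst]
  congr 1
  refine intervalIntegral.integral_congr fun x hx => ?_
  have hx' : x ∈ Set.Icc (-1 : ℝ) 1 :=
    Set.uIcc_subset_Icc (by constructor <;> norm_num) τ.2 hx
  change γ.comp (scaleIcc s) (Set.projIcc _ _ _ x) = γ (Set.projIcc _ _ _ _)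
  rw [Set.projIcc_of_mem _ hx']
  exact congrArg γ (Set.projIcc_of_mem _ (scaleIcc s ⟨x, hx'⟩).2).symm

/-- The defect of the integral equation `γ s = x + t ∫₀ˢ v (γ τ) dτ`, as a function of the initial
value `x`, the time scale `t` and the curve `γ` on `[-1, 1]`: its zeros are the integral curves of
`t v` starting at `x`. -/
noncomputable def picardDefect (v : C(E, E)) (z : (E × ℝ) × C(Set.Icc (-1 : ℝ) 1, E)) :
    C(Set.Icc (-1 : ℝ) 1, E) :=
  z.2 - (ContinuousMap.const _ z.1.1 + z.1.2 • primitiveCLM E (v.comp z.2))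

variable {v : C(E, E)}

theorem picardDefect_scale {x : E} {t : ℝ} (γ : C(Set.Icc (-1 : ℝ) 1, E))
    (s : Set.Icc (-1 : ℝ) 1) : picardDefect v ((x, s * t), γ.comp (scaleIcc s)) =
      (picardDefect v ((x, t), γ)).comp (scaleIcc s) := by
  simp only [picardDefect, mul_comm (s : ℝ) t, mul_smul, ← ContinuousMap.comp_assoc,
    smul_primitiveCLM_comp_scaleIcc]
  rfl

theorem picardDefect_eq_zero_iff {x : E} {t : ℝ} {γ : C(Set.Icc (-1 : ℝ) 1, E)} :
    picardDefect v ((x, t), γ) = 0 ↔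
      γ = ContinuousMap.const _ x + t • primitiveCLM E (v.comp γ) :=
  sub_eq_zero

theorem hasDerivAt_of_picardDefect_eq_zero [CompleteSpace E] {x : E} {b t : ℝ}
    {γ : C(Set.Icc (-1 : ℝ) 1, E)} (hγ : picardDefect v ((x, b), γ) = 0) (ht : |t| < b) :
    HasDerivAt (fun τ => γ.IccExtend (by norm_num : (-1 : ℝ) ≤ 1) (τ / b))
      (v (γ.IccExtend (by norm_num : (-1 : ℝ) ≤ 1) (t / b))) t := by
  have hb : 0 < b := (abs_nonneg t).trans_lt ht
  set w : C(ℝ, E) := (v.comp γ).IccExtend (by norm_num : (-1 : ℝ) ≤ 1)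
  have hder : HasDerivAt (fun τ => x + b • ∫ σ in (0 : ℝ)..(τ / b), w σ) (w (t / b)) t := by
    refine ((((w.continuous.integral_hasStrictDerivAt 0 (t / b)).hasDerivAt.scomp t
      ((hasDerivAt_id t).div_const b)).const_smul b).const_add x).congr_deriv ?_
    rw [smul_smul, mul_one_div_cancel hb.ne', one_smul]
  refine hder.congr_of_eventuallyEq ?_
  filter_upwards [continuous_abs.continuousAt.eventually_lt_const ht] with τ hτ
  have hmem : τ / b ∈ Set.Icc (-1 : ℝ) 1 := by
    rw [Set.mem_Icc, ← abs_le, abs_div, abs_of_pos hb]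
    exact (div_le_one hb).2 hτ.le
  change γ (Set.projIcc _ _ _ _) = _
  rw [Set.projIcc_of_mem _ hmem]
  exact DFunLike.congr_fun (picardDefect_eq_zero_iff.1 hγ) ⟨τ / b, hmem⟩

theorem contDiff_picardDefect (hv : ContDiff ℝ ∞ v) : ContDiff ℝ ∞ (picardDefect v) := by
  have hintegral : ContDiff ℝ ∞ (fun z : (E × ℝ) × C(Set.Icc (-1 : ℝ) 1, E) =>
      primitiveCLM E (v.comp z.2)) :=
    (primitiveCLM E).contDiff.comp ((contDiff_continuousMap_comp v hv).comp contDiff_snd)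
  have hconst : ContDiff ℝ ∞ (fun z : (E × ℝ) × C(Set.Icc (-1 : ℝ) 1, E) =>
      ContinuousMap.const (Set.Icc (-1 : ℝ) 1) z.1.1) :=
    ContDiff.comp (g := ContinuousLinearMap.const ℝ (Set.Icc (-1 : ℝ) 1))
      (ContinuousLinearMap.contDiff _) (contDiff_fst.comp contDiff_fst)
  exact contDiff_snd.sub (hconst.add ((contDiff_snd.comp contDiff_fst).smul hintegral))

theorem hasFDerivAt_picardDefect (hv : ContDiff ℝ ∞ v) (x : E) (γ : C(Set.Icc (-1 : ℝ) 1, E)) :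
    HasFDerivAt (picardDefect v)
      ((-((ContinuousLinearMap.const ℝ (Set.Icc (-1 : ℝ) 1)).comp (.fst ℝ E ℝ) +
        (ContinuousLinearMap.snd ℝ E ℝ).smulRight (primitiveCLM E (v.comp γ)))).coprod (.id ℝ _))
      ((x, 0), γ) := by
  let C := C(Set.Icc (-1 : ℝ) 1, E)
  have hintegral : DifferentiableAt ℝ (fun z : (E × ℝ) × C => primitiveCLM E (v.comp z.2))
      ((x, 0), γ) :=
    ((primitiveCLM E).contDiff.comp
      ((contDiff_continuousMap_comp v hv).comp contDiff_snd)).contDiffAt.differentiableAt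
        (by simp : (∞ : WithTop ℕ∞) ≠ 0)
  have hconst := ((ContinuousLinearMap.const ℝ (Set.Icc (-1 : ℝ) 1)).comp
    ((ContinuousLinearMap.fst ℝ E ℝ).comp (.fst ℝ (E × ℝ) C))).hasFDerivAt (x := ((x, 0), γ))
  have htime := ((ContinuousLinearMap.snd ℝ E ℝ).comp (.fst ℝ (E × ℝ) C)).hasFDerivAt
    (x := ((x, 0), γ))
  refine (hasFDerivAt_snd.sub (hconst.add (htime.smul hintegral.hasFDerivAt))).congr_fderiv ?_
  ext z
  · simp
  · simp
  · simp [C]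

theorem exists_smoothNear_picardSolution [CompleteSpace E] (hv : ContDiff ℝ ∞ v) (p : E) :
    ∃ G : E × ℝ → C(Set.Icc (-1 : ℝ) 1, E), SmoothNear G (p, 0) ∧
      G (p, 0) = ContinuousMap.const _ p ∧
      ∀ᶠ z in 𝓝 ((p, 0), ContinuousMap.const _ p), picardDefect v z = 0 ↔ z.2 = G z.1 := by
  have hp : picardDefect v ((p, 0), ContinuousMap.const _ p) = 0 := by simp [picardDefect]
  obtain ⟨G, hG, hiff⟩ := exists_smoothNear_implicitFunction
    (SmoothNear.of_contDiff (contDiff_picardDefect hv)) (hasFDerivAt_picardDefect hv p _) hp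
  exact ⟨G, hG, (hiff.self_of_nhds.1 hp).symm, hiff⟩

/-- A smooth local flow of the vector field `v` near `p`: `φ (x, t)` is the position at time `t` of
the integral curve starting at `x`. -/
structure IsSmoothFlowNear (v : E → E) (p : E) (φ : E × ℝ → E) : Prop where
  smoothNear : SmoothNear φ (p, 0)
  apply_zero : ∀ᶠ x in 𝓝 p, φ (x, 0) = x
  hasDerivAt : ∀ᶠ q in 𝓝 (p, (0 : ℝ)), HasDerivAt (fun t => φ (q.1, t)) (v (φ q)) q.2

/- Local uniqueness of the zeros of `picardDefect` gives `G (x, s t) = G (x, t) ∘ (s · )`. -/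
theorem eventually_picardSolution_scale {p : E} {G : E × ℝ → C(Set.Icc (-1 : ℝ) 1, E)}
    (hG : ContinuousAt G (p, 0)) (hGp : G (p, 0) = ContinuousMap.const _ p)
    (hiff : ∀ᶠ z in 𝓝 ((p, 0), ContinuousMap.const _ p), picardDefect v z = 0 ↔ z.2 = G z.1) :
    ∀ᶠ q in 𝓝 (p, (0 : ℝ)), picardDefect v (q, G q) = 0 ∧
      ∀ s : Set.Icc (-1 : ℝ) 1, G (q.1, s * q.2) = (G q).comp (scaleIcc s) := by
  obtain ⟨δ, hδ, hball⟩ := Metric.eventually_nhds_iff.1 hiff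
  have hgraph : Filter.Tendsto (fun q => (q, G q)) (𝓝 (p, 0))
      (𝓝 ((p, 0), ContinuousMap.const _ p)) :=
    Filter.tendsto_id.prodMk_nhds (hGp ▸ hG)
  filter_upwards [hgraph.eventually (Metric.ball_mem_nhds _ hδ)] with ⟨x, t⟩ hq
  have hzero : picardDefect v ((x, t), G (x, t)) = 0 := (hball hq).2 rfl
  refine ⟨hzero, fun s => ((hball (y := ((x, s * t), (G (x, t)).comp (scaleIcc s))) ?_).1 ?_).symm⟩
  · rw [Prod.dist_eq, Prod.dist_eq, max_lt_iff, max_lt_iff] at hq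
    rw [Prod.dist_eq, Prod.dist_eq, max_lt_iff, max_lt_iff]
    refine ⟨⟨hq.1.1, lt_of_le_of_lt ?_ hq.1.2⟩, lt_of_le_of_lt ?_ hq.2⟩
    · simpa only [dist_zero_right, norm_mul, Real.norm_eq_abs (s : ℝ)] using
        mul_le_of_le_one_left (norm_nonneg _) (abs_le.2 s.2)
    · exact (ContinuousMap.dist_le dist_nonneg).2 fun τ =>
        ContinuousMap.dist_apply_le_dist (g := ContinuousMap.const _ p) (scaleIcc s τ)
  · rw [picardDefect_scale, hzero, ContinuousMap.zero_comp]

theorem exists_isSmoothFlowNear [CompleteSpace E] {v : E → E} (hv : ContDiff ℝ ∞ v) (p : E) :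
    ∃ φ : E × ℝ → E, IsSmoothFlowNear v p φ := by
  let vc : C(E, E) := ⟨v, hv.continuous⟩
  obtain ⟨G, hG, hGp, hiff⟩ := exists_smoothNear_picardSolution (v := vc) hv p
  have hscale := eventually_picardSolution_scale hG.continuousAt hGp hiff
  let one : Set.Icc (-1 : ℝ) 1 := ⟨1, by norm_num, le_rfl⟩
  refine ⟨fun q => G q one, ?_, ?_, ?_⟩
  · exact hG.mono fun q hq => ContDiffAt.comp (g := ContinuousMap.evalCLM ℝ one) q
      (ContinuousLinearMap.contDiff _).contDiffAt hq
  · filter_upwards [(by fun_prop : Continuous fun x : E => (x, (0 : ℝ))).continuousAt.eventually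
      hscale] with x hx
    rw [picardDefect_eq_zero_iff.1 hx.1, zero_smul, add_zero, ContinuousMap.const_apply]
  obtain ⟨δ, hδ, hball⟩ := Metric.eventually_nhds_iff.1 hscale
  filter_upwards [Metric.ball_mem_nhds (p, (0 : ℝ)) (half_pos hδ)] with ⟨x, t⟩ hq
  rw [Metric.mem_ball, Prod.dist_eq, max_lt_iff, dist_zero_right, Real.norm_eq_abs] at hq
  set b := δ / 2 with hb
  have hb0 : 0 < b := half_pos hδ
  obtain ⟨hzero, hcurve⟩ := hball (y := (x, b)) (by
    rw [Prod.dist_eq, max_lt_iff, dist_zero_right, Real.norm_of_nonneg hb0.le]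
    exact ⟨hq.1.trans (by linarith), by linarith⟩)
  have heq (τ : ℝ) (hτ : |τ| < b) :
      G (x, τ) one = (G (x, b)).IccExtend (by norm_num : (-1 : ℝ) ≤ 1) (τ / b) := by
    have hmem : τ / b ∈ Set.Icc (-1 : ℝ) 1 := by
      rw [Set.mem_Icc, ← abs_le, abs_div, abs_of_pos hb0]
      exact (div_le_one hb0).2 hτ.le
    have h := DFunLike.congr_fun (hcurve ⟨τ / b, hmem⟩) one
    simp only [div_mul_cancel₀ _ hb0.ne'] at h
    rw [h]
    change G (x, b) _ = G (x, b) (Set.projIcc _ _ _ _)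
    rw [Set.projIcc_of_mem _ hmem]
    exact congrArg _ (Subtype.ext (mul_one _))
  change HasDerivAt (fun τ => G (x, τ) one) (v (G (x, t) one)) t
  rw [heq t hq.2]
  refine (hasDerivAt_of_picardDefect_eq_zero hzero hq.2).congr_of_eventuallyEq ?_
  filter_upwards [continuous_abs.continuousAt.eventually_lt_const hq.2] with τ hτ using heq τ hτ

theorem IsSmoothFlowNear.hasFDerivAt {v : E → E} {p : E} {φ : E × ℝ → E}
    (hφ : IsSmoothFlowNear v p φ) : HasFDerivAt φ ((ContinuousLinearMap.id ℝ E).coprod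
      ((ContinuousLinearMap.id ℝ ℝ).smulRight (v p))) (p, 0) := by
  have hd := (hφ.smoothNear.contDiffAt.differentiableAt (by simp)).hasFDerivAt
  have hspace : (fderiv ℝ φ (p, 0)).comp (.inl ℝ E ℝ) = .id ℝ E :=
    (hd.comp p ((hasFDerivAt_id p).prodMk (hasFDerivAt_const 0 p))).unique
      ((hasFDerivAt_id p).congr_of_eventuallyEq hφ.apply_zero)
  have htime : fderiv ℝ φ (p, 0) (0, 1) = v p := by
    have := hφ.hasDerivAt.self_of_nhds
    rw [hφ.apply_zero.self_of_nhds] at this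
    exact (hd.comp_hasDerivAt (0 : ℝ)
      ((hasDerivAt_const (0 : ℝ) p).prodMk (hasDerivAt_id _))).unique this
  refine hd.congr_fderiv (ContinuousLinearMap.ext fun ⟨x, t⟩ => ?_)
  have hsplit : ((x, t) : E × ℝ) = (x, 0) + t • (0, 1) := by simp
  have hx : fderiv ℝ φ (p, 0) (x, 0) = x := DFunLike.congr_fun hspace x
  rw [hsplit, map_add, map_smul, hx, htime]
  simp

theorem IsSmoothFlowNear.eventually_fderiv_apply {v : E → E} {p : E} {φ : E × ℝ → E}
    (hφ : IsSmoothFlowNear v p φ) : ∀ᶠ q in 𝓝 (p, 0), fderiv ℝ φ q (0, 1) = v (φ q) := by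
  filter_upwards [hφ.smoothNear.eventually_differentiableAt, hφ.hasDerivAt] with q hd hq
  exact (hd.hasFDerivAt.comp_hasDerivAt q.2
    ((hasDerivAt_const q.2 q.1).prodMk (hasDerivAt_id _))).unique hq

theorem SmoothNear.exists_flowBox [FiniteDimensional ℝ E] {V : E → E} {p w : E}
    (hV : SmoothNear V p) (hp : V p ≠ 0) (hw : w ≠ 0) :
    ∃ e : OpenPartialHomeomorph E E, IsSmoothLocalDiffeo e ∧ 0 ∈ e.source ∧ e 0 = p ∧
      ∀ᶠ x in 𝓝 0, fderiv ℝ e x w = V (e x) := by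
  have : CompleteSpace E := FiniteDimensional.complete ℝ E
  obtain ⟨v, hv, hvV⟩ := hV.exists_contDiff_eventuallyEq
  obtain ⟨φ, hφ⟩ := exists_isSmoothFlowNear hv p
  obtain ⟨L, hL⟩ := SeparatingDual.exists_continuousLinearEquiv_apply_eq (R := ℝ) hw hp
  obtain ⟨ℓ, hℓ⟩ := SeparatingDual.exists_eq_one (R := ℝ) hw
  -- The flow is applied to the hypersurface `p + L (ker ℓ)`, with `ℓ` as time.
  let A : E →L[ℝ] E × ℝ := (L.toContinuousLinearMap.comp (.id ℝ E - ℓ.smulRight w)).prod ℓ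
  have hAw : A w = (0, 1) := by simp [A, hℓ]
  have hA (y : E) : HasFDerivAt (fun y => (p, (0 : ℝ)) + A y) A y := A.hasFDerivAt.const_add _
  have hA0 : (p, (0 : ℝ)) + A 0 = (p, 0) := by simp
  have hφA : SmoothNear φ ((p, 0) + A 0) := by rw [hA0]; exact hφ.smoothNear
  have hΦ : SmoothNear (fun y => φ ((p, 0) + A y)) 0 :=
    hφA.comp (f := fun y => (p, 0) + A y) (.of_contDiff (contDiff_const.add A.contDiff))
  have hΦ0 : φ ((p, 0) + A 0) = p := by rw [hA0, hφ.apply_zero.self_of_nhds]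
  have hflow : ∀ᶠ y in 𝓝 0, fderiv ℝ (fun y => φ ((p, 0) + A y)) y w = V (φ ((p, 0) + A y)) := by
    have hAt := (hA 0).continuousAt
    filter_upwards [hAt.eventually (hA0 ▸ hφ.eventually_fderiv_apply),
      hAt.eventually hφA.eventually_differentiableAt,
      hΦ.continuousAt.eventually (hΦ0 ▸ hvV)] with y hy hd hyv
    have hderiv : HasFDerivAt (fun y => φ ((p, 0) + A y)) _ y := hd.hasFDerivAt.comp y (hA y)
    rw [hderiv.fderiv, ContinuousLinearMap.comp_apply, hAw, hy, hyv]
  have hL' : HasFDerivAt (fun y => φ ((p, 0) + A y)) (L : E →L[ℝ] E) 0 := by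
    refine ((hA0 ▸ hφ.hasFDerivAt).comp 0 (hA 0)).congr_fderiv (ContinuousLinearMap.ext fun y => ?_)
    simp [A, hvV.self_of_nhds, ← hL]
  obtain ⟨e, he0, he, hsmooth⟩ := hΦ.exists_isSmoothLocalDiffeo hL'
  rw [← he] at hflow
  refine ⟨e, hsmooth, he0, by rw [he]; exact hΦ0, hflow.mono fun y hy => by rw [hy, he]⟩

end Flow

/-! ### A convolution equation with rapidly decreasing coefficients -/

section Convolution

open scoped ENNReal NNReal

/-- Rapidly decreasing families indexed by a normed group: those summable against all polynomial
weights. -/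
def RapidlyDecreasing {ι F : Type*} [Norm ι] [Norm F] (a : ι → F) : Prop :=
  ∀ s : ℕ, Summable fun n => (1 + ‖n‖) ^ s * ‖a n‖

theorem RapidlyDecreasing.summable_norm {ι F : Type*} [Norm ι] [Norm F] {a : ι → F}
    (ha : RapidlyDecreasing a) : Summable fun n => ‖a n‖ := by
  simpa only [pow_zero, one_mul] using ha 0

variable {ι R : Type*} [SeminormedAddCommGroup ι]

theorem RapidlyDecreasing.of_norm_le {F F' : Type*} [SeminormedAddCommGroup F]
    [SeminormedAddCommGroup F'] {a : ι → F} {b : ι → F'} (ha : RapidlyDecreasing a) (C : ℝ)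
    (h : ∀ n, ‖b n‖ ≤ C * ‖a n‖) : RapidlyDecreasing b := by
  intro s
  refine Summable.of_nonneg_of_le (fun n => by positivity) (fun n => ?_) ((ha s).mul_left C)
  calc (1 + ‖n‖) ^ s * ‖b n‖ ≤ (1 + ‖n‖) ^ s * (C * ‖a n‖) := by gcongr; exact h n
    _ = C * ((1 + ‖n‖) ^ s * ‖a n‖) := by ring

theorem tsum_ofReal_mul_enorm {α F : Type*} [SeminormedAddCommGroup F] {w : α → ℝ}
    (hw : ∀ n, 0 ≤ w n) {a : α → F} (h : Summable fun n => w n * ‖a n‖) :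
    ∑' n, ENNReal.ofReal (w n) * ‖a n‖ₑ = ENNReal.ofReal (∑' n, w n * ‖a n‖) := by
  rw [ENNReal.ofReal_tsum_of_nonneg (fun n => mul_nonneg (hw n) (norm_nonneg _)) h]
  exact tsum_congr fun n => by rw [ENNReal.ofReal_mul (hw n), ofReal_norm]

theorem summable_mul_norm_of_tsum_ne_top {α F : Type*} [SeminormedAddCommGroup F] {w : α → ℝ}
    (hw : ∀ n, 0 ≤ w n) {a : α → F} (h : ∑' n, ENNReal.ofReal (w n) * ‖a n‖ₑ ≠ ⊤) :
    Summable fun n => w n * ‖a n‖ := by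
  refine Summable.of_enorm (ne_top_of_le_ne_top h (ENNReal.tsum_le_tsum fun n => ?_))
  rw [enorm_mul, enorm_norm, Real.enorm_of_nonneg (hw n)]

theorem one_add_mul_norm_pow_submul {δ : ℝ} (hδ : 0 ≤ δ) (s : ℕ) (m n : ι) :
    (1 + δ * ‖m + n‖) ^ s ≤ (1 + δ * ‖m‖) ^ s * (1 + δ * ‖n‖) ^ s := by
  rw [← mul_pow]
  refine pow_le_pow_left₀ (by positivity) ?_ s
  have hadd := mul_le_mul_of_nonneg_left (norm_add_le m n) hδ
  have hprod : 0 ≤ (δ * ‖m‖) * (δ * ‖n‖) := by positivity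
  nlinarith

theorem RapidlyDecreasing.exists_small_weight {F : Type*} [SeminormedAddCommGroup F] {a : ι → F}
    (ha : RapidlyDecreasing a) (s : ℕ) {C B : ℝ} (hB : C * ∑' n, ‖a n‖ < B) :
    ∃ δ : ℝ, 0 < δ ∧ δ ≤ 1 ∧ (Summable fun n => (1 + δ * ‖n‖) ^ s * ‖a n‖) ∧
      C * ∑' n, (1 + δ * ‖n‖) ^ s * ‖a n‖ < B := by
  have hle {δ : ℝ} (hδ : 0 < δ ∧ δ ≤ 1) (n : ι) :
      (1 + δ * ‖n‖) ^ s * ‖a n‖ ≤ (1 + ‖n‖) ^ s * ‖a n‖ := by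
    have := hδ.1.le
    gcongr
    exact mul_le_of_le_one_left (norm_nonneg _) hδ.2
  have hunit : ∀ᶠ δ : ℝ in 𝓝[>] 0, 0 < δ ∧ δ ≤ 1 := Ioc_mem_nhdsGT zero_lt_one
  have hlim : Filter.Tendsto (fun δ : ℝ => ∑' n, (1 + δ * ‖n‖) ^ s * ‖a n‖) (𝓝[>] 0)
      (𝓝 (∑' n, ‖a n‖)) := by
    refine tendsto_tsum_of_dominated_convergence (ha s) (fun n => ?_) ?_
    · have hcont : Continuous fun δ : ℝ => (1 + δ * ‖n‖) ^ s * ‖a n‖ := by fun_prop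
      simpa using (hcont.tendsto 0).mono_left nhdsWithin_le_nhds
    · filter_upwards [hunit] with δ hδ n
      have := hδ.1.le
      rw [Real.norm_of_nonneg (by positivity)]
      exact hle hδ n
  obtain ⟨δ, hδ, hlt⟩ := (hunit.and ((hlim.const_mul C).eventually_lt_const hB)).exists
  have := hδ.1.le
  exact ⟨δ, hδ.1, hδ.2, .of_nonneg_of_le (fun n => by positivity) (hle hδ) (ha s), hlt⟩

variable [NormedDivisionRing R]

/-- The terms of the Neumann series of the convolution equation `W = a + a * (T W)`. -/
noncomputable def neumannTerm (a T : ι → R) : ℕ → ι → R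
  | 0 => a
  | k + 1 => fun n => ∑' m, a (n - m) * (T m * neumannTerm a T k m)

/-- The solution of the convolution equation `W = a + a * (T W)` by its Neumann series. -/
noncomputable def neumannSeries (a T : ι → R) (n : ι) : R :=
  ∑' k, neumannTerm a T k n

variable {a T : ι → R} {w : ι → ℝ≥0∞}

theorem tsum_weight_enorm_neumannTerm_le {C : ℝ≥0∞} (hT : ∀ n, ‖T n‖ₑ ≤ C)
    (hw : ∀ m n, w (m + n) ≤ w m * w n) (k : ℕ) :
    ∑' n, w n * ‖neumannTerm a T k n‖ₑ ≤
      (C * ∑' n, w n * ‖a n‖ₑ) ^ k * ∑' n, w n * ‖a n‖ₑ := by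
  induction k with
  | zero => rw [pow_zero, one_mul]; rfl
  | succ k ih =>
    set A := ∑' n, w n * ‖a n‖ₑ
    have hterm (n m : ι) : w n * ‖a (n - m) * (T m * neumannTerm a T k m)‖ₑ ≤
        (w (n - m) * ‖a (n - m)‖ₑ) * (C * (w m * ‖neumannTerm a T k m‖ₑ)) := by
      have hwn : w n ≤ w (n - m) * w m := by simpa using hw (n - m) m
      calc w n * ‖a (n - m) * (T m * neumannTerm a T k m)‖ₑ
          ≤ (w (n - m) * w m) * (‖a (n - m)‖ₑ * (C * ‖neumannTerm a T k m‖ₑ)) := by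
            rw [enorm_mul, enorm_mul]; gcongr; exact hT m
        _ = _ := by ring
    calc ∑' n, w n * ‖neumannTerm a T (k + 1) n‖ₑ
        ≤ ∑' n, ∑' m, w n * ‖a (n - m) * (T m * neumannTerm a T k m)‖ₑ := by
          refine ENNReal.tsum_le_tsum fun n => ?_
          rw [ENNReal.tsum_mul_left]
          exact mul_le_mul_right enorm_tsum_le_tsum_enorm _
      _ ≤ ∑' n, ∑' m, (w (n - m) * ‖a (n - m)‖ₑ) * (C * (w m * ‖neumannTerm a T k m‖ₑ)) :=
          ENNReal.tsum_le_tsum fun n => ENNReal.tsum_le_tsum (hterm n)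
      _ = ∑' m, A * (C * (w m * ‖neumannTerm a T k m‖ₑ)) := by
          rw [ENNReal.tsum_comm]
          refine tsum_congr fun m => ?_
          rw [ENNReal.tsum_mul_right]
          exact congrArg (· * _) ((Equiv.subRight m).tsum_eq (fun n => w n * ‖a n‖ₑ))
      _ ≤ A * (C * ((C * A) ^ k * A)) := by
          rw [ENNReal.tsum_mul_left, ENNReal.tsum_mul_left]; gcongr
      _ = (C * A) ^ (k + 1) * A := by ring

theorem tsum_tsum_weight_enorm_neumannTerm_le {C : ℝ≥0∞} (hT : ∀ n, ‖T n‖ₑ ≤ C)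
    (hw : ∀ m n, w (m + n) ≤ w m * w n) :
    ∑' k, ∑' n, w n * ‖neumannTerm a T k n‖ₑ ≤
      (1 - C * ∑' n, w n * ‖a n‖ₑ)⁻¹ * ∑' n, w n * ‖a n‖ₑ := by
  rw [← ENNReal.tsum_geometric, ← ENNReal.tsum_mul_right]
  exact ENNReal.tsum_le_tsum (tsum_weight_enorm_neumannTerm_le hT hw)

theorem tsum_weight_enorm_neumannSeries_le {C : ℝ≥0∞} (hT : ∀ n, ‖T n‖ₑ ≤ C)
    (hw : ∀ m n, w (m + n) ≤ w m * w n) :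
    ∑' n, w n * ‖neumannSeries a T n‖ₑ ≤
      (1 - C * ∑' n, w n * ‖a n‖ₑ)⁻¹ * ∑' n, w n * ‖a n‖ₑ := by
  refine le_trans ?_ (tsum_tsum_weight_enorm_neumannTerm_le hT hw)
  rw [ENNReal.tsum_comm]
  refine ENNReal.tsum_le_tsum fun n => ?_
  rw [ENNReal.tsum_mul_left]
  exact mul_le_mul_right enorm_tsum_le_tsum_enorm _

theorem inv_one_sub_mul_ne_top {c A : ℝ≥0∞} (hc : c * A < 1) (hA : A ≠ ⊤) :
    (1 - c * A)⁻¹ * A ≠ ⊤ :=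
  ENNReal.mul_ne_top (ENNReal.inv_ne_top.2 (tsub_pos_of_lt hc).ne') hA

/- For every exponent `s`, the weight `(1 + δ‖n‖) ^ s` with small `δ` is submultiplicative and still
makes the weighted norm of `a` small, so that the Neumann series converges in the weighted norm. -/
theorem rapidlyDecreasing_neumannSeries {C : ℝ≥0} (ha : RapidlyDecreasing a)
    (hT : ∀ n, ‖T n‖ₑ ≤ C) (hsmall : C * ∑' n, ‖a n‖ < 1) :
    RapidlyDecreasing (neumannSeries a T) := by
  intro s
  obtain ⟨δ, hδ, hδ1, hsum, hlt⟩ := ha.exists_small_weight s hsmall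
  have hweight (n : ι) : 0 ≤ (1 + δ * ‖n‖) ^ s := by positivity
  have hbound := tsum_weight_enorm_neumannSeries_le (a := a)
    (w := fun n => .ofReal ((1 + δ * ‖n‖) ^ s)) hT fun m n => by
      rw [← ENNReal.ofReal_mul (hweight m)]
      exact ENNReal.ofReal_le_ofReal (one_add_mul_norm_pow_submul hδ.le s m n)
  rw [tsum_ofReal_mul_enorm hweight hsum] at hbound
  have hsum' := summable_mul_norm_of_tsum_ne_top hweight <| ne_top_of_le_ne_top
    (inv_one_sub_mul_ne_top (by
      rwa [← ENNReal.ofReal_coe_nnreal, ← ENNReal.ofReal_mul C.coe_nonneg, ENNReal.ofReal_lt_one])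
      ENNReal.ofReal_ne_top) hbound
  refine .of_nonneg_of_le (fun n => by positivity) (fun n => ?_) (hsum'.mul_left (δ ^ s)⁻¹)
  rw [← mul_assoc, ← inv_pow, ← mul_pow, mul_add, inv_mul_cancel_left₀ hδ.ne', mul_one]
  gcongr
  exact (one_le_inv₀ hδ).2 hδ1

variable [CompleteSpace R]

theorem neumannSeries_eq {C : ℝ≥0∞} (hT : ∀ n, ‖T n‖ₑ ≤ C) (ha : ∑' n, ‖a n‖ₑ ≠ ⊤)
    (hsmall : C * ∑' n, ‖a n‖ₑ < 1) (hC : C ≠ ⊤) (n : ι) :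
    neumannSeries a T n = a n + ∑' m, a (n - m) * (T m * neumannSeries a T m) := by
  set A := ∑' n, ‖a n‖ₑ
  have htotal : ∑' k, ∑' m, ‖neumannTerm a T k m‖ₑ ≠ ⊤ := by
    have hle := tsum_tsum_weight_enorm_neumannTerm_le (a := a) (w := 1) hT (by simp)
    simp only [Pi.one_apply, one_mul] at hle
    exact ne_top_of_le_ne_top (inv_one_sub_mul_ne_top hsmall ha) hle
  have hterms : Summable fun k => neumannTerm a T k n :=
    .of_enorm (ne_top_of_le_ne_top htotal (ENNReal.tsum_le_tsum fun _ => ENNReal.le_tsum n))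
  have hdouble : Summable (Function.uncurry fun (k : ℕ) (m : ι) =>
      a (n - m) * (T m * neumannTerm a T k m)) := by
    refine .of_enorm (ne_top_of_le_ne_top (b := A * (C * ∑' k, ∑' m, ‖neumannTerm a T k m‖ₑ))
      (ENNReal.mul_ne_top ha (ENNReal.mul_ne_top hC htotal)) ?_)
    rw [ENNReal.tsum_prod']
    simp only [← ENNReal.tsum_mul_left, Function.uncurry_apply_pair, enorm_mul]
    gcongr with k m
    · exact ENNReal.le_tsum (n - m)
    · exact hT m
  calc neumannSeries a T n
      = a n + ∑' k, ∑' m, a (n - m) * (T m * neumannTerm a T k m) := hterms.tsum_eq_zero_add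
    _ = a n + ∑' m, ∑' k, a (n - m) * (T m * neumannTerm a T k m) := by rw [hdouble.tsum_comm]
    _ = a n + ∑' m, a (n - m) * (T m * neumannSeries a T m) := by
        simp only [tsum_mul_left, neumannSeries]

theorem RapidlyDecreasing.exists_convolution_solution {C : ℝ≥0} (ha : RapidlyDecreasing a)
    (hT : ∀ n, ‖T n‖ ≤ C) (hsmall : C * ∑' n, ‖a n‖ < 1 / 2) :
    ∃ W : ι → R, RapidlyDecreasing W ∧ (∀ n, W n = a n + ∑' m, a (n - m) * (T m * W m)) ∧
      C * ∑' n, ‖W n‖ < 1 := by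
  have hT' (n : ι) : ‖T n‖ₑ ≤ C := by exact_mod_cast hT n
  have hA : ∑' n, ‖a n‖ₑ = ENNReal.ofReal (∑' n, ‖a n‖) := by
    simpa using tsum_ofReal_mul_enorm (w := 1) (fun _ => zero_le_one)
      (by simpa using ha.summable_norm)
  set A := ∑' n, ‖a n‖
  have : 0 ≤ A := tsum_nonneg fun n => norm_nonneg _
  have hCA : C * ∑' n, ‖a n‖ₑ = ENNReal.ofReal (C * A) := by
    rw [hA, ENNReal.ofReal_mul C.coe_nonneg, ENNReal.ofReal_coe_nnreal]
  have hW := rapidlyDecreasing_neumannSeries ha hT' (by linarith)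
  refine ⟨_, hW, neumannSeries_eq hT' (hA ▸ ENNReal.ofReal_ne_top)
    (by rw [hCA, ENNReal.ofReal_lt_one]; linarith) ENNReal.coe_ne_top, ?_⟩
  have hbound := tsum_weight_enorm_neumannSeries_le (a := a) (w := 1) hT' (by simp)
  have hpos : 0 < 1 - C * A := by linarith
  have hWsum : ∑' n, ‖neumannSeries a T n‖ₑ = ENNReal.ofReal (∑' n, ‖neumannSeries a T n‖) := by
    simpa using tsum_ofReal_mul_enorm (w := 1) (fun _ => zero_le_one)
      (by simpa using hW.summable_norm)
  simp only [Pi.one_apply, one_mul] at hbound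
  rw [hCA, hA, hWsum, ← ENNReal.ofReal_one, ← ENNReal.ofReal_sub _ (by positivity),
    ← ENNReal.ofReal_inv_of_pos hpos, ← ENNReal.ofReal_mul (by positivity),
    ENNReal.ofReal_le_ofReal_iff (by positivity)] at hbound
  calc C * ∑' n, ‖neumannSeries a T n‖ ≤ C * ((1 - C * A)⁻¹ * A) := by gcongr
    _ = (C * A) / (1 - C * A) := by rw [div_eq_inv_mul]; ring
    _ < 1 := by rw [div_lt_one hpos]; linarith

end Convolution

/-! ### Fourier series of smooth functions with small support -/

section FourierSeries

open scoped FourierTransform SchwartzMap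
open MeasureTheory

variable {d : Type*}

/-- The function on the torus that agrees on the cube `(-1/2, 1/2]ᵈ` with a given function on
`ℝᵈ`. -/
noncomputable def torusLift (f : EuclideanSpace ℝ d → ℂ) (t : UnitAddTorus d) : ℂ :=
  f (WithLp.toLp 2 fun i => (AddCircle.equivIoc 1 (-1 / 2 : ℝ) (t i) : ℝ))

theorem torusLift_coe (f : EuclideanSpace ℝ d → ℂ) {x : d → ℝ}
    (hx : ∀ i, x i ∈ Set.Ioc (-1 / 2 : ℝ) (-1 / 2 + 1)) :
    torusLift f (fun i => (x i : UnitAddCircle)) = f (WithLp.toLp 2 x) :=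
  congrArg f (congrArg _ (funext fun i => AddCircle.equivIoc_coe_of_mem (hx i)))

variable [Fintype d]

/-- The point of `ℝᵈ` with the integral coordinates `n`. -/
noncomputable def latticePoint (n : d → ℤ) : EuclideanSpace ℝ d :=
  WithLp.toLp 2 fun i => (n i : ℝ)

/-- The linear functional `x ↦ 2π ⟨n, x⟩`. -/
noncomputable def phase (n : d → ℤ) : EuclideanSpace ℝ d →L[ℝ] ℝ :=
  (2 * Real.pi) • innerSL ℝ (latticePoint n)

theorem phase_apply (n : d → ℤ) (x : EuclideanSpace ℝ d) :
    phase n x = 2 * Real.pi * ∑ i, n i * x i := by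
  simp [phase, latticePoint, PiLp.inner_apply, mul_comm]

/-- The exponential monomial `exp (2πi ⟨n, x⟩)`. -/
noncomputable def expMonomial (n : d → ℤ) (x : EuclideanSpace ℝ d) : ℂ :=
  Complex.exp (phase n x * Complex.I)

theorem expMonomial_add (m n : d → ℤ) (x : EuclideanSpace ℝ d) :
    expMonomial (m + n) x = expMonomial m x * expMonomial n x := by
  rw [expMonomial, expMonomial, expMonomial, ← Complex.exp_add, phase_apply, phase_apply,
    phase_apply, ← add_mul, ← Complex.ofReal_add, ← mul_add, ← Finset.sum_add_distrib]
  simp only [Pi.add_apply, Int.cast_add, add_mul]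

theorem norm_expMonomial (n : d → ℤ) (x : EuclideanSpace ℝ d) : ‖expMonomial n x‖ = 1 :=
  Complex.norm_exp_ofReal_mul_I _

theorem mFourier_coe (n : d → ℤ) (x : d → ℝ) :
    UnitAddTorus.mFourier n (fun i => (x i : UnitAddCircle)) =
      expMonomial n (WithLp.toLp 2 x) := by
  simp only [UnitAddTorus.mFourier, ContinuousMap.coe_mk, fourier_coe_apply, ← Complex.exp_sum,
    expMonomial, phase_apply]
  congr 1
  push_cast
  rw [Finset.mul_sum, Finset.sum_mul]
  exact Finset.sum_congr rfl fun i _ => by ring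

theorem apply_mem_Ioc_of_norm_le {r : ℝ} (hr : r < 1 / 2) {x : EuclideanSpace ℝ d} (hx : ‖x‖ ≤ r)
    (i : d) : x i ∈ Set.Ioc (-1 / 2 : ℝ) (-1 / 2 + 1) := by
  have hi := abs_le.1 ((PiLp.norm_apply_le x i).trans hx)
  constructor <;> linarith

variable {f : EuclideanSpace ℝ d → ℂ} {r : ℝ}

theorem continuous_torusLift (hf : Continuous f) (hr : r < 1 / 2)
    (hsupp : Function.support f ⊆ Metric.closedBall 0 r) : Continuous (torusLift f) := by
  refine continuous_iff_continuousAt.2 fun t => ?_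
  by_cases ht : ∀ i, t i ≠ ((-1 / 2 : ℝ) : UnitAddCircle)
  · refine (hf.comp (PiLp.continuous_toLp 2 _)).continuousAt.comp (continuousAt_pi.2 fun i => ?_)
    exact continuous_subtype_val.continuousAt.comp (ContinuousAt.comp
      (f := fun t : UnitAddTorus d => t i) (AddCircle.continuousAt_equivIoc 1 _ (ht i))
      (continuous_apply i).continuousAt)
  push Not at ht
  obtain ⟨i, hi⟩ := ht
  have hti : r < ‖t i‖ := by
    have hhalf : ‖((1 / 2 : ℝ) : UnitAddCircle)‖ = 1 / 2 := by
      simpa using AddCircle.norm_half_period_eq (1 : ℝ)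
    rwa [hi, neg_div, AddCircle.coe_neg, norm_neg, hhalf]
  refine (continuousAt_const (y := (0 : ℂ))).congr ?_
  have hnorm : Continuous fun s : UnitAddTorus d => ‖s i‖ := (continuous_apply i).norm
  filter_upwards [hnorm.continuousAt.eventually_const_lt hti] with s hs
  by_contra hne
  refine hs.not_ge ?_
  rw [← AddCircle.coe_equivIoc (a := (-1 / 2 : ℝ)) (y := s i)]
  exact (QuotientAddGroup.norm_mk_le_norm ..).trans
    ((PiLp.norm_apply_le _ i).trans (mem_closedBall_zero_iff.1 (hsupp (Ne.symm hne))))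

theorem mFourierCoeff_torusLift (hr : r < 1 / 2)
    (hsupp : Function.support f ⊆ Metric.closedBall 0 r) (n : d → ℤ) :
    UnitAddTorus.mFourierCoeff (torusLift f) n = 𝓕 f (latticePoint n) := by
  let cube := {x : d → ℝ | ∀ i, x i ∈ Set.Ioc (-1 / 2 : ℝ) (-1 / 2 + 1)}
  have hcube : MeasurableSet cube := MeasurableSet.univ_pi' fun _ => measurableSet_Ioc
  have hcongr : ∀ x ∈ cube, UnitAddTorus.mFourier (-n) (fun i => (x i : UnitAddCircle)) •
      torusLift f (fun i => (x i : UnitAddCircle)) =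
        expMonomial (-n) (WithLp.toLp 2 x) • f (WithLp.toLp 2 x) := fun x hx => by
    rw [torusLift_coe f hx, mFourier_coe]
  rw [UnitAddTorus.mFourierCoeff_eq_integral _ _ (fun _ => -1 / 2), Real.fourier_eq',
    setIntegral_congr_fun hcube hcongr, setIntegral_eq_integral_of_forall_compl_eq_zero,
    ← (EuclideanSpace.volume_preserving_symm_measurableEquiv_toLp d).symm.integral_comp
      (MeasurableEquiv.toLp 2 (d → ℝ)).measurableEmbedding]
  · refine integral_congr_ae (.of_forall fun x => congrArg (· • _) ?_)
    change Complex.exp _ = Complex.exp (((-2 * Real.pi *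
      inner ℝ (WithLp.toLp 2 x) (latticePoint n) : ℝ) : ℂ) * Complex.I)
    simp [phase_apply, latticePoint, PiLp.inner_apply]
  · intro x hx
    by_contra hne
    exact hx (apply_mem_Ioc_of_norm_le hr
      (mem_closedBall_zero_iff.1 (hsupp (right_ne_zero_of_smul hne))))

theorem hasSum_fourier_expMonomial (hf : Continuous f) (hr : r < 1 / 2)
    (hsupp : Function.support f ⊆ Metric.closedBall 0 r)
    (hs : Summable fun n : d → ℤ => 𝓕 f (latticePoint n)) {x : EuclideanSpace ℝ d} (hx : ‖x‖ ≤ r) :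
    HasSum (fun n => 𝓕 f (latticePoint n) * expMonomial n x) (f x) := by
  have hcoeff := funext (mFourierCoeff_torusLift hr hsupp)
  have hsum := UnitAddTorus.hasSum_mFourier_series_apply_of_summable
    (f := ⟨torusLift f, continuous_torusLift hf hr hsupp⟩)
    (by rwa [ContinuousMap.coe_mk, hcoeff]) (fun i => (x i : UnitAddCircle))
  rw [ContinuousMap.coe_mk, hcoeff, torusLift_coe f (x := x) (apply_mem_Ioc_of_norm_le hr hx)]
    at hsum
  simpa only [mFourier_coe, smul_eq_mul] using hsum

theorem norm_le_norm_latticePoint (n : d → ℤ) : ‖n‖ ≤ ‖latticePoint n‖ :=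
  (pi_norm_le_iff_of_nonneg (norm_nonneg _)).2 fun i => PiLp.norm_apply_le (latticePoint n) i

theorem summable_one_add_norm_pow_inv :
    Summable fun n : d → ℤ => ((1 + ‖n‖) ^ (Fintype.card d + 1))⁻¹ := by
  let L := Submodule.span ℤ (Set.range (Pi.basisFun ℝ d))
  let coeL (n : d → ℤ) : L := ⟨fun i => n i, (Pi.basisFun ℝ d).mem_span_iff_repr_mem ℤ _ |>.2
    fun i => ⟨n i, by simp⟩⟩
  have hcoeL : Function.Injective coeL := fun m n hmn => funext fun i =>
    Int.cast_injective (congrFun (congrArg Subtype.val hmn) i)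
  have hrank : Module.finrank ℤ L < Fintype.card d + 1 := by
    rw [ZLattice.rank ℝ L, Module.finrank_pi]
    exact Nat.lt_succ_self _
  refine .of_norm_bounded_eventually
    ((ZLattice.summable_norm_pow_inv L _ hrank).comp_injective hcoeL) ?_
  filter_upwards [(Set.finite_singleton (0 : d → ℤ)).compl_mem_cofinite] with n hn
  have hnorm : ‖coeL n‖ = ‖n‖ := rfl
  have : 0 < ‖n‖ := norm_pos_iff.2 hn
  rw [Function.comp_apply, hnorm, inv_pow, Real.norm_of_nonneg (by positivity)]
  gcongr
  linarith

theorem one_add_norm_pow_mul_fourier_le (f : 𝓢(EuclideanSpace ℝ d, ℂ)) (k : ℕ) (n : d → ℤ) :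
    (1 + ‖n‖) ^ k * ‖𝓕 (f : EuclideanSpace ℝ d → ℂ) (latticePoint n)‖ ≤
      2 ^ k * (Finset.Iic (k, 0)).sup (schwartzSeminormFamily ℝ _ ℂ) (𝓕 f) := by
  have hsup := SchwartzMap.one_add_le_sup_seminorm_apply (𝕜 := ℝ) (m := (k, 0)) (k := k) (n := 0)
    le_rfl le_rfl (𝓕 f) (latticePoint n)
  rw [norm_iteratedFDeriv_zero] at hsup
  refine le_trans ?_ hsup
  rw [SchwartzMap.fourier_coe]
  gcongr
  exact norm_le_norm_latticePoint n

theorem rapidlyDecreasing_fourier (f : 𝓢(EuclideanSpace ℝ d, ℂ)) :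
    RapidlyDecreasing fun n : d → ℤ => 𝓕 (f : EuclideanSpace ℝ d → ℂ) (latticePoint n) := by
  intro s
  refine .of_nonneg_of_le (fun n => by positivity) (fun n => ?_)
    (summable_one_add_norm_pow_inv.mul_left (2 ^ (s + (Fintype.card d + 1)) *
      (Finset.Iic (s + (Fintype.card d + 1), 0)).sup (schwartzSeminormFamily ℝ _ ℂ) (𝓕 f)))
  rw [← div_eq_mul_inv, le_div_iff₀ (by positivity), mul_right_comm, ← pow_add]
  exact one_add_norm_pow_mul_fourier_le f _ n

theorem tendsto_tsum_norm_fourier {α : Type*} {u : α → 𝓢(EuclideanSpace ℝ d, ℂ)} {l : Filter α}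
    (hu : Filter.Tendsto u l (𝓝 0)) : Filter.Tendsto (fun s => ∑' n : d → ℤ,
      ‖𝓕 (u s : EuclideanSpace ℝ d → ℂ) (latticePoint n)‖) l (𝓝 0) := by
  let p := (Finset.Iic (Fintype.card d + 1, 0)).sup
    (schwartzSeminormFamily ℝ (EuclideanSpace ℝ d) ℂ)
  have hfourier : Filter.Tendsto (fun s => 𝓕 (u s)) l (𝓝 0) := by
    have hcomp := ((SchwartzMap.fourierTransformCLM ℝ (V := EuclideanSpace ℝ d)
      (E := ℂ)).continuous.tendsto 0).comp hu
    rw [map_zero] at hcomp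
    exact hcomp
  have hp : Filter.Tendsto (fun s => p (𝓕 (u s))) l (𝓝 0) := by
    refine Metric.tendsto_nhds.2 fun ε hε => ?_
    filter_upwards [((schwartz_withSeminorms ℝ _ ℂ).tendsto_nhds' _ 0).1 hfourier _ ε hε] with s hs
    rwa [dist_zero_right, Real.norm_of_nonneg (apply_nonneg _ _), ← sub_zero (𝓕 (u s))]
  have hlim := (hp.const_mul (2 ^ (Fintype.card d + 1))).mul_const
    (∑' n : d → ℤ, ((1 + ‖n‖) ^ (Fintype.card d + 1))⁻¹)
  rw [mul_zero, zero_mul] at hlim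
  refine squeeze_zero (fun s => tsum_nonneg fun n => norm_nonneg _) (fun s => ?_) hlim
  rw [← tsum_mul_left]
  refine (rapidlyDecreasing_fourier (u s)).summable_norm.tsum_le_tsum (fun n => ?_)
    (summable_one_add_norm_pow_inv.mul_left _)
  rw [← div_eq_mul_inv, le_div_iff₀ (by positivity), mul_comm]
  exact one_add_norm_pow_mul_fourier_le (u s) _ n

end FourierSeries

section Schwartz

open scoped SchwartzMap

variable {P E F : Type*} [NormedAddCommGroup P] [NormedSpace ℝ P] [NormedAddCommGroup E]
  [NormedSpace ℝ E] [NormedAddCommGroup F] [NormedSpace ℝ F] {G : P × E → F}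

theorem iteratedFDeriv_prodMk_left {l : ℕ} (hG : ContDiff ℝ l G) (s : P) (x : E) :
    iteratedFDeriv ℝ l (fun x => G (s, x)) x =
      (iteratedFDeriv ℝ l G (s, x)).compContinuousLinearMap fun _ => .inr ℝ P E := by
  have hslice :
      (fun x => G (s, x)) = (fun q => G ((s, 0) + q)) ∘ ContinuousLinearMap.inr ℝ P E := by
    funext x
    simp
  rw [hslice, (ContinuousLinearMap.inr ℝ P E).iteratedFDeriv_comp_right (n := l) (by fun_prop) x
    le_rfl, iteratedFDeriv_comp_add_left]
  simp

theorem tendsto_schwartzMap_zero (hG : ContDiff ℝ ∞ G) {K : Set E} (hK : IsCompact K)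
    (hsupp : ∀ s, tsupport (fun x => G (s, x)) ⊆ K) {p : P} (hp : ∀ x, G (p, x) = 0)
    {u : P → 𝓢(E, F)} (hu : ∀ s x, u s x = G (s, x)) : Filter.Tendsto u (𝓝 p) (𝓝 0) := by
  refine ((schwartz_withSeminorms ℝ E F).tendsto_nhds _ _).2 fun ⟨k, l⟩ ε hε => ?_
  have hcoe (s : P) : (u s : E → F) = fun x => G (s, x) := funext (hu s)
  let H (q : P × E) := (iteratedFDeriv ℝ l G q).compContinuousLinearMap fun _ => .inr ℝ P E
  have hH (s : P) (x : E) : iteratedFDeriv ℝ l (u s) x = H (s, x) := by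
    rw [hcoe]
    exact iteratedFDeriv_prodMk_left (hG.of_le (by exact_mod_cast le_top)) s x
  have hHcont : Continuous H := (ContinuousMultilinearMap.compContinuousLinearMapL (𝕜 := ℝ)
    (fun _ : Fin l => ContinuousLinearMap.inr ℝ P E)).continuous.comp
      (hG.continuous_iteratedFDeriv (by exact_mod_cast le_top))
  have hHp (x : E) : H (p, x) = 0 := by
    rw [← hH, hcoe, funext hp]
    simp
  have hsmall : ∀ᶠ s in 𝓝 p, ∀ x ∈ K, ‖x‖ ^ k * ‖H (s, x)‖ < ε / 2 := by
    refine hK.eventually_forall_of_forall_eventually fun x _ => ?_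
    have hcont : Continuous fun q : P × E => ‖q.2‖ ^ k * ‖H q‖ := by fun_prop
    refine (hcont.tendsto (p, x)).eventually_lt_const ?_
    rw [hHp, norm_zero, mul_zero]
    exact half_pos hε
  filter_upwards [hsmall] with s hs
  rw [sub_zero]
  refine (SchwartzMap.seminorm_le_bound ℝ k l (u s) (half_pos hε).le fun x => ?_).trans_lt
    (half_lt_self hε)
  by_cases hx : x ∈ K
  · rw [hH]
    exact (hs x hx).le
  · have hzero : iteratedFDeriv ℝ l (u s) x = 0 := by
      by_contra hne
      exact hx (hsupp s (hcoe s ▸ support_iteratedFDeriv_subset l hne))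
    rw [hzero, norm_zero, mul_zero]
    exact (half_pos hε).le

end Schwartz

section SmallFourierSeries

open scoped FourierTransform SchwartzMap

variable {d : Type*} [Fintype d]

/- The rescaled function `x ↦ χ x * ρ (s x)` tends to zero in the Schwartz space as `s → 0`. -/
theorem exists_small_fourier_series {ρ : EuclideanSpace ℝ d → ℂ} (hρ : ContDiff ℝ ∞ ρ)
    (hρ0 : ρ 0 = 0) {ε : ℝ} (hε : 0 < ε) :
    ∃ (s : ℝ) (a : (d → ℤ) → ℂ), 0 < s ∧ RapidlyDecreasing a ∧ ∑' n, ‖a n‖ < ε ∧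
      ∀ᶠ x in 𝓝 (0 : EuclideanSpace ℝ d), HasSum (fun n => a n * expMonomial n x) (ρ (s • x)) := by
  let χ : ContDiffBump (0 : EuclideanSpace ℝ d) := ⟨1 / 8, 1 / 4, by norm_num, by norm_num⟩
  let G : ℝ × EuclideanSpace ℝ d → ℂ := fun q => χ q.2 • ρ (q.1 • q.2)
  have hG : ContDiff ℝ ∞ G :=
    (χ.contDiff.comp contDiff_snd).smul (hρ.comp (contDiff_fst.smul contDiff_snd))
  have hsupp (s : ℝ) : tsupport (fun x => G (s, x)) ⊆ Metric.closedBall 0 (1 / 4) := by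
    rw [← χ.tsupport_eq]
    exact closure_mono (Function.support_smul_subset_left χ (fun x => ρ (s • x)))
  let u (s : ℝ) : 𝓢(EuclideanSpace ℝ d, ℂ) :=
    (HasCompactSupport.of_support_subset_isCompact (isCompact_closedBall 0 (1 / 4))
      ((subset_tsupport _).trans (hsupp s))).toSchwartzMap
        (hG.comp (contDiff_const.prodMk contDiff_id) : ContDiff ℝ ∞ fun x => G (s, x))
  have hu : Filter.Tendsto u (𝓝 0) (𝓝 0) := tendsto_schwartzMap_zero hG
    (isCompact_closedBall 0 (1 / 4)) hsupp (fun x => by simp [G, hρ0]) (fun s x => rfl)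
  have hpos : ∀ᶠ s in 𝓝[>] (0 : ℝ), 0 < s := self_mem_nhdsWithin
  obtain ⟨s, hs0, hs⟩ := (hpos.and (((tendsto_tsum_norm_fourier hu).mono_left
    nhdsWithin_le_nhds).eventually_lt_const hε)).exists
  refine ⟨s, fun n => 𝓕 (u s : EuclideanSpace ℝ d → ℂ) (latticePoint n), hs0,
    rapidlyDecreasing_fourier _, hs, ?_⟩
  filter_upwards [χ.eventuallyEq_one, Metric.closedBall_mem_nhds (0 : EuclideanSpace ℝ d)
    (by norm_num : (0 : ℝ) < 1 / 4)] with x hχ hx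
  have hsum := hasSum_fourier_expMonomial (f := u s) (u s).continuous
    (by norm_num : (1 / 4 : ℝ) < _) ((subset_tsupport _).trans (hsupp s))
    (rapidlyDecreasing_fourier (u s)).summable_norm.of_norm (mem_closedBall_zero_iff.1 hx)
  have hux : u s x = ρ (s • x) := by
    change χ x • ρ (s • x) = _
    rw [hχ, Pi.one_apply, one_smul]
  rwa [hux] at hsum

end SmallFourierSeries

section ExponentialSeries

variable {d : Type*} [Fintype d]

theorem norm_phase_le (n : d → ℤ) : ‖phase n‖ ≤ 2 * Real.pi * Fintype.card d * ‖n‖ := by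
  refine ContinuousLinearMap.opNorm_le_bound _ (by positivity) fun x => ?_
  have hterm (i : d) : ‖(n i : ℝ) * x i‖ ≤ ‖n‖ * ‖x‖ := by
    rw [norm_mul]
    exact mul_le_mul (norm_le_pi_norm n i) (PiLp.norm_apply_le x i) (norm_nonneg _) (norm_nonneg _)
  rw [phase_apply, norm_mul, Real.norm_of_nonneg Real.two_pi_pos.le]
  calc 2 * Real.pi * ‖∑ i, (n i : ℝ) * x i‖
      ≤ 2 * Real.pi * (Fintype.card d • (‖n‖ * ‖x‖)) := by
        gcongr
        exact norm_sum_le_of_le _ (fun i _ => hterm i) |>.trans_eq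
          (by rw [Finset.sum_const, Finset.card_univ])
    _ = 2 * Real.pi * Fintype.card d * ‖n‖ * ‖x‖ := by rw [nsmul_eq_mul]; ring

theorem iteratedDeriv_cexp_ofReal_mul_I (k : ℕ) :
    iteratedDeriv k (fun t : ℝ => Complex.exp (t * Complex.I)) =
      fun t : ℝ => Complex.I ^ k * Complex.exp (t * Complex.I) := by
  induction k with
  | zero => simp
  | succ k ih =>
    rw [iteratedDeriv_succ, ih]
    funext t
    have hlin : HasDerivAt (fun t : ℝ => (t : ℂ) * Complex.I) Complex.I t := by
      simpa using (Complex.ofRealCLM.hasDerivAt (x := t)).mul_const Complex.I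
    rw [(hlin.cexp.const_mul (Complex.I ^ k)).deriv]
    ring

theorem contDiff_expMonomial (n : d → ℤ) : ContDiff ℝ ∞ (expMonomial n) :=
  ((Complex.ofRealCLM.contDiff.comp (phase n).contDiff).mul contDiff_const).cexp

theorem fderiv_expMonomial_apply (n : d → ℤ) (x v : EuclideanSpace ℝ d) :
    fderiv ℝ (expMonomial n) x v = phase n v * Complex.I * expMonomial n x := by
  have hlin : HasFDerivAt (fun x : EuclideanSpace ℝ d => (phase n x : ℂ) * Complex.I) _ x :=
    (Complex.ofRealCLM.comp (phase n)).hasFDerivAt.mul_const Complex.I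
  have hexp : HasFDerivAt (expMonomial n) _ x := hlin.cexp
  rw [hexp.fderiv]
  simp [expMonomial]
  ring

theorem norm_iteratedFDeriv_expMonomial_le (n : d → ℤ) (k : ℕ) (x : EuclideanSpace ℝ d) :
    ‖iteratedFDeriv ℝ k (expMonomial n) x‖ ≤ ‖phase n‖ ^ k := by
  have hexp : ContDiff ℝ ∞ fun t : ℝ => Complex.exp (t * Complex.I) :=
    (Complex.ofRealCLM.contDiff.mul contDiff_const).cexp
  have hcomp : expMonomial n = (fun t : ℝ => Complex.exp (t * Complex.I)) ∘ phase n := rfl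
  rw [hcomp, (phase n).iteratedFDeriv_comp_right hexp x (by exact_mod_cast le_top)]
  refine (ContinuousMultilinearMap.norm_compContinuousLinearMap_le _ _).trans_eq ?_
  rw [norm_iteratedFDeriv_eq_norm_iteratedDeriv, iteratedDeriv_cexp_ofReal_mul_I, norm_mul,
    norm_pow, Complex.norm_I, one_pow, one_mul, Complex.norm_exp_ofReal_mul_I, one_mul,
    Finset.prod_const, Finset.card_univ, Fintype.card_fin]

theorem norm_iteratedFDeriv_const_mul_expMonomial_le (c : ℂ) (n : d → ℤ) (k : ℕ)
    (x : EuclideanSpace ℝ d) : ‖iteratedFDeriv ℝ k (fun x => c * expMonomial n x) x‖ ≤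
      (2 * Real.pi * Fintype.card d) ^ k * ((1 + ‖n‖) ^ k * ‖c‖) := by
  have hsmul : iteratedFDeriv ℝ k (fun x => c * expMonomial n x) x =
      c • iteratedFDeriv ℝ k (expMonomial n) x :=
    iteratedFDeriv_const_smul_apply (a := c)
      ((contDiff_expMonomial n).of_le (by exact_mod_cast le_top)).contDiffAt
  have hphase : ‖phase n‖ ≤ 2 * Real.pi * Fintype.card d * (1 + ‖n‖) :=
    (norm_phase_le n).trans (by gcongr; linarith)
  rw [hsmul, norm_smul]
  calc ‖c‖ * ‖iteratedFDeriv ℝ k (expMonomial n) x‖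
      ≤ ‖c‖ * (2 * Real.pi * Fintype.card d * (1 + ‖n‖)) ^ k := by
        gcongr
        exact (norm_iteratedFDeriv_expMonomial_le n k x).trans (by gcongr)
    _ = (2 * Real.pi * Fintype.card d) ^ k * ((1 + ‖n‖) ^ k * ‖c‖) := by rw [mul_pow]; ring

variable {a c W : (d → ℤ) → ℂ}

theorem RapidlyDecreasing.contDiff_tsum (ha : RapidlyDecreasing a) :
    ContDiff ℝ ∞ fun x => ∑' n, a n * expMonomial n x :=
  _root_.contDiff_tsum (N := ⊤) (fun n => contDiff_const.mul (contDiff_expMonomial n))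
    (fun k _ => (ha k).mul_left _)
    fun k n x _ => norm_iteratedFDeriv_const_mul_expMonomial_le (a n) n k x

theorem summable_norm_mul_expMonomial (hc : Summable fun n => ‖c n‖) (x : EuclideanSpace ℝ d) :
    Summable fun n => ‖c n * expMonomial n x‖ :=
  hc.congr fun n => by rw [norm_mul, norm_expMonomial, mul_one]

theorem norm_tsum_mul_expMonomial_le (hc : Summable fun n => ‖c n‖) (x : EuclideanSpace ℝ d) :
    ‖∑' n, c n * expMonomial n x‖ ≤ ∑' n, ‖c n‖ :=
  (norm_tsum_le_tsum_norm (summable_norm_mul_expMonomial hc x)).trans_eq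
    (tsum_congr fun n => by rw [norm_mul, norm_expMonomial, mul_one])

theorem RapidlyDecreasing.hasSum_fderiv_apply (ha : RapidlyDecreasing a)
    (x v : EuclideanSpace ℝ d) :
    HasSum (fun n => a n * (phase n v * Complex.I * expMonomial n x))
      (fderiv ℝ (fun x => ∑' n, a n * expMonomial n x) x v) := by
  have hdiff (n : d → ℤ) : Differentiable ℝ (expMonomial n) :=
    (contDiff_expMonomial n).differentiable (by simp)
  have hbound (n : d → ℤ) (x : EuclideanSpace ℝ d) :
      ‖fderiv ℝ (fun x => a n * expMonomial n x) x‖ ≤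
        (2 * Real.pi * Fintype.card d) ^ 1 * ((1 + ‖n‖) ^ 1 * ‖a n‖) := by
    rw [← norm_iteratedFDeriv_one]
    exact norm_iteratedFDeriv_const_mul_expMonomial_le (a n) n 1 x
  have hsum : Summable fun n => (2 * Real.pi * Fintype.card d) ^ 1 * ((1 + ‖n‖) ^ 1 * ‖a n‖) :=
    (ha 1).mul_left _
  rw [fderiv_tsum hsum (fun n => (hdiff n).const_mul (a n)) hbound
    (summable_norm_mul_expMonomial ha.summable_norm 0).of_norm]
  refine ((Summable.of_norm_bounded hsum (hbound · x)).hasSum.mapL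
    (ContinuousLinearMap.apply ℝ ℂ v)).congr_fun fun n => ?_
  rw [ContinuousLinearMap.apply_apply, fderiv_const_mul (hdiff n x), smul_apply, smul_eq_mul,
    fderiv_expMonomial_apply]

theorem RapidlyDecreasing.hasSum_fderiv_single [DecidableEq d] (ha : RapidlyDecreasing a)
    (x : EuclideanSpace ℝ d) (i : d) :
    HasSum (fun n => 2 * Real.pi * Complex.I * n i * a n * expMonomial n x)
      (fderiv ℝ (fun x => ∑' n, a n * expMonomial n x) x (EuclideanSpace.single i 1)) := by
  refine (ha.hasSum_fderiv_apply x _).congr_fun fun n => ?_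
  have hphase : phase n (EuclideanSpace.single i 1) = 2 * Real.pi * n i := by
    simp [phase_apply]
  rw [hphase]
  push_cast
  ring

theorem tsum_mul_tsum_expMonomial (ha : Summable fun n => ‖a n‖) (hc : Summable fun n => ‖c n‖)
    (x : EuclideanSpace ℝ d) :
    (∑' n, a n * expMonomial n x) * (∑' n, c n * expMonomial n x) =
      ∑' n, (∑' m, a (n - m) * c m) * expMonomial n x := by
  have haS := summable_norm_mul_expMonomial ha x
  have hcS := summable_norm_mul_expMonomial hc x
  let shear : (d → ℤ) × (d → ℤ) ≃ (d → ℤ) × (d → ℤ) :=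
    { toFun := fun z => (z.1 - z.2, z.2)
      invFun := fun z => (z.1 + z.2, z.2)
      left_inv := fun z => by simp
      right_inv := fun z => by simp }
  have hsplit (n m : d → ℤ) : expMonomial n x = expMonomial (n - m) x * expMonomial m x := by
    rw [← expMonomial_add, sub_add_cancel]
  have hshear : Summable fun z : (d → ℤ) × (d → ℤ) =>
      a (z.1 - z.2) * expMonomial (z.1 - z.2) x * (c z.2 * expMonomial z.2 x) :=
    shear.summable_iff.2 (summable_mul_of_summable_norm haS hcS)
  rw [tsum_mul_tsum_of_summable_norm haS hcS]
  refine (shear.tsum_eq _).symm.trans (hshear.tsum_prod.trans (tsum_congr fun n => ?_))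
  rw [← tsum_mul_right]
  refine tsum_congr fun m => ?_
  rw [hsplit n m]
  ring

theorem tsum_eq_mul_one_add_tsum_of_convolution_eq (ha : Summable fun n => ‖a n‖)
    (hc : Summable fun n => ‖c n‖) (hW : Summable fun n => ‖W n‖)
    (hconv : ∀ n, W n = a n + ∑' m, a (n - m) * c m) (x : EuclideanSpace ℝ d) :
    ∑' n, W n * expMonomial n x =
      (∑' n, a n * expMonomial n x) * (1 + ∑' n, c n * expMonomial n x) := by
  have haS := (summable_norm_mul_expMonomial ha x).of_norm
  have hWS := (summable_norm_mul_expMonomial hW x).of_norm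
  rw [mul_one_add, tsum_mul_tsum_expMonomial ha hc, ← sub_eq_iff_eq_add', ← hWS.tsum_sub haS]
  refine tsum_congr fun n => ?_
  rw [hconv n, ← sub_mul, add_sub_cancel_left]

end ExponentialSeries

/-! ### The Beltrami equation in the plane -/

section Beltrami

/-- The Euclidean plane. -/
abbrev E2 : Type := EuclideanSpace ℝ (Fin 2)

/-- The symbol of the operator `∂₁ - σ₀ ∂₀` on `E2`, up to the factor `2πi`. -/
noncomputable def beltramiSymbol (σ₀ : ℂ) (n : Fin 2 → ℤ) : ℂ := n 1 - σ₀ * n 0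

variable {σ₀ : ℂ} {n : Fin 2 → ℤ} {W : (Fin 2 → ℤ) → ℂ}

theorem abs_im_mul_abs_le_norm_beltramiSymbol (σ₀ : ℂ) (n : Fin 2 → ℤ) :
    |σ₀.im| * |(n 0 : ℝ)| ≤ ‖beltramiSymbol σ₀ n‖ := by
  simpa [beltramiSymbol, abs_mul] using Complex.abs_im_le_norm (beltramiSymbol σ₀ n)

theorem norm_div_beltramiSymbol_le (him : σ₀.im ≠ 0) (n : Fin 2 → ℤ) :
    ‖n 0 / beltramiSymbol σ₀ n‖ ≤ |σ₀.im|⁻¹ := by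
  rw [norm_div, Complex.norm_intCast]
  refine div_le_of_le_mul₀ (norm_nonneg _) (by positivity) ?_
  rw [← div_eq_inv_mul, le_div_iff₀' (abs_pos.2 him)]
  exact abs_im_mul_abs_le_norm_beltramiSymbol σ₀ n

theorem min_le_norm_beltramiSymbol (σ₀ : ℂ) (hn : n ≠ 0) :
    min |σ₀.im| 1 ≤ ‖beltramiSymbol σ₀ n‖ := by
  by_cases hn0 : n 0 = 0
  · have hn1 : n 1 ≠ 0 := fun hn1 => hn (funext (Fin.forall_fin_two.2 ⟨hn0, hn1⟩))
    refine (min_le_right _ _).trans ?_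
    simpa [beltramiSymbol, hn0, Complex.norm_intCast] using
      (by exact_mod_cast Int.one_le_abs hn1 : (1 : ℝ) ≤ |(n 1 : ℝ)|)
  · have hn0' : (1 : ℝ) ≤ |(n 0 : ℝ)| := by exact_mod_cast Int.one_le_abs hn0
    exact (min_le_left _ _).trans ((le_mul_of_one_le_right (abs_nonneg _) hn0').trans
      (abs_im_mul_abs_le_norm_beltramiSymbol σ₀ n))

theorem beltramiSymbol_ne_zero (him : σ₀.im ≠ 0) (hn : n ≠ 0) : beltramiSymbol σ₀ n ≠ 0 :=
  norm_pos_iff.1 ((lt_min (abs_pos.2 him) one_pos).trans_le (min_le_norm_beltramiSymbol σ₀ hn))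

theorem RapidlyDecreasing.div_beltramiSymbol (hW : RapidlyDecreasing W) (him : σ₀.im ≠ 0) :
    RapidlyDecreasing fun n => W n / (2 * Real.pi * Complex.I * beltramiSymbol σ₀ n) := by
  have : 0 < min |σ₀.im| 1 := lt_min (abs_pos.2 him) one_pos
  refine hW.of_norm_le (2 * Real.pi * min |σ₀.im| 1)⁻¹ fun n => ?_
  rcases eq_or_ne n 0 with rfl | hn
  · simp only [beltramiSymbol, Pi.zero_apply, Int.cast_zero, mul_zero, sub_zero, div_zero,
      norm_zero]
    positivity
  · have hnorm : ‖2 * Real.pi * Complex.I * beltramiSymbol σ₀ n‖ =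
        2 * Real.pi * ‖beltramiSymbol σ₀ n‖ := by
      simp [abs_of_pos Real.pi_pos]
    rw [norm_div, hnorm, div_eq_inv_mul]
    gcongr
    exact min_le_norm_beltramiSymbol σ₀ hn

theorem exists_periodic_beltrami_primitive (hW : RapidlyDecreasing W) (him : σ₀.im ≠ 0) :
    ∃ S : E2 → ℂ, ContDiff ℝ ∞ S ∧
      (∀ x, fderiv ℝ S x (EuclideanSpace.single 0 1) =
        ∑' n, n 0 / beltramiSymbol σ₀ n * W n * expMonomial n x) ∧
      ∀ x, ∑' n, W n * expMonomial n x = W 0 + (fderiv ℝ S x (EuclideanSpace.single 1 1) -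
        σ₀ * fderiv ℝ S x (EuclideanSpace.single 0 1)) := by
  let b (n : Fin 2 → ℤ) : ℂ := W n / (2 * Real.pi * Complex.I * beltramiSymbol σ₀ n)
  have hb : RapidlyDecreasing b := hW.div_beltramiSymbol him
  have hbW {n} (hn : n ≠ 0) : b n * (2 * Real.pi * Complex.I * beltramiSymbol σ₀ n) = W n :=
    div_mul_cancel₀ _ (mul_ne_zero Complex.two_pi_I_ne_zero (beltramiSymbol_ne_zero him hn))
  refine ⟨fun x => ∑' n, b n * expMonomial n x, hb.contDiff_tsum, fun x => ?_, fun x => ?_⟩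
  · rw [← (hb.hasSum_fderiv_single x 0).tsum_eq]
    refine tsum_congr fun n => ?_
    rcases eq_or_ne n 0 with rfl | hn
    · simp
    · have hD := beltramiSymbol_ne_zero him hn
      rw [← hbW hn]
      field_simp
  · refine (((hasSum_ite_eq 0 (W 0)).add ((hb.hasSum_fderiv_single x 1).sub
      ((hb.hasSum_fderiv_single x 0).mul_left σ₀))).congr_fun fun n => ?_).tsum_eq
    split_ifs with hn
    · subst hn
      simp [expMonomial, phase_apply]
    · rw [← hbW hn]
      simp only [beltramiSymbol]
      ring

/- The linear summand absorbs the mean value `W 0`, on which the symbol vanishes. -/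
theorem exists_beltrami_primitive (hW : RapidlyDecreasing W) (him : σ₀.im ≠ 0) :
    ∃ F : E2 → ℂ, ContDiff ℝ ∞ F ∧
      (∀ x, fderiv ℝ F x (EuclideanSpace.single 0 1) =
        1 + ∑' n, n 0 / beltramiSymbol σ₀ n * W n * expMonomial n x) ∧
      ∀ x, fderiv ℝ F x (EuclideanSpace.single 1 1) =
        σ₀ * fderiv ℝ F x (EuclideanSpace.single 0 1) + ∑' n, W n * expMonomial n x := by
  obtain ⟨S, hS, hS₀, hS₁⟩ := exists_periodic_beltrami_primitive hW him
  let Λ : E2 →L[ℝ] ℂ := Complex.ofRealCLM.comp (EuclideanSpace.proj 0) +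
    (σ₀ + W 0) • Complex.ofRealCLM.comp (EuclideanSpace.proj 1)
  have hF (x v) : fderiv ℝ (fun x => Λ x + S x) x v = Λ v + fderiv ℝ S x v := by
    have hsum := (Λ.hasFDerivAt (x := x)).add (hS.differentiable (by simp) x).hasFDerivAt
    exact DFunLike.congr_fun hsum.fderiv v
  refine ⟨fun x => Λ x + S x, Λ.contDiff.add hS, fun x => ?_, fun x => ?_⟩
  · rw [hF, hS₀]
    simp [Λ]
  · rw [hF, hF, hS₁]
    simp [Λ]
    ring

theorem exists_beltrami_solution_of_small (him : σ₀.im ≠ 0) {a : (Fin 2 → ℤ) → ℂ}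
    (ha : RapidlyDecreasing a) (hsmall : ∑' n, ‖a n‖ < |σ₀.im| / 2) :
    ∃ F : E2 → ℂ, ContDiff ℝ ∞ F ∧ (∀ x, fderiv ℝ F x (EuclideanSpace.single 0 1) ≠ 0) ∧
      ∀ x, fderiv ℝ F x (EuclideanSpace.single 1 1) =
        (σ₀ + ∑' n, a n * expMonomial n x) * fderiv ℝ F x (EuclideanSpace.single 0 1) := by
  have him' : 0 < |σ₀.im| := abs_pos.2 him
  let C : NNReal := ‖σ₀.im‖₊⁻¹
  let T (n : Fin 2 → ℤ) : ℂ := n 0 / beltramiSymbol σ₀ n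
  have hT (n) : ‖T n‖ ≤ C := norm_div_beltramiSymbol_le him n
  have hCsmall : C * ∑' n, ‖a n‖ < 1 / 2 := by
    change |σ₀.im|⁻¹ * _ < _
    rw [inv_mul_lt_iff₀ him']
    linarith
  obtain ⟨W, hW, hconv, hWsmall⟩ := ha.exists_convolution_solution hT hCsmall
  obtain ⟨F, hF, hF0, hF1⟩ := exists_beltrami_primitive hW him
  have hTW : RapidlyDecreasing fun n => T n * W n := hW.of_norm_le C fun n => by
    rw [norm_mul]
    gcongr
    exact hT n
  refine ⟨F, hF, fun x hx => ?_, fun x => ?_⟩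
  · have hlt : ‖∑' n, T n * W n * expMonomial n x‖ < 1 := by
      refine (norm_tsum_mul_expMonomial_le hTW.summable_norm x).trans_lt (hWsmall.trans_le' ?_)
      rw [← tsum_mul_left]
      refine hTW.summable_norm.tsum_le_tsum (fun n => ?_) (hW.summable_norm.mul_left _)
      rw [norm_mul]
      gcongr
      exact hT n
    rw [eq_neg_of_add_eq_zero_right ((hF0 x).symm.trans hx), norm_neg, norm_one] at hlt
    exact lt_irrefl _ hlt
  · rw [hF1, add_mul, hF0, tsum_eq_mul_one_add_tsum_of_convolution_eq ha.summable_norm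
      hTW.summable_norm hW.summable_norm hconv]

theorem exists_beltrami_solution {σ : E2 → ℂ} (hσ : SmoothNear σ 0) (him : (σ 0).im ≠ 0) :
    ∃ F : E2 → ℂ, ContDiff ℝ ∞ F ∧ fderiv ℝ F 0 (EuclideanSpace.single 0 1) ≠ 0 ∧
      ∀ᶠ x in 𝓝 0, fderiv ℝ F x (EuclideanSpace.single 1 1) =
        σ x * fderiv ℝ F x (EuclideanSpace.single 0 1) := by
  obtain ⟨σ', hσ', heq⟩ := hσ.exists_contDiff_eventuallyEq
  obtain ⟨s, a, hs, ha, hsmall, hsum⟩ := exists_small_fourier_series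
    (ρ := fun x => σ' x - σ 0) (hσ'.sub contDiff_const) (sub_eq_zero.2 heq.self_of_nhds)
    (half_pos (abs_pos.2 him))
  obtain ⟨F, hF, hF0, hF1⟩ := exists_beltrami_solution_of_small him ha hsmall
  have hscale (x v) : fderiv ℝ (fun x => F (s⁻¹ • x)) x v = s⁻¹ * fderiv ℝ F (s⁻¹ • x) v := by
    rw [fderiv_comp_smul]
    simp
  refine ⟨fun x => F (s⁻¹ • x), hF.comp (contDiff_const_smul _), ?_, ?_⟩
  · rw [hscale]
    exact mul_ne_zero (Complex.ofReal_ne_zero.2 (inv_ne_zero hs.ne')) (hF0 _)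
  · have htendsto : Filter.Tendsto (fun x : E2 => s⁻¹ • x) (𝓝 0) (𝓝 0) := by
      simpa using (continuous_const_smul s⁻¹).tendsto (0 : E2)
    filter_upwards [htendsto.eventually hsum, heq] with x hx hxσ
    rw [hscale, hscale, hF1, hx.tsum_eq, smul_inv_smul₀ hs.ne', hxσ]
    ring

end Beltrami

/-! ### Partial derivatives and functions of two of the three coordinates -/

section PartialDerivative

variable {n : ℕ} {F G : Type*} [NormedAddCommGroup F]
  [NormedSpace ℝ F] [NormedAddCommGroup G] [NormedSpace ℝ G]

/-- The `i`-th partial derivative. -/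
noncomputable def pd (i : Fin n) (f : EuclideanSpace ℝ (Fin n) → F)
    (z : EuclideanSpace ℝ (Fin n)) : F :=
  fderiv ℝ f z (EuclideanSpace.single i 1)

variable {f g : EuclideanSpace ℝ (Fin n) → F} {i : Fin n} {z : EuclideanSpace ℝ (Fin n)}

theorem SmoothNear.pd (hf : SmoothNear f z) (i : Fin n) : SmoothNear (pd i f) z :=
  hf.fderiv_apply _

theorem pd_congr (h : f =ᶠ[𝓝 z] g) : pd i f z = pd i g z :=
  DFunLike.congr_fun h.fderiv_eq _

theorem pd_add (hf : DifferentiableAt ℝ f z) (hg : DifferentiableAt ℝ g z) :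
    pd i (fun x => f x + g x) z = pd i f z + pd i g z :=
  DFunLike.congr_fun (fderiv_fun_add hf hg) _

theorem pd_sub (hf : DifferentiableAt ℝ f z) (hg : DifferentiableAt ℝ g z) :
    pd i (fun x => f x - g x) z = pd i f z - pd i g z :=
  DFunLike.congr_fun (fderiv_fun_sub hf hg) _

theorem pd_clm (L : F →L[ℝ] G) (hf : DifferentiableAt ℝ f z) :
    pd i (fun x => L (f x)) z = L (pd i f z) :=
  DFunLike.congr_fun (L.hasFDerivAt.comp z hf.hasFDerivAt).fderiv _

variable {𝔸 : Type*} [NormedCommRing 𝔸] [NormedAlgebra ℝ 𝔸] {f g : EuclideanSpace ℝ (Fin n) → 𝔸}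

theorem pd_mul (hf : DifferentiableAt ℝ f z) (hg : DifferentiableAt ℝ g z) :
    pd i (fun x => f x * g x) z = pd i f z * g z + f z * pd i g z := by
  simp [pd, fderiv_fun_mul hf hg, mul_comm, add_comm]

theorem pd_const_mul (c : 𝔸) (hf : DifferentiableAt ℝ f z) :
    pd i (fun x => c * f x) z = c * pd i f z := by
  simp [pd, fderiv_const_mul hf]

theorem clm_apply_eq_sum_single (L : EuclideanSpace ℝ (Fin n) →L[ℝ] F)
    (v : EuclideanSpace ℝ (Fin n)) : L v = ∑ i, v i • L (EuclideanSpace.single i 1) := by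
  conv_lhs => rw [← (EuclideanSpace.basisFun (Fin n) ℝ).sum_repr v, map_sum]
  simp

theorem fderiv_apply_eq_sum_pd (f : EuclideanSpace ℝ (Fin n) → F)
    (z v : EuclideanSpace ℝ (Fin n)) : fderiv ℝ f z v = ∑ i, v i • _root_.pd i f z :=
  clm_apply_eq_sum_single _ v

end PartialDerivative

section PlaneProjection

/-- The projection of space to the first two coordinates. -/
noncomputable def planeProj : E3 →L[ℝ] E2 :=
  LinearMap.toContinuousLinearMap
    { toFun := fun z => !₂[z 0, z 1]
      map_add' := fun z w => by ext i; fin_cases i <;> simp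
      map_smul' := fun c z => by ext i; fin_cases i <;> simp }

/-- The inclusion of the plane as the zero section of the third coordinate. -/
noncomputable def planeIncl : E2 →L[ℝ] E3 :=
  LinearMap.toContinuousLinearMap
    { toFun := fun x => !₂[x 0, x 1, 0]
      map_add' := fun z w => by ext i; fin_cases i <;> simp
      map_smul' := fun c z => by ext i; fin_cases i <;> simp }

theorem planeProj_apply (z : E3) : planeProj z = !₂[z 0, z 1] := rfl

theorem planeIncl_apply (x : E2) : planeIncl x = !₂[x 0, x 1, 0] := rfl

theorem planeProj_single_two : planeProj (EuclideanSpace.single 2 1) = 0 := by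
  rw [planeProj_apply]; ext i; fin_cases i <;> simp

theorem planeIncl_planeProj_add (z : E3) :
    planeIncl (planeProj z) + z 2 • EuclideanSpace.single 2 1 = z := by
  rw [planeIncl_apply, planeProj_apply]; ext i; fin_cases i <;> simp

theorem tendsto_planeProj : Filter.Tendsto planeProj (𝓝 0) (𝓝 0) := by
  simpa using planeProj.continuous.tendsto 0

variable {F : Type*} [NormedAddCommGroup F] [NormedSpace ℝ F] {f : E2 → F} {z : E3}

theorem SmoothNear.comp_planeProj (hf : SmoothNear f 0) :
    SmoothNear (fun z => f (planeProj z)) 0 :=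
  SmoothNear.comp (f := planeProj) (by rwa [map_zero]) (.of_contDiff planeProj.contDiff)

theorem SmoothNear.comp_planeIncl {f : E3 → F} (hf : SmoothNear f 0) :
    SmoothNear (fun z => f (planeIncl z)) 0 :=
  SmoothNear.comp (f := planeIncl) (by rwa [map_zero]) (.of_contDiff planeIncl.contDiff)

theorem fderiv_comp_planeProj (hf : DifferentiableAt ℝ f (planeProj z)) (v : E3) :
    fderiv ℝ (fun z => f (planeProj z)) z v = fderiv ℝ f (planeProj z) (planeProj v) :=
  congrArg (· v) (hf.hasFDerivAt.comp z planeProj.hasFDerivAt).fderiv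

theorem pd_two_comp_planeProj (hf : DifferentiableAt ℝ f (planeProj z)) :
    pd 2 (fun z => f (planeProj z)) z = 0 := by
  rw [pd, fderiv_comp_planeProj hf, planeProj_single_two, map_zero]

theorem norm_planeIncl_planeProj_add_le (z : E3) {s : ℝ} (hs : s ∈ Set.Icc (0 : ℝ) 1) :
    ‖planeIncl (planeProj z) + s • z 2 • EuclideanSpace.single 2 (1 : ℝ)‖ ≤ ‖z‖ := by
  have hs2 : s ^ 2 ≤ 1 := pow_le_one₀ hs.1 hs.2
  rw [EuclideanSpace.norm_eq, EuclideanSpace.norm_eq]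
  refine Real.sqrt_le_sqrt ?_
  simp [Fin.sum_univ_three, planeIncl_apply, planeProj_apply]
  nlinarith [sq_nonneg (z 2)]

theorem eventually_eq_comp_planeIncl_planeProj {f : E3 → F} (hf : SmoothNear f 0)
    (hf2 : ∀ᶠ z in 𝓝 0, pd 2 f z = 0) : ∀ᶠ z in 𝓝 0, f z = f (planeIncl (planeProj z)) := by
  obtain ⟨r, hr, hball⟩ := Metric.eventually_nhds_iff.1 (hf.and hf2)
  filter_upwards [Metric.ball_mem_nhds (0 : E3) hr] with z hz
  rw [mem_ball_zero_iff] at hz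
  let γ (s : ℝ) : E3 := planeIncl (planeProj z) + s • z 2 • EuclideanSpace.single 2 (1 : ℝ)
  have hfγ {s} (hs : s ∈ Set.Icc (0 : ℝ) 1) : HasDerivAt (fun s => f (γ s)) 0 s := by
    obtain ⟨hsmooth, hpd⟩ := @hball (γ s)
      (by simpa using (norm_planeIncl_planeProj_add_le z hs).trans_lt hz)
    have hγ : HasDerivAt γ ((1 : ℝ) • z 2 • EuclideanSpace.single 2 (1 : ℝ)) s :=
      ((hasDerivAt_id s).smul_const _).const_add _
    have hcomp := (hsmooth.differentiableAt (by simp)).hasFDerivAt.comp_hasDerivAt s hγ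
    rw [map_smul, map_smul] at hcomp
    change HasDerivAt (f ∘ γ) ((1 : ℝ) • z 2 • pd 2 f (γ s)) s at hcomp
    rwa [hpd, smul_zero, smul_zero] at hcomp
  have hconst := constant_of_has_deriv_right_zero (f := fun s => f (γ s)) (a := 0) (b := 1)
    (fun s hs => (hfγ hs).continuousAt.continuousWithinAt)
    (fun s hs => (hfγ ⟨hs.1, hs.2.le⟩).hasDerivWithinAt) 1 ⟨zero_le_one, le_rfl⟩
  simpa only [γ, one_smul, zero_smul, add_zero, planeIncl_planeProj_add] using hconst

theorem exists_ratio_of_wronskian_eq_zero {𝕜 : Type*} [NormedField 𝕜] [NormedAlgebra ℝ 𝕜]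
    [CompleteSpace 𝕜] {n₁ n₂ : E3 → 𝕜} (h₁ : SmoothNear n₁ 0) (h₂ : SmoothNear n₂ 0)
    (hw : ∀ᶠ z in 𝓝 0, n₁ z * pd 2 n₂ z - n₂ z * pd 2 n₁ z = 0) (h0 : n₁ 0 ≠ 0) :
    ∃ σ : E2 → 𝕜, SmoothNear σ 0 ∧ ∀ᶠ z in 𝓝 0, n₂ z = σ (planeProj z) * n₁ z := by
  have hτ : SmoothNear (fun z => n₂ z / n₁ z) 0 := h₂.div h₁ h0
  have hne := h₁.continuousAt.eventually_ne h0
  have hpd : ∀ᶠ z in 𝓝 0, pd 2 (fun z => n₂ z / n₁ z) z = 0 := by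
    filter_upwards [hw, hτ.eventually_differentiableAt, h₁.eventually_differentiableAt,
      hne.eventually_nhds] with z hz hdτ hd₁ hn
    have hmul : pd 2 (fun z => n₂ z / n₁ z * n₁ z) z = pd 2 n₂ z :=
      pd_congr (hn.mono fun y hy => div_mul_cancel₀ _ hy)
    rw [pd_mul hdτ hd₁] at hmul
    have hn0 := hn.self_of_nhds
    have hsq : pd 2 (fun z => n₂ z / n₁ z) z * n₁ z ^ 2 = 0 := by
      rw [← hz, ← hmul]
      field_simp
      ring
    exact (mul_eq_zero.1 hsq).resolve_right (pow_ne_zero 2 hn0)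
  refine ⟨fun x => n₂ (planeIncl x) / n₁ (planeIncl x), hτ.comp_planeIncl, ?_⟩
  filter_upwards [eventually_eq_comp_planeIncl_planeProj hτ hpd, hne] with z hz hn
  rw [← hz, div_mul_cancel₀ _ hn]

theorem exists_direction_of_wronskian_eq_zero {n₁ n₂ : E3 → ℝ} (h₁ : SmoothNear n₁ 0)
    (h₂ : SmoothNear n₂ 0) (hw : ∀ᶠ z in 𝓝 0, n₁ z * pd 2 n₂ z - n₂ z * pd 2 n₁ z = 0)
    (h0 : n₁ 0 ≠ 0 ∨ n₂ 0 ≠ 0) :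
    ∃ β₁ β₂ : E2 → ℝ, SmoothNear β₁ 0 ∧ SmoothNear β₂ 0 ∧ (∀ x, β₁ x ≠ 0 ∨ β₂ x ≠ 0) ∧
      ∀ᶠ z in 𝓝 0, n₁ z * β₂ (planeProj z) = n₂ z * β₁ (planeProj z) := by
  rcases h0 with h0 | h0
  · obtain ⟨σ, hσ, h⟩ := exists_ratio_of_wronskian_eq_zero h₁ h₂ hw h0
    refine ⟨fun _ => 1, σ, .const 1 0, hσ, fun _ => .inl one_ne_zero, h.mono fun z hz => ?_⟩
    rw [hz, mul_one, mul_comm]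
  · obtain ⟨σ, hσ, h⟩ := exists_ratio_of_wronskian_eq_zero h₂ h₁
      (hw.mono fun z hz => by linarith) h0
    refine ⟨σ, fun _ => 1, hσ, .const 1 0, fun _ => .inr one_ne_zero, h.mono fun z hz => ?_⟩
    rw [hz, mul_one, mul_comm]

end PlaneProjection

section FirstIntegral

theorem fderiv_apply_eq_pd {f : E2 → ℝ} (x v : E2) :
    fderiv ℝ f x v = v 0 * pd 0 f x + v 1 * pd 1 f x := by
  rw [fderiv_apply_eq_sum_pd, Fin.sum_univ_two]
  rfl

/-- Coordinates `f` in which the planar vector field `V` is the coordinate field `∂₀`. -/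
structure Straightens (f : E2 → E2) (V : E2 → E2) : Prop where
  smoothNear : SmoothNear f 0
  fderiv_surjective : Function.Surjective (fderiv ℝ f 0)
  fderiv_apply : ∀ᶠ x in 𝓝 0, fderiv ℝ f x (V x) = EuclideanSpace.single 0 1

theorem exists_straightens {V : E2 → E2} (hV : SmoothNear V 0) (hV0 : V 0 ≠ 0) :
    ∃ f, Straightens f V := by
  obtain ⟨e, he, he0, hep, heV⟩ := hV.exists_flowBox hV0
    (w := EuclideanSpace.single 0 1) (by simp)
  have h0 : (0 : E2) ∈ e.target := hep ▸ e.map_source he0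
  have hsymm0 : e.symm 0 = 0 := by simpa only [hep] using e.left_inv he0
  have hsmooth : SmoothNear e.symm 0 := by
    filter_upwards [e.open_target.mem_nhds h0] with y hy using he.contDiffAt_symm y hy
  have htendsto : Filter.Tendsto e.symm (𝓝 0) (𝓝 0) := by
    simpa only [hsymm0] using hsmooth.continuousAt.tendsto
  refine ⟨e.symm, hsmooth, ?_, ?_⟩
  · obtain ⟨g, hg⟩ := he.exists_hasFDerivAt (e.map_target h0)
    rw [(e.hasFDerivAt_symm h0 hg).fderiv]
    exact g.symm.surjective
  · filter_upwards [e.open_target.mem_nhds h0, htendsto.eventually heV] with y hy hVy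
    obtain ⟨g, hg⟩ := he.exists_hasFDerivAt (e.map_target hy)
    rw [hg.fderiv, e.right_inv hy] at hVy
    rw [(e.hasFDerivAt_symm hy hg).fderiv, ← hVy]
    exact g.symm_apply_apply _

theorem exists_firstIntegral {v₁ v₂ : E2 → ℝ} (h₁ : SmoothNear v₁ 0) (h₂ : SmoothNear v₂ 0)
    (h0 : v₁ 0 ≠ 0 ∨ v₂ 0 ≠ 0) :
    ∃ f g : E2 → ℝ, SmoothNear f 0 ∧ SmoothNear g 0 ∧ (pd 0 f 0 ≠ 0 ∨ pd 1 f 0 ≠ 0) ∧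
      (∀ᶠ x in 𝓝 0, v₁ x * pd 0 f x + v₂ x * pd 1 f x = 0) ∧
      ∀ᶠ x in 𝓝 0, v₁ x * pd 0 g x + v₂ x * pd 1 g x = 1 := by
  let V (x : E2) : E2 := v₁ x • EuclideanSpace.single 0 1 + v₂ x • EuclideanSpace.single 1 1
  have hV0 (x) : V x 0 = v₁ x := by simp [V]
  have hV1 (x) : V x 1 = v₂ x := by simp [V]
  have hV : SmoothNear V 0 := by
    filter_upwards [h₁, h₂] with x hx hy
    exact (hx.smul contDiffAt_const).add (hy.smul contDiffAt_const)
  have hVne : V 0 ≠ 0 := fun h => by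
    rw [← hV0, ← hV1, h] at h0
    simp at h0
  obtain ⟨φ, hφ⟩ := exists_straightens hV hVne
  have hcoord (i : Fin 2) {x} (hx : DifferentiableAt ℝ φ x) (v : E2) :
      fderiv ℝ φ x v i = v 0 * pd 0 (fun x => φ x i) x + v 1 * pd 1 (fun x => φ x i) x := by
    rw [← fderiv_apply_eq_pd]
    exact (congrArg (· v) ((EuclideanSpace.proj (𝕜 := ℝ) i).hasFDerivAt.comp x
      hx.hasFDerivAt).fderiv).symm
  have hsmooth (i : Fin 2) : SmoothNear (fun x => φ x i) 0 :=
    hφ.smoothNear.mono fun x hx => (EuclideanSpace.proj (𝕜 := ℝ) i).contDiff.contDiffAt.comp x hx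
  have hunit (i : Fin 2) : ∀ᶠ x in 𝓝 0, v₁ x * pd 0 (fun x => φ x i) x +
      v₂ x * pd 1 (fun x => φ x i) x = (EuclideanSpace.single 0 1 : E2) i := by
    filter_upwards [hφ.smoothNear.eventually_differentiableAt, hφ.fderiv_apply] with x hx hVx
    rw [← hV0, ← hV1, ← hcoord i hx, hVx]
  refine ⟨fun x => φ x 1, fun x => φ x 0, hsmooth 1, hsmooth 0, ?_, ?_, ?_⟩
  · by_contra! hzero
    obtain ⟨v, hv⟩ := hφ.fderiv_surjective (EuclideanSpace.single 1 1)
    have hv1 := hcoord 1 hφ.smoothNear.eventually_differentiableAt.self_of_nhds v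
    rw [hv, hzero.1, hzero.2] at hv1
    simp at hv1
  · simpa using hunit 1
  · simpa using hunit 0

end FirstIntegral

/-! ### Balanced pairs of forms annihilating the third coordinate direction -/

section Parallel

variable {E : Type*} [NormedAddCommGroup E] [NormedSpace ℝ E] {a : E}

theorem SmoothNear.const_mul {f : E → ℝ} (k : ℝ) (hf : SmoothNear f a) :
    SmoothNear (fun x => k * f x) a :=
  (SmoothNear.const k a).mul hf

theorem SmoothNear.clm_comp {F G : Type*} [NormedAddCommGroup F] [NormedSpace ℝ F]
    [NormedAddCommGroup G] [NormedSpace ℝ G] {f : E → F} (L : F →L[ℝ] G) (hf : SmoothNear f a) :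
    SmoothNear (fun x => L (f x)) a :=
  SmoothNear.comp (g := L) (.of_contDiff (ContinuousLinearMap.contDiff _)) hf

theorem SmoothNear.exists_eq_mul_of_parallel {n₁ n₂ d₁ d₂ : E → ℝ} (hn₁ : SmoothNear n₁ a)
    (hn₂ : SmoothNear n₂ a) (hd₁ : SmoothNear d₁ a) (hd₂ : SmoothNear d₂ a)
    (hpar : ∀ᶠ z in 𝓝 a, n₁ z * d₂ z = n₂ z * d₁ z) (hne : d₁ a ≠ 0 ∨ d₂ a ≠ 0) :
    ∃ h : E → ℝ, SmoothNear h a ∧ ∀ᶠ z in 𝓝 a, n₁ z = h z * d₁ z ∧ n₂ z = h z * d₂ z := by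
  rcases hne with hne | hne
  · refine ⟨fun z => n₁ z / d₁ z, hn₁.div hd₁ hne, ?_⟩
    filter_upwards [hpar, hd₁.continuousAt.eventually_ne hne] with z hz hdz
    refine ⟨(div_mul_cancel₀ _ hdz).symm, ?_⟩
    rw [div_mul_eq_mul_div, hz, mul_div_cancel_right₀ _ hdz]
  · refine ⟨fun z => n₂ z / d₂ z, hn₂.div hd₂ hne, ?_⟩
    filter_upwards [hpar, hd₂.continuousAt.eventually_ne hne] with z hz hdz
    refine ⟨?_, (div_mul_cancel₀ _ hdz).symm⟩
    rw [div_mul_eq_mul_div, ← hz, mul_div_cancel_right₀ _ hdz]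

end Parallel

section Potential

theorem exists_potential_of_wronskian_eq_zero {n₁ n₂ : E3 → ℝ} (h₁ : SmoothNear n₁ 0)
    (h₂ : SmoothNear n₂ 0) (hw : ∀ᶠ z in 𝓝 0, n₁ z * pd 2 n₂ z - n₂ z * pd 2 n₁ z = 0)
    (h0 : n₁ 0 ≠ 0 ∨ n₂ 0 ≠ 0) :
    ∃ (F : E2 → ℝ) (h : E3 → ℝ), SmoothNear F 0 ∧ SmoothNear h 0 ∧
      (pd 0 F 0 ≠ 0 ∨ pd 1 F 0 ≠ 0) ∧
      ∀ᶠ z in 𝓝 0, n₁ z = h z * pd 0 F (planeProj z) ∧ n₂ z = h z * pd 1 F (planeProj z) := by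
  obtain ⟨β₁, β₂, hβ₁, hβ₂, hβ, hnβ⟩ := exists_direction_of_wronskian_eq_zero h₁ h₂ hw h0
  obtain ⟨F, -, hF, -, hF0, hβF, -⟩ := exists_firstIntegral hβ₂ hβ₁.neg
    ((hβ 0).symm.imp_right neg_ne_zero.2)
  have hpar : ∀ᶠ z in 𝓝 0, n₁ z * pd 1 F (planeProj z) = n₂ z * pd 0 F (planeProj z) := by
    filter_upwards [hnβ, tendsto_planeProj.eventually hβF] with z hnz hFz
    rcases hβ (planeProj z) with hβz | hβz
    · refine mul_left_cancel₀ hβz ?_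
      linear_combination (n₁ z) * (-hFz) + pd 0 F (planeProj z) * hnz
    · refine mul_left_cancel₀ hβz ?_
      linear_combination pd 1 F (planeProj z) * hnz - n₂ z * hFz
  obtain ⟨h, hh, hn⟩ := h₁.exists_eq_mul_of_parallel h₂ (hF.pd 0).comp_planeProj
    (hF.pd 1).comp_planeProj hpar (by simpa only [map_zero] using hF0)
  exact ⟨F, h, hF, hh, hF0, hn⟩

theorem exists_complexPotential_of_wronskian_eq_zero {n₁ n₂ : E3 → ℂ} (h₁ : SmoothNear n₁ 0)
    (h₂ : SmoothNear n₂ 0) (hw : ∀ᶠ z in 𝓝 0, n₁ z * pd 2 n₂ z - n₂ z * pd 2 n₁ z = 0)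
    (hind : (n₁ 0).re * (n₂ 0).im - (n₁ 0).im * (n₂ 0).re ≠ 0) :
    ∃ F : E2 → ℂ, ContDiff ℝ ∞ F ∧ ∀ᶠ z in 𝓝 0, ∃ h : ℂ,
      n₁ z = h * pd 0 F (planeProj z) ∧ n₂ z = h * pd 1 F (planeProj z) := by
  have hne : n₁ 0 ≠ 0 := fun h => hind (by simp [h])
  obtain ⟨σ, hσ, hσn⟩ := exists_ratio_of_wronskian_eq_zero h₁ h₂ hw hne
  have him : (σ 0).im ≠ 0 := by
    have hn0 := hσn.self_of_nhds
    rw [map_zero] at hn0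
    intro him
    rw [hn0, Complex.mul_im, Complex.mul_re, him] at hind
    exact hind (by ring)
  obtain ⟨F, hF, hF0, hFσ⟩ := exists_beltrami_solution hσ him
  have hFne : ∀ᶠ w in 𝓝 0, pd 0 F w ≠ 0 :=
    ((SmoothNear.of_contDiff hF).pd 0).continuousAt.eventually_ne hF0
  refine ⟨F, hF, ?_⟩
  filter_upwards [hσn, tendsto_planeProj.eventually hFσ, tendsto_planeProj.eventually hFne]
    with z hnz hFz hFnez
  change pd 1 F _ = σ _ * pd 0 F _ at hFz
  refine ⟨n₁ z / pd 0 F (planeProj z), (div_mul_cancel₀ _ hFnez).symm, ?_⟩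
  rw [hnz, hFz, mul_left_comm, div_mul_cancel₀ _ hFnez]

end Potential

section BalancedPlanar

/-- Coefficients of two contact forms `f₁ du + f₂ dv` and `g₁ du + g₂ dv` near the origin of space
which are balanced with sign `ε`, transverse, and have constant generating invariant `c`. -/
structure IsBalancedPlanar (ε c : ℝ) (f₁ f₂ g₁ g₂ : E3 → ℝ) : Prop where
  smooth_f₁ : SmoothNear f₁ 0
  smooth_f₂ : SmoothNear f₂ 0
  smooth_g₁ : SmoothNear g₁ 0
  smooth_g₂ : SmoothNear g₂ 0
  nondeg : ∀ᶠ z in 𝓝 0, f₁ z * pd 2 f₂ z - f₂ z * pd 2 f₁ z ≠ 0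
  balanced : ∀ᶠ z in 𝓝 0, g₁ z * pd 2 g₂ z - g₂ z * pd 2 g₁ z =
    ε * (f₁ z * pd 2 f₂ z - f₂ z * pd 2 f₁ z)
  invariant : ∀ᶠ z in 𝓝 0, f₁ z * pd 2 g₂ z - f₂ z * pd 2 g₁ z +
    (g₁ z * pd 2 f₂ z - g₂ z * pd 2 f₁ z) = c * (f₁ z * pd 2 f₂ z - f₂ z * pd 2 f₁ z)
  indep : f₁ 0 * g₂ 0 - f₂ 0 * g₁ 0 ≠ 0

/-- The planar functions `x, y` put the pair of forms into the normal form
`m dy + l dx`, `(c m - l) dy + ε m dx`. -/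
structure IsNormalizing (ε c : ℝ) (f₁ f₂ g₁ g₂ : E3 → ℝ) (x y : E2 → ℝ) (m l : E3 → ℝ) : Prop where
  smooth_x : SmoothNear x 0
  smooth_y : SmoothNear y 0
  smooth_m : SmoothNear m 0
  smooth_l : SmoothNear l 0
  jacobian : pd 0 x 0 * pd 1 y 0 - pd 1 x 0 * pd 0 y 0 ≠ 0
  normal_f₁ : ∀ᶠ z in 𝓝 0, f₁ z = m z * pd 0 y (planeProj z) + l z * pd 0 x (planeProj z)
  normal_f₂ : ∀ᶠ z in 𝓝 0, f₂ z = m z * pd 1 y (planeProj z) + l z * pd 1 x (planeProj z)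
  normal_g₁ : ∀ᶠ z in 𝓝 0,
    g₁ z = (c * m z - l z) * pd 0 y (planeProj z) + ε * m z * pd 0 x (planeProj z)
  normal_g₂ : ∀ᶠ z in 𝓝 0,
    g₂ z = (c * m z - l z) * pd 1 y (planeProj z) + ε * m z * pd 1 x (planeProj z)

/-- The combination `g - κ f` of two real functions, with `κ` in an extension of `ℝ`. When `κ` is
a root of `κ² - c κ + ε`, the pair of combinations formed from the coefficients of a balanced pair
has constant direction along the axis. -/
noncomputable def pencil {𝕜 : Type*} [NormedField 𝕜] [NormedAlgebra ℝ 𝕜] (κ : 𝕜) (f g : E3 → ℝ)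
    (z : E3) : 𝕜 :=
  algebraMap ℝ 𝕜 (g z) - κ * algebraMap ℝ 𝕜 (f z)

section Pencil

variable {𝕜 : Type*} [NormedField 𝕜] [NormedAlgebra ℝ 𝕜] {ε c : ℝ} {f g f₁ f₂ g₁ g₂ : E3 → ℝ}
  {z : E3}

theorem SmoothNear.pencil (κ : 𝕜) (hf : SmoothNear f z) (hg : SmoothNear g z) :
    SmoothNear (pencil κ f g) z :=
  (hg.clm_comp (algebraMapCLM ℝ 𝕜)).sub
    ((SmoothNear.const κ z).mul (hf.clm_comp (algebraMapCLM ℝ 𝕜)))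

theorem pd_pencil (κ : 𝕜) (i : Fin 3) (hf : DifferentiableAt ℝ f z)
    (hg : DifferentiableAt ℝ g z) : pd i (pencil κ f g) z = pencil κ (pd i f) (pd i g) z := by
  have hpd {k : E3 → ℝ} (hk : DifferentiableAt ℝ k z) :
      pd i (fun x => algebraMap ℝ 𝕜 (k x)) z = algebraMap ℝ 𝕜 (pd i k z) :=
    pd_clm (algebraMapCLM ℝ 𝕜) hk
  have hdiff {k : E3 → ℝ} (hk : DifferentiableAt ℝ k z) :
      DifferentiableAt ℝ (fun x => algebraMap ℝ 𝕜 (k x)) z :=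
    (algebraMapCLM ℝ 𝕜).differentiableAt.comp z hk
  rw [pencil, ← hpd hf, ← hpd hg, ← pd_const_mul κ (hdiff hf),
    ← pd_sub (hdiff hg) ((hdiff hf).const_mul κ)]
  rfl

theorem pencil_re (κ : ℂ) : (pencil κ f g z).re = g z - κ.re * f z := by
  simp [pencil]

theorem pencil_im (κ : ℂ) : (pencil κ f g z).im = -κ.im * f z := by
  simp [pencil]

theorem IsBalancedPlanar.wronskian_pencil_eq_zero (H : IsBalancedPlanar ε c f₁ f₂ g₁ g₂) {κ : 𝕜}
    (hκ : κ ^ 2 - algebraMap ℝ 𝕜 c * κ + algebraMap ℝ 𝕜 ε = 0) :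
    ∀ᶠ z in 𝓝 0, pencil κ f₁ g₁ z * pd 2 (pencil κ f₂ g₂) z -
      pencil κ f₂ g₂ z * pd 2 (pencil κ f₁ g₁) z = 0 := by
  filter_upwards [H.balanced, H.invariant, H.smooth_f₁.eventually_differentiableAt,
    H.smooth_f₂.eventually_differentiableAt, H.smooth_g₁.eventually_differentiableAt,
    H.smooth_g₂.eventually_differentiableAt] with z hbalanced hinvariant hf₁ hf₂ hg₁ hg₂
  rw [pd_pencil κ 2 hf₁ hg₁, pd_pencil κ 2 hf₂ hg₂]
  apply_fun algebraMap ℝ 𝕜 at hbalanced hinvariant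
  simp only [map_sub, map_mul, map_add] at hbalanced hinvariant
  simp only [pencil]
  linear_combination hbalanced - κ * hinvariant + (algebraMap ℝ 𝕜 (f₁ z) * algebraMap ℝ 𝕜
    (pd 2 f₂ z) - algebraMap ℝ 𝕜 (f₂ z) * algebraMap ℝ 𝕜 (pd 2 f₁ z)) * hκ

end Pencil

variable {ε c κ κ₁ κ₂ : ℝ} {f₁ f₂ g₁ g₂ : E3 → ℝ} {x y F : E2 → ℝ}

theorem IsBalancedPlanar.exists_isNormalizing_of_normal (H : IsBalancedPlanar ε c f₁ f₂ g₁ g₂)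
    (hx : SmoothNear x 0) (hy : SmoothNear y 0)
    (hnormal : ∀ᶠ z in 𝓝 0, ∃ m l : ℝ,
      f₁ z = m * pd 0 y (planeProj z) + l * pd 0 x (planeProj z) ∧
      f₂ z = m * pd 1 y (planeProj z) + l * pd 1 x (planeProj z) ∧
      g₁ z = (c * m - l) * pd 0 y (planeProj z) + ε * m * pd 0 x (planeProj z) ∧
      g₂ z = (c * m - l) * pd 1 y (planeProj z) + ε * m * pd 1 x (planeProj z)) :
    ∃ m l, IsNormalizing ε c f₁ f₂ g₁ g₂ x y m l := by
  have hjacobian : pd 0 x 0 * pd 1 y 0 - pd 1 x 0 * pd 0 y 0 ≠ 0 := by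
    intro hJ
    obtain ⟨m, l, hf₁, hf₂, hg₁, hg₂⟩ := hnormal.self_of_nhds
    rw [map_zero] at hf₁ hf₂ hg₁ hg₂
    apply H.indep
    rw [hf₁, hf₂, hg₁, hg₂]
    linear_combination (c * m * l - l ^ 2 - ε * m ^ 2) * hJ
  have hx₀ := (hx.pd 0).comp_planeProj
  have hx₁ := (hx.pd 1).comp_planeProj
  have hy₀ := (hy.pd 0).comp_planeProj
  have hy₁ := (hy.pd 1).comp_planeProj
  let J (z : E3) : ℝ := pd 0 x (planeProj z) * pd 1 y (planeProj z) -
    pd 1 x (planeProj z) * pd 0 y (planeProj z)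
  have hJ : SmoothNear J 0 := (hx₀.mul hy₁).sub (hx₁.mul hy₀)
  have hJ0 : J 0 ≠ 0 := by simpa only [J, map_zero] using hjacobian
  let m (z : E3) : ℝ := (pd 0 x (planeProj z) * f₂ z - pd 1 x (planeProj z) * f₁ z) / J z
  let l (z : E3) : ℝ := (pd 1 y (planeProj z) * f₁ z - pd 0 y (planeProj z) * f₂ z) / J z
  have hcoeff : ∀ᶠ z in 𝓝 0,
      (f₁ z = m z * pd 0 y (planeProj z) + l z * pd 0 x (planeProj z) ∧
      f₂ z = m z * pd 1 y (planeProj z) + l z * pd 1 x (planeProj z)) ∧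
      g₁ z = (c * m z - l z) * pd 0 y (planeProj z) + ε * m z * pd 0 x (planeProj z) ∧
      g₂ z = (c * m z - l z) * pd 1 y (planeProj z) + ε * m z * pd 1 x (planeProj z) := by
    filter_upwards [hnormal, hJ.continuousAt.eventually_ne hJ0]
      with z ⟨m', l', hf₁, hf₂, hg₁, hg₂⟩ hJz
    obtain rfl : m z = m' := by
      rw [div_eq_iff hJz, hf₁, hf₂]; ring
    obtain rfl : l z = l' := by
      rw [div_eq_iff hJz, hf₁, hf₂]; ring
    exact ⟨⟨hf₁, hf₂⟩, hg₁, hg₂⟩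
  exact ⟨m, l, hx, hy, ((hx₀.mul H.smooth_f₂).sub (hx₁.mul H.smooth_f₁)).div hJ hJ0,
    ((hy₁.mul H.smooth_f₁).sub (hy₀.mul H.smooth_f₂)).div hJ hJ0, hjacobian,
    hcoeff.mono fun _ h => h.1.1, hcoeff.mono fun _ h => h.1.2, hcoeff.mono fun _ h => h.2.1,
    hcoeff.mono fun _ h => h.2.2⟩

theorem IsBalancedPlanar.exists_isNormalizing_of_potential (H : IsBalancedPlanar ε c f₁ f₂ g₁ g₂)
    (hc : c = κ₁ + κ₂) (hε : ε = κ₁ * κ₂) (hF : SmoothNear F 0) (hx : SmoothNear x 0)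
    (hpotential : ∀ᶠ z in 𝓝 0, ∃ m h : ℝ,
      f₁ z = m * pd 0 F (planeProj z) - h * pd 0 x (planeProj z) ∧
      f₂ z = m * pd 1 F (planeProj z) - h * pd 1 x (planeProj z) ∧
      g₁ z - κ₁ * f₁ z = h * (pd 0 F (planeProj z) + (κ₁ - κ₂) * pd 0 x (planeProj z)) ∧
      g₂ z - κ₁ * f₂ z = h * (pd 1 F (planeProj z) + (κ₁ - κ₂) * pd 1 x (planeProj z))) :
    ∃ m l, IsNormalizing ε c f₁ f₂ g₁ g₂ x (fun w => F w - κ₂ * x w) m l := by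
  refine H.exists_isNormalizing_of_normal hx (hF.sub (hx.const_mul κ₂)) ?_
  filter_upwards [hpotential, tendsto_planeProj.eventually hF.eventually_differentiableAt,
    tendsto_planeProj.eventually hx.eventually_differentiableAt]
    with z ⟨m, h, hf₁, hf₂, hg₁, hg₂⟩ hFz hxz
  have hpd (i : Fin 2) : pd i (fun w => F w - κ₂ * x w) (planeProj z) =
      pd i F (planeProj z) - κ₂ * pd i x (planeProj z) := by
    rw [pd_sub hFz (hxz.const_mul _), pd_const_mul _ hxz]
  rw [hpd, hpd, hc, hε]
  refine ⟨m, κ₂ * m - h, ?_, ?_, ?_, ?_⟩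
  · linear_combination hf₁
  · linear_combination hf₂
  · linear_combination hg₁ + κ₁ * hf₁
  · linear_combination hg₂ + κ₁ * hf₂

theorem IsBalancedPlanar.exists_potential (H : IsBalancedPlanar ε c f₁ f₂ g₁ g₂)
    (hκ : κ ^ 2 - c * κ + ε = 0) :
    ∃ (F : E2 → ℝ) (h : E3 → ℝ), SmoothNear F 0 ∧ SmoothNear h 0 ∧
      (pd 0 F 0 ≠ 0 ∨ pd 1 F 0 ≠ 0) ∧
      ∀ᶠ z in 𝓝 0, g₁ z - κ * f₁ z = h z * pd 0 F (planeProj z) ∧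
        g₂ z - κ * f₂ z = h z * pd 1 F (planeProj z) := by
  refine exists_potential_of_wronskian_eq_zero (.pencil κ H.smooth_f₁ H.smooth_g₁)
    (.pencil κ H.smooth_f₂ H.smooth_g₂) (H.wronskian_pencil_eq_zero hκ) ?_
  by_contra! ⟨hu, hv⟩
  change g₁ 0 - κ * f₁ 0 = 0 at hu
  change g₂ 0 - κ * f₂ 0 = 0 at hv
  exact H.indep (by linear_combination f₁ 0 * hv - f₂ 0 * hu)

theorem IsBalancedPlanar.exists_isNormalizing_of_ne (H : IsBalancedPlanar ε c f₁ f₂ g₁ g₂)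
    (hc : c = κ₁ + κ₂) (hε : ε = κ₁ * κ₂) (hne : κ₁ ≠ κ₂) :
    ∃ x y m l, IsNormalizing ε c f₁ f₂ g₁ g₂ x y m l := by
  obtain ⟨F₁, h₁, hF₁, -, -, hn₁⟩ := H.exists_potential (κ := κ₁) (by rw [hc, hε]; ring)
  obtain ⟨F₂, h₂, hF₂, -, -, hn₂⟩ := H.exists_potential (κ := κ₂) (by rw [hc, hε]; ring)
  have hκ : κ₁ - κ₂ ≠ 0 := sub_ne_zero.2 hne
  refine ⟨_, _, H.exists_isNormalizing_of_potential hc hε hF₂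
    ((hF₁.sub hF₂).const_mul (κ₁ - κ₂)⁻¹) ?_⟩
  filter_upwards [hn₁, hn₂, tendsto_planeProj.eventually hF₁.eventually_differentiableAt,
    tendsto_planeProj.eventually hF₂.eventually_differentiableAt]
    with z ⟨hu₁, hv₁⟩ ⟨hu₂, hv₂⟩ hF₁z hF₂z
  have hpd (i : Fin 2) : pd i (fun w => (κ₁ - κ₂)⁻¹ * (F₁ w - F₂ w)) (planeProj z) =
      (κ₁ - κ₂)⁻¹ * (pd i F₁ (planeProj z) - pd i F₂ (planeProj z)) := by
    rw [pd_const_mul _ (hF₁z.fun_sub hF₂z), pd_sub hF₁z hF₂z]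
  rw [hpd, hpd]
  refine ⟨(κ₁ - κ₂)⁻¹ * (h₂ z - h₁ z), h₁ z, ?_, ?_, ?_, ?_⟩ <;> field_simp
  · linear_combination hu₂ - hu₁
  · linear_combination hv₂ - hv₁
  · linear_combination hu₁
  · linear_combination hv₁

theorem IsBalancedPlanar.wronskian_potential_eq_zero (H : IsBalancedPlanar ε (2 * κ) f₁ f₂ g₁ g₂)
    (hF : SmoothNear F 0) {h : E3 → ℝ} (hh : SmoothNear h 0)
    (hn : ∀ᶠ z in 𝓝 0, g₁ z - κ * f₁ z = h z * pd 0 F (planeProj z) ∧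
      g₂ z - κ * f₂ z = h z * pd 1 F (planeProj z)) :
    ∀ᶠ z in 𝓝 0, h z * pd 2
      (fun z => f₁ z * pd 1 F (planeProj z) - f₂ z * pd 0 F (planeProj z)) z -
      (f₁ z * pd 1 F (planeProj z) - f₂ z * pd 0 F (planeProj z)) * pd 2 h z = 0 := by
  filter_upwards [H.invariant, H.smooth_f₁.eventually_differentiableAt,
    H.smooth_f₂.eventually_differentiableAt, H.smooth_g₁.eventually_differentiableAt,
    H.smooth_g₂.eventually_differentiableAt,
    (hF.pd 0).comp_planeProj.eventually_differentiableAt,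
    (hF.pd 1).comp_planeProj.eventually_differentiableAt, hh.eventually_differentiableAt,
    hn.eventually_nhds, tendsto_planeProj.eventually (hF.pd 0).eventually_differentiableAt,
    tendsto_planeProj.eventually (hF.pd 1).eventually_differentiableAt]
    with z hinvariant hf₁ hf₂ hg₁ hg₂ hFu hFv hhz hnz hFu' hFv'
  have hdu : pd 2 (fun z => g₁ z - κ * f₁ z) z = pd 2 (fun z => h z * pd 0 F (planeProj z)) z :=
    pd_congr (hnz.mono fun _ hz => hz.1)
  have hdv : pd 2 (fun z => g₂ z - κ * f₂ z) z = pd 2 (fun z => h z * pd 1 F (planeProj z)) z :=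
    pd_congr (hnz.mono fun _ hz => hz.2)
  obtain ⟨hu, hv⟩ := hnz.self_of_nhds
  rw [pd_sub hg₁ (hf₁.const_mul κ), pd_const_mul κ hf₁, pd_mul hhz hFu,
    pd_two_comp_planeProj hFu'] at hdu
  rw [pd_sub hg₂ (hf₂.const_mul κ), pd_const_mul κ hf₂, pd_mul hhz hFv,
    pd_two_comp_planeProj hFv'] at hdv
  rw [pd_sub (hf₁.fun_mul hFv) (hf₂.fun_mul hFu), pd_mul hf₁ hFv, pd_mul hf₂ hFu,
    pd_two_comp_planeProj hFu', pd_two_comp_planeProj hFv']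
  linear_combination f₁ z * hdv - f₂ z * hdu - hinvariant + pd 2 f₂ z * hu - pd 2 f₁ z * hv

theorem IsBalancedPlanar.exists_ratio_potential (H : IsBalancedPlanar ε (2 * κ) f₁ f₂ g₁ g₂)
    (hF : SmoothNear F 0) {h : E3 → ℝ} (hh : SmoothNear h 0)
    (hn : ∀ᶠ z in 𝓝 0, g₁ z - κ * f₁ z = h z * pd 0 F (planeProj z) ∧
      g₂ z - κ * f₂ z = h z * pd 1 F (planeProj z)) :
    ∃ q : E2 → ℝ, SmoothNear q 0 ∧ q 0 ≠ 0 ∧ ∀ᶠ z in 𝓝 0,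
      f₁ z * pd 1 F (planeProj z) - f₂ z * pd 0 F (planeProj z) = q (planeProj z) * h z := by
  have hn0 := hn.self_of_nhds
  have hh0 : h 0 ≠ 0 := by
    intro h0
    rw [h0, zero_mul, zero_mul] at hn0
    exact H.indep (by linear_combination f₁ 0 * hn0.2 - f₂ 0 * hn0.1)
  obtain ⟨q, hq, hqh⟩ := exists_ratio_of_wronskian_eq_zero hh
    ((H.smooth_f₁.mul (hF.pd 1).comp_planeProj).sub (H.smooth_f₂.mul (hF.pd 0).comp_planeProj))
    (H.wronskian_potential_eq_zero hF hh hn) hh0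
  refine ⟨q, hq, fun hq0 => H.indep ?_, hqh⟩
  have hqh0 := hqh.self_of_nhds
  rw [map_zero] at hn0 hqh0
  rw [hq0] at hqh0
  linear_combination f₁ 0 * hn0.2 - f₂ 0 * hn0.1 + h 0 * hqh0

theorem IsBalancedPlanar.exists_isNormalizing_of_double
    (H : IsBalancedPlanar (κ * κ) (2 * κ) f₁ f₂ g₁ g₂) :
    ∃ x y m l, IsNormalizing (κ * κ) (2 * κ) f₁ f₂ g₁ g₂ x y m l := by
  obtain ⟨F, h, hF, hh, hF0, hn⟩ := H.exists_potential (κ := κ) (by ring)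
  obtain ⟨q, hq, hq0, hqh⟩ := H.exists_ratio_potential hF hh hn
  obtain ⟨-, x, -, hx, -, -, hVx⟩ := exists_firstIntegral
    ((hF.pd 1).div hq hq0).neg ((hF.pd 0).div hq hq0)
    (hF0.symm.imp (fun hne => neg_ne_zero.2 (div_ne_zero hne hq0)) (div_ne_zero · hq0))
  have hx0 := (hx.pd 0).comp_planeProj
  have hx1 := (hx.pd 1).comp_planeProj
  have hpar : ∀ᶠ z in 𝓝 0, (f₁ z + h z * pd 0 x (planeProj z)) * pd 1 F (planeProj z) =
      (f₂ z + h z * pd 1 x (planeProj z)) * pd 0 F (planeProj z) := by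
    filter_upwards [hqh, tendsto_planeProj.eventually hVx,
      tendsto_planeProj.eventually (hq.continuousAt.eventually_ne hq0)] with z hqhz hVxz hqz
    field_simp at hVxz
    linear_combination hqhz - h z * hVxz
  obtain ⟨m, -, hm⟩ := (H.smooth_f₁.add (hh.mul hx0)).exists_eq_mul_of_parallel
    (H.smooth_f₂.add (hh.mul hx1)) (hF.pd 0).comp_planeProj (hF.pd 1).comp_planeProj hpar
    (by simpa only [map_zero] using hF0)
  refine ⟨x, _, H.exists_isNormalizing_of_potential (two_mul κ) rfl hF hx ?_⟩
  filter_upwards [hn, hm] with z ⟨hu, hv⟩ ⟨hmu, hmv⟩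
  refine ⟨m z, h z, ?_, ?_, ?_, ?_⟩
  · linear_combination hmu
  · linear_combination hmv
  · linear_combination hu
  · linear_combination hv

/-- For partial derivatives `A + i B` of a complex potential `F`, the right-hand sides are in normal
form for the functions `x = Im F / b` and `y = Re F - a x`. -/
theorem normal_of_pencil_eq_mul {a b f g A B : ℝ} {h : ℂ} (hb : b ≠ 0)
    (hre : g - a * f = h.re * A - h.im * B) (him : -b * f = h.re * B + h.im * A) :
    f = -b⁻¹ * h.im * (A - a * b⁻¹ * B) + (-a * b⁻¹ * h.im - h.re) * (b⁻¹ * B) ∧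
    g = (2 * a * (-b⁻¹ * h.im) - (-a * b⁻¹ * h.im - h.re)) * (A - a * b⁻¹ * B) +
      (a ^ 2 + b ^ 2) * (-b⁻¹ * h.im) * (b⁻¹ * B) := by
  have hf : f = -b⁻¹ * (h.re * B + h.im * A) := by
    rw [← him]
    field_simp
  have hg : g = a * f + (h.re * A - h.im * B) := by linear_combination hre
  rw [hg, hf]
  constructor <;> field_simp <;> ring

theorem IsBalancedPlanar.exists_complexPotential {a b : ℝ}
    (H : IsBalancedPlanar (a ^ 2 + b ^ 2) (2 * a) f₁ f₂ g₁ g₂) (hb : b ≠ 0) :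
    ∃ F : E2 → ℂ, ContDiff ℝ ∞ F ∧ ∀ᶠ z in 𝓝 0, ∃ h : ℂ,
      pencil (⟨a, b⟩ : ℂ) f₁ g₁ z = h * pd 0 F (planeProj z) ∧
      pencil (⟨a, b⟩ : ℂ) f₂ g₂ z = h * pd 1 F (planeProj z) := by
  refine exists_complexPotential_of_wronskian_eq_zero (.pencil _ H.smooth_f₁ H.smooth_g₁)
    (.pencil _ H.smooth_f₂ H.smooth_g₂) (H.wronskian_pencil_eq_zero ?_) ?_
  · apply Complex.ext <;> simp [pow_two] <;> ring
  · simp only [pencil_re, pencil_im]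
    intro hzero
    exact H.indep (mul_left_cancel₀ hb (by linear_combination hzero))

theorem IsBalancedPlanar.exists_isNormalizing_of_complex {a b : ℝ}
    (H : IsBalancedPlanar (a ^ 2 + b ^ 2) (2 * a) f₁ f₂ g₁ g₂) (hb : b ≠ 0) :
    ∃ x y m l, IsNormalizing (a ^ 2 + b ^ 2) (2 * a) f₁ f₂ g₁ g₂ x y m l := by
  obtain ⟨F, hF, hpotential⟩ := H.exists_complexPotential hb
  have hdF (w) : DifferentiableAt ℝ F w := hF.contDiffAt.differentiableAt (by simp)
  have hdre (w) : DifferentiableAt ℝ (fun w => (F w).re) w :=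
    Complex.reCLM.differentiableAt.comp w (hdF w)
  have hdim (w) : DifferentiableAt ℝ (fun w => (F w).im) w :=
    Complex.imCLM.differentiableAt.comp w (hdF w)
  have hre (i w) : pd i (fun w => (F w).re) w = (pd i F w).re := pd_clm Complex.reCLM (hdF w)
  have him (i w) : pd i (fun w => (F w).im) w = (pd i F w).im := pd_clm Complex.imCLM (hdF w)
  have hsre : SmoothNear (fun w => (F w).re) 0 := (SmoothNear.of_contDiff hF).clm_comp Complex.reCLM
  have hsim : SmoothNear (fun w => (F w).im) 0 := (SmoothNear.of_contDiff hF).clm_comp Complex.imCLM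
  refine ⟨_, _, H.exists_isNormalizing_of_normal (hsim.const_mul b⁻¹)
    (hsre.sub (hsim.const_mul (a * b⁻¹))) ?_⟩
  filter_upwards [hpotential] with z ⟨h, hu, hv⟩
  simp only [pd_sub (hdre _) ((hdim _).const_mul _), pd_const_mul _ (hdim _), hre, him]
  have hu_re := congrArg Complex.re hu
  have hu_im := congrArg Complex.im hu
  have hv_re := congrArg Complex.re hv
  have hv_im := congrArg Complex.im hv
  rw [Complex.mul_re, pencil_re] at hu_re hv_re
  rw [Complex.mul_im, pencil_im] at hu_im hv_im
  obtain ⟨hf₁, hg₁⟩ := normal_of_pencil_eq_mul hb hu_re hu_im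
  obtain ⟨hf₂, hg₂⟩ := normal_of_pencil_eq_mul hb hv_re hv_im
  exact ⟨_, _, hf₁, hf₂, hg₁, hg₂⟩

theorem IsBalancedPlanar.exists_isNormalizing (H : IsBalancedPlanar ε c f₁ f₂ g₁ g₂) :
    ∃ x y m l, IsNormalizing ε c f₁ f₂ g₁ g₂ x y m l := by
  obtain ⟨κ, rfl⟩ : ∃ κ, c = 2 * κ := ⟨c / 2, by ring⟩
  rcases lt_trichotomy (κ ^ 2) ε with hlt | heq | hgt
  · obtain ⟨b, hb, rfl⟩ : ∃ b, b ≠ 0 ∧ ε = κ ^ 2 + b ^ 2 := by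
      have hpos := sub_pos.2 hlt
      exact ⟨√(ε - κ ^ 2), (Real.sqrt_pos.2 hpos).ne', by rw [Real.sq_sqrt hpos.le]; ring⟩
    exact H.exists_isNormalizing_of_complex hb
  · obtain rfl : ε = κ * κ := by rw [← heq, pow_two]
    exact H.exists_isNormalizing_of_double
  · have hpos := sub_pos.2 hgt
    have hsq := Real.sq_sqrt hpos.le
    have hsqrt := Real.sqrt_pos.2 hpos
    exact H.exists_isNormalizing_of_ne (κ₁ := κ + √(κ ^ 2 - ε)) (κ₂ := κ - √(κ ^ 2 - ε))
      (by ring) (by linear_combination hsq) (by intro h; linarith)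

end BalancedPlanar

/-! ### Normal form of a balanced pair -/

section NormalForm

variable {ε c : ℝ} {f₁ f₂ g₁ g₂ : E3 → ℝ} {x y : E2 → ℝ} {m l p : E3 → ℝ}

theorem eventually_pd_linearCombination (hx : SmoothNear x 0) (hy : SmoothNear y 0)
    (a b : ℝ) (i : Fin 2) :
    ∀ᶠ w in 𝓝 0, pd i (fun w => a * x w + b * y w) w = a * pd i x w + b * pd i y w := by
  filter_upwards [hx.eventually_differentiableAt, hy.eventually_differentiableAt] with w hx hy
  rw [pd_add (hx.const_mul a) (hy.const_mul b), pd_const_mul _ hx, pd_const_mul _ hy]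

theorem IsNormalizing.linearChange (N : IsNormalizing ε c f₁ f₂ g₁ g₂ x y m l) {s Δ : ℝ}
    (hΔ : Δ ≠ 0) (hs : Δ = s ^ 2 + c * s + ε) :
    IsNormalizing ε c f₁ f₂ g₁ g₂
      (fun w => (s + c) / Δ * x w + 1 / Δ * y w)
      (fun w => -ε / Δ * x w + s / Δ * y w)
      (fun z => s * m z + (c * m z - l z)) (fun z => s * l z + ε * m z) := by
  have hpdx := eventually_pd_linearCombination N.smooth_x N.smooth_y ((s + c) / Δ) (1 / Δ)
  have hpdy := eventually_pd_linearCombination N.smooth_x N.smooth_y (-ε / Δ) (s / Δ)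
  have hpdx' (i : Fin 2) := tendsto_planeProj.eventually (hpdx i)
  have hpdy' (i : Fin 2) := tendsto_planeProj.eventually (hpdy i)
  refine ⟨(N.smooth_x.const_mul _).add (N.smooth_y.const_mul _),
    (N.smooth_x.const_mul _).add (N.smooth_y.const_mul _),
    (N.smooth_m.const_mul _).add ((N.smooth_m.const_mul _).sub N.smooth_l),
    (N.smooth_l.const_mul _).add (N.smooth_m.const_mul _), ?_, ?_, ?_, ?_, ?_⟩
  · rw [(hpdx 0).self_of_nhds, (hpdx 1).self_of_nhds, (hpdy 0).self_of_nhds,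
      (hpdy 1).self_of_nhds]
    convert mul_ne_zero (inv_ne_zero hΔ) N.jacobian using 1
    field_simp
    linear_combination (pd 1 x 0 * pd 0 y 0 - pd 0 x 0 * pd 1 y 0) * hs
  · filter_upwards [N.normal_f₁, hpdx' 0, hpdy' 0] with z hf hx hy
    rw [hf, hx, hy]
    field_simp
    linear_combination (m z * pd 0 y _ + l z * pd 0 x _) * hs
  · filter_upwards [N.normal_f₂, hpdx' 1, hpdy' 1] with z hf hx hy
    rw [hf, hx, hy]
    field_simp
    linear_combination (m z * pd 1 y _ + l z * pd 1 x _) * hs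
  · filter_upwards [N.normal_g₁, hpdx' 0, hpdy' 0] with z hg hx hy
    rw [hg, hx, hy]
    field_simp
    linear_combination ((c * m z - l z) * pd 0 y _ + ε * m z * pd 0 x _) * hs
  · filter_upwards [N.normal_g₂, hpdx' 1, hpdy' 1] with z hg hx hy
    rw [hg, hx, hy]
    field_simp
    linear_combination ((c * m z - l z) * pd 1 y _ + ε * m z * pd 1 x _) * hs

theorem IsNormalizing.quadratic_ne_zero (N : IsNormalizing ε c f₁ f₂ g₁ g₂ x y m l)
    (H : IsBalancedPlanar ε c f₁ f₂ g₁ g₂) : l 0 * (c * m 0 - l 0) - ε * m 0 ^ 2 ≠ 0 := by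
  intro hQ
  apply H.indep
  rw [N.normal_f₁.self_of_nhds, N.normal_f₂.self_of_nhds, N.normal_g₁.self_of_nhds,
    N.normal_g₂.self_of_nhds]
  simp only [map_zero]
  linear_combination (pd 0 x 0 * pd 1 y 0 - pd 1 x 0 * pd 0 y 0) * hQ

theorem IsBalancedPlanar.exists_isNormalizing_ne_zero (H : IsBalancedPlanar ε c f₁ f₂ g₁ g₂) :
    ∃ x y m l, IsNormalizing ε c f₁ f₂ g₁ g₂ x y m l ∧ m 0 ≠ 0 ∧ c * m 0 - l 0 ≠ 0 := by
  obtain ⟨x, y, m, l, N⟩ := H.exists_isNormalizing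
  by_cases hml : m 0 ≠ 0 ∧ c * m 0 - l 0 ≠ 0
  · exact ⟨x, y, m, l, N, hml⟩
  -- A large `s` makes both the change of coordinates invertible and the new coefficients nonzero.
  let s := |c| + |ε| + 1
  have hs : 0 < s := by positivity
  have hsc : 0 < s + c := by linarith [neg_abs_le c, abs_nonneg ε]
  have hΔ : 0 < s ^ 2 + c * s + ε := by
    have hsε : 1 * (|ε| + 1) ≤ s * (s + c) :=
      mul_le_mul (by linarith [abs_nonneg c, abs_nonneg ε]) (by linarith [neg_abs_le c])
        (by positivity) hs.le
    linarith [neg_abs_le ε]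
  refine ⟨_, _, _, _, N.linearChange hΔ.ne' rfl, ?_⟩
  have hQ := N.quadratic_ne_zero H
  rw [not_and_or, not_not, not_not] at hml
  rcases hml with hm | hml
  · have hl : l 0 ≠ 0 := fun hl => hQ (by rw [hm, hl]; ring)
    constructor
    · convert neg_ne_zero.2 hl using 1
      rw [hm]; ring
    · convert neg_ne_zero.2 (mul_ne_zero hsc.ne' hl) using 1
      rw [hm]; ring
  · have hεm : ε * m 0 ^ 2 ≠ 0 := fun hεm => hQ (by rw [hml, hεm]; ring)
    obtain ⟨hε, hm⟩ := mul_ne_zero_iff.1 hεm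
    have hm := (pow_ne_zero_iff two_ne_zero).1 hm
    constructor
    · rw [hml, add_zero]
      exact mul_ne_zero hs.ne' hm
    · convert neg_ne_zero.2 (mul_ne_zero hε hm) using 1
      linear_combination (s + c) * hml

theorem IsNormalizing.wronskian_ne_zero (N : IsNormalizing ε c f₁ f₂ g₁ g₂ x y m l)
    (H : IsBalancedPlanar ε c f₁ f₂ g₁ g₂) : m 0 * pd 2 l 0 - l 0 * pd 2 m 0 ≠ 0 := by
  have hm := N.smooth_m.eventually_differentiableAt.self_of_nhds
  have hl := N.smooth_l.eventually_differentiableAt.self_of_nhds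
  have hpd {f : E3 → ℝ} {a b : E2 → ℝ} (ha : SmoothNear a 0) (hb : SmoothNear b 0)
      (hf : ∀ᶠ z in 𝓝 0, f z = m z * a (planeProj z) + l z * b (planeProj z)) :
      pd 2 f 0 = pd 2 m 0 * a 0 + pd 2 l 0 * b 0 := by
    have hda := ha.comp_planeProj.eventually_differentiableAt.self_of_nhds
    have hdb := hb.comp_planeProj.eventually_differentiableAt.self_of_nhds
    have hpd0 {w : E2 → ℝ} (hw : SmoothNear w 0) : pd 2 (fun z => w (planeProj z)) 0 = 0 :=
      pd_two_comp_planeProj (by simpa using hw.eventually_differentiableAt.self_of_nhds)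
    rw [pd_congr hf, pd_add (hm.fun_mul hda) (hl.fun_mul hdb), pd_mul hm hda, pd_mul hl hdb,
      hpd0 ha, hpd0 hb, map_zero]
    ring
  intro hW
  apply H.nondeg.self_of_nhds
  rw [hpd (N.smooth_y.pd 0) (N.smooth_x.pd 0) N.normal_f₁,
    hpd (N.smooth_y.pd 1) (N.smooth_x.pd 1) N.normal_f₂, N.normal_f₁.self_of_nhds,
    N.normal_f₂.self_of_nhds, map_zero]
  linear_combination (pd 0 y 0 * pd 1 x 0 - pd 1 y 0 * pd 0 x 0) * hW

theorem IsNormalizing.pd_neg_div_ne_zero (N : IsNormalizing ε c f₁ f₂ g₁ g₂ x y m l)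
    (H : IsBalancedPlanar ε c f₁ f₂ g₁ g₂) (hm0 : m 0 ≠ 0) :
    pd 2 (fun z => -l z / m z) 0 ≠ 0 := by
  have hp := (N.smooth_l.neg.div N.smooth_m hm0).eventually_differentiableAt.self_of_nhds
  have hm := N.smooth_m.eventually_differentiableAt.self_of_nhds
  have hl := N.smooth_l.eventually_differentiableAt.self_of_nhds
  have hpm : pd 2 (fun z => -1 * l z) 0 = pd 2 (fun z => -l z / m z * m z) 0 := by
    refine pd_congr ?_
    filter_upwards [N.smooth_m.continuousAt.eventually_ne hm0] with z hmz
    field_simp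
  rw [pd_const_mul _ hl, pd_mul hp hm] at hpm
  intro hzero
  apply N.wronskian_ne_zero H
  rw [hzero] at hpm
  field_simp at hpm
  linear_combination -hpm

/-- The map of space with first two coordinates `x`, `y`, which depend only on the first two
coordinates, and third coordinate `p`. -/
noncomputable def fiberedMap (x y : E2 → ℝ) (p : E3 → ℝ) (z : E3) : E3 :=
  !₂[x (planeProj z), y (planeProj z), p z]

theorem SmoothNear.fiberedMap (hx : SmoothNear x 0) (hy : SmoothNear y 0) (hp : SmoothNear p 0) :
    SmoothNear (fiberedMap x y p) 0 := by
  filter_upwards [hx.comp_planeProj, hy.comp_planeProj, hp] with z hxz hyz hpz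
  rw [contDiffAt_euclidean]
  intro i
  fin_cases i
  exacts [hxz, hyz, hpz]

theorem fderiv_euclidean_apply {E : Type*} [NormedAddCommGroup E] [NormedSpace ℝ E] {n : ℕ}
    {f : E → EuclideanSpace ℝ (Fin n)} {z : E} (hf : DifferentiableAt ℝ f z) (v : E) (i : Fin n) :
    fderiv ℝ f z v i = fderiv ℝ (fun z => f z i) z v :=
  (DFunLike.congr_fun
    ((EuclideanSpace.proj (𝕜 := ℝ) i).hasFDerivAt.comp z hf.hasFDerivAt).fderiv v).symm

theorem eventually_fderiv_fiberedMap (hx : SmoothNear x 0) (hy : SmoothNear y 0)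
    (hp : SmoothNear p 0) : ∀ᶠ z in 𝓝 0, ∀ v : E3,
      fderiv ℝ (fiberedMap x y p) z v 0 =
        v 0 * pd 0 x (planeProj z) + v 1 * pd 1 x (planeProj z) ∧
      fderiv ℝ (fiberedMap x y p) z v 1 =
        v 0 * pd 0 y (planeProj z) + v 1 * pd 1 y (planeProj z) ∧
      fderiv ℝ (fiberedMap x y p) z v 2 = fderiv ℝ p z v := by
  filter_upwards [(hx.fiberedMap hy hp).eventually_differentiableAt,
    tendsto_planeProj.eventually hx.eventually_differentiableAt,
    tendsto_planeProj.eventually hy.eventually_differentiableAt] with z hz hxz hyz v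
  rw [fderiv_euclidean_apply hz, fderiv_euclidean_apply hz, fderiv_euclidean_apply hz]
  exact ⟨(fderiv_comp_planeProj hxz v).trans (fderiv_apply_eq_pd _ _),
    (fderiv_comp_planeProj hyz v).trans (fderiv_apply_eq_pd _ _), rfl⟩

theorem fderiv_fiberedMap_injective (hx : SmoothNear x 0) (hy : SmoothNear y 0)
    (hp : SmoothNear p 0) (hJ : pd 0 x 0 * pd 1 y 0 - pd 1 x 0 * pd 0 y 0 ≠ 0)
    (hdp : pd 2 p 0 ≠ 0) : Function.Injective (fderiv ℝ (fiberedMap x y p) 0) := by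
  rw [injective_iff_map_eq_zero]
  intro v hv
  obtain ⟨hx0, hy0, hp0⟩ := (eventually_fderiv_fiberedMap hx hy hp).self_of_nhds v
  rw [hv, PiLp.zero_apply] at hx0 hy0 hp0
  rw [map_zero] at hx0 hy0
  have hv0 : v 0 = 0 := by
    refine (mul_eq_zero.1 (?_ : v 0 * _ = 0)).resolve_right hJ
    linear_combination pd 1 x 0 * hy0 - pd 1 y 0 * hx0
  have hv1 : v 1 = 0 := by
    refine (mul_eq_zero.1 (?_ : v 1 * _ = 0)).resolve_right hJ
    linear_combination pd 0 y 0 * hx0 - pd 0 x 0 * hy0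
  have hv2 : v 2 = 0 := by
    rw [fderiv_apply_eq_sum_pd, Fin.sum_univ_three, hv0, hv1, zero_smul, zero_smul, zero_add,
      zero_add] at hp0
    exact (mul_eq_zero.1 hp0.symm).resolve_right hdp
  ext i
  fin_cases i
  exacts [hv0, hv1, hv2]

theorem exists_isSmoothLocalDiffeo_eq_fiberedMap (hx : SmoothNear x 0) (hy : SmoothNear y 0)
    (hp : SmoothNear p 0) (hJ : pd 0 x 0 * pd 1 y 0 - pd 1 x 0 * pd 0 y 0 ≠ 0)
    (hdp : pd 2 p 0 ≠ 0) :
    ∃ Θ : OpenPartialHomeomorph E3 E3, 0 ∈ Θ.source ∧ ⇑Θ = fiberedMap x y p ∧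
      IsSmoothLocalDiffeo Θ := by
  have hsmooth := hx.fiberedMap hy hp
  let L := (LinearEquiv.ofInjectiveEndo (fderiv ℝ (fiberedMap x y p) 0 : E3 →ₗ[ℝ] E3)
    (fderiv_fiberedMap_injective hx hy hp hJ hdp)).toContinuousLinearEquiv
  have hL : (L : E3 →L[ℝ] E3) = fderiv ℝ (fiberedMap x y p) 0 := by ext1 v; rfl
  refine hsmooth.exists_isSmoothLocalDiffeo (f' := L) ?_
  rw [hL]
  exact hsmooth.eventually_differentiableAt.self_of_nhds.hasFDerivAt

/-- The one-form `f₁ du + f₂ dv` on space, where `u, v` are the first two coordinates. -/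
noncomputable def planarForm (f₁ f₂ : E3 → ℝ) (z : E3) : E3 →L[ℝ] ℝ :=
  f₁ z • EuclideanSpace.proj 0 + f₂ z • EuclideanSpace.proj 1

/-- The covectors `a` and `a'` are `dy - p dx` and `(p + c) dy + ε dx`, up to a common nonzero
factor. Here `q` is the point with coordinates `(x, y, p)` and `L` is the differential of the
coordinates; both are arguments so that this applies in charts of space and of a manifold. -/
structure IsNormalFormAt {V : Type*} [AddCommGroup V] [Module ℝ V] [TopologicalSpace V]
    (ε c : ℝ) (q : E3) (L : V →L[ℝ] E3) (a a' : V →L[ℝ] ℝ) : Prop where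
  add_ne_zero : q 2 + c ≠ 0
  exists_factor : ∃ m : ℝ, m ≠ 0 ∧ ∀ v, a v = m * (L v 1 - q 2 * L v 0) ∧
    a' v = m * ((q 2 + c) * L v 1 + ε * L v 0)

namespace IsNormalFormAt

variable {V W : Type*} [AddCommGroup V] [Module ℝ V] [TopologicalSpace V] [AddCommGroup W]
  [Module ℝ W] [TopologicalSpace W] {q : E3} {L : V →L[ℝ] E3} {a a' : V →L[ℝ] ℝ}

theorem comp (h : IsNormalFormAt ε c q L a a') (g : W →L[ℝ] V) :
    IsNormalFormAt ε c q (L.comp g) (a.comp g) (a'.comp g) :=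
  ⟨h.add_ne_zero, h.exists_factor.imp fun _ hm => ⟨hm.1, fun w => hm.2 (g w)⟩⟩

theorem apply_eq_zero_iff (h : IsNormalFormAt ε c q L a a') (v : V) :
    a v = 0 ↔ L v 1 = q 2 * L v 0 := by
  obtain ⟨m, hm, hform⟩ := h.exists_factor
  rw [(hform v).1, mul_eq_zero, or_iff_right hm, sub_eq_zero]

theorem apply_eq_zero_iff' (h : IsNormalFormAt ε c q L a a') (v : V) :
    a' v = 0 ↔ L v 1 + ε * (L v 0 / (q 2 + c)) = 0 := by
  obtain ⟨m, hm, hform⟩ := h.exists_factor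
  have hdiv : (q 2 + c) * L v 1 + ε * L v 0 =
      (q 2 + c) * (L v 1 + ε * (L v 0 / (q 2 + c))) := by
    rw [mul_add, mul_left_comm, mul_div_cancel₀ _ h.add_ne_zero]
  rw [(hform v).2, hdiv, mul_eq_zero, or_iff_right hm, mul_eq_zero, or_iff_right h.add_ne_zero]

end IsNormalFormAt

theorem IsBalancedPlanar.exists_normalForm (H : IsBalancedPlanar ε c f₁ f₂ g₁ g₂) :
    ∃ Θ : OpenPartialHomeomorph E3 E3, 0 ∈ Θ.source ∧ IsSmoothLocalDiffeo Θ ∧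
      ∀ᶠ z in 𝓝 0, IsNormalFormAt ε c (Θ z) (fderiv ℝ Θ z) (planarForm f₁ f₂ z)
        (planarForm g₁ g₂ z) := by
  obtain ⟨x, y, m, l, N, hm0, hml0⟩ := H.exists_isNormalizing_ne_zero
  have hp : SmoothNear (fun z => -l z / m z) 0 := N.smooth_l.neg.div N.smooth_m hm0
  obtain ⟨Θ, h0, hΘ, hΘs⟩ := exists_isSmoothLocalDiffeo_eq_fiberedMap N.smooth_x N.smooth_y hp
    N.jacobian (N.pd_neg_div_ne_zero H hm0)
  refine ⟨Θ, h0, hΘs, ?_⟩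
  filter_upwards [N.normal_f₁, N.normal_f₂, N.normal_g₁, N.normal_g₂,
    N.smooth_m.continuousAt.eventually_ne hm0,
    ((N.smooth_m.const_mul c).sub N.smooth_l).continuousAt.eventually_ne hml0,
    eventually_fderiv_fiberedMap N.smooth_x N.smooth_y hp]
    with z hf₁ hf₂ hg₁ hg₂ hmz hmlz hdΘ
  have hΘ2 : Θ z 2 = -l z / m z := by rw [hΘ]; rfl
  refine ⟨fun hzero => hmlz ?_, m z, hmz, fun v => ?_⟩
  · rw [hΘ2] at hzero
    field_simp at hzero
    linear_combination hzero
  · obtain ⟨hv₀, hv₁, -⟩ := hdΘ v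
    have hplanar (h₁ h₂ : E3 → ℝ) : planarForm h₁ h₂ z v = h₁ z * v 0 + h₂ z * v 1 := rfl
    rw [hΘ2, hΘ, hv₀, hv₁, hplanar, hplanar, hf₁, hf₂, hg₁, hg₂]
    constructor <;> field_simp <;> ring

end NormalForm

/-! ### One-forms on the model space -/

section Forms

variable {E F : Type*} [NormedAddCommGroup E] [NormedSpace ℝ E] [NormedAddCommGroup F]
  [NormedSpace ℝ F]

/-- The exterior derivative of a one-form on a normed space, as a function of two vectors. Unlike
`extDeriv`, it takes the one-form as a field of linear functionals. -/
noncomputable def extD (A : E → E →L[ℝ] ℝ) (z v w : E) : ℝ :=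
  fderiv ℝ A z v w - fderiv ℝ A z w v

/-- The wedge product `A ∧ dB` of a one-form and the exterior derivative of a one-form. -/
noncomputable def wedgeExtD (A B : E → E →L[ℝ] ℝ) (z u v w : E) : ℝ :=
  A z u * extD B z v w + A z v * extD B z w u + A z w * extD B z u v

/-- The pullback of the one-form `A` by the map `φ`. -/
noncomputable def pullbackForm (φ : E → F) (A : F → F →L[ℝ] ℝ) (x : E) : E →L[ℝ] ℝ :=
  (A (φ x)).comp (fderiv ℝ φ x)

variable {φ : E → F} {A B : E → E →L[ℝ] ℝ} {x z : E}

theorem fderiv_clm_apply_const (hA : DifferentiableAt ℝ A z) (v w : E) :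
    fderiv ℝ (fun z => A z w) z v = fderiv ℝ A z v w := by
  rw [(hA.hasFDerivAt.clm_apply (hasFDerivAt_const w z)).fderiv]
  simp

theorem extDeriv_ofSubsingleton (hA : DifferentiableAt ℝ A z) (v w : E) :
    extDeriv (fun z => ContinuousAlternatingMap.ofSubsingleton ℝ E ℝ (0 : Fin 1) (A z)) z
      ![v, w] = extD A z v w := by
  have hdiff : DifferentiableAt ℝ
      (fun z => ContinuousAlternatingMap.ofSubsingleton ℝ E ℝ (0 : Fin 1) (A z)) z :=
    (ContinuousAlternatingMap.ofSubsingletonLIE (𝕜 := ℝ) (E := E) (F := ℝ)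
      (0 : Fin 1)).toContinuousLinearEquiv.differentiableAt.comp z hA
  rw [extDeriv_apply hdiff, Fin.sum_univ_two]
  simp [Fin.removeNth, extD, fderiv_clm_apply_const hA]
  ring

theorem extD_pullbackForm {A : F → F →L[ℝ] ℝ} (hφ : ContDiffAt ℝ ∞ φ x)
    (hA : DifferentiableAt ℝ A (φ x)) (v w : E) :
    extD (pullbackForm φ A) x v w = extD A (φ x) (fderiv ℝ φ x v) (fderiv ℝ φ x w) := by
  have hφ' : HasFDerivAt φ (fderiv ℝ φ x) x := (hφ.differentiableAt (by simp)).hasFDerivAt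
  have hφ'' : HasFDerivAt (fderiv ℝ φ) (fderiv ℝ (fderiv ℝ φ) x) x :=
    ((hφ.fderiv_right (m := ∞) (by simp)).differentiableAt (by simp)).hasFDerivAt
  have hsymm : fderiv ℝ (fderiv ℝ φ) x v w = fderiv ℝ (fderiv ℝ φ) x w v :=
    hφ.isSymmSndFDerivAt (by simpa using ENat.LEInfty.out) v w
  have hpull : HasFDerivAt (pullbackForm φ A) _ x := (hA.hasFDerivAt.comp x hφ').clm_comp hφ''
  have hderiv (v w : E) : fderiv ℝ (pullbackForm φ A) x v w =
      A (φ x) (fderiv ℝ (fderiv ℝ φ) x v w) +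
        fderiv ℝ A (φ x) (fderiv ℝ φ x v) (fderiv ℝ φ x w) := by
    rw [hpull.fderiv]
    rfl
  rw [extD, hderiv, hderiv, hsymm, extD]
  ring

theorem wedgeExtD_pullbackForm {A B : F → F →L[ℝ] ℝ} (hφ : ContDiffAt ℝ ∞ φ x)
    (hB : DifferentiableAt ℝ B (φ x)) (u v w : E) :
    wedgeExtD (pullbackForm φ A) (pullbackForm φ B) x u v w =
      wedgeExtD A B (φ x) (fderiv ℝ φ x u) (fderiv ℝ φ x v) (fderiv ℝ φ x w) := by
  simp only [wedgeExtD, extD_pullbackForm hφ hB]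
  rfl

theorem SmoothNear.pullbackForm {A : F → F →L[ℝ] ℝ} (hφ : SmoothNear φ x)
    (hA : SmoothNear A (φ x)) : SmoothNear (pullbackForm φ A) x := by
  filter_upwards [hA.comp hφ, hφ] with z hAz hφz
  exact hAz.clm_comp (hφz.fderiv_right (m := ∞) (by simp))

theorem wedgeExtD_congr {A' B' : E → E →L[ℝ] ℝ} (hA : A z = A' z) (hB : B =ᶠ[𝓝 z] B')
    (u v w : E) : wedgeExtD A B z u v w = wedgeExtD A' B' z u v w := by
  simp only [wedgeExtD, extD, hA, hB.fderiv_eq]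

theorem wedgeExtD_smul_self {k : E → ℝ} (hk : DifferentiableAt ℝ k z)
    (hA : DifferentiableAt ℝ A z) (u v w : E) :
    wedgeExtD (fun z => k z • A z) (fun z => k z • A z) z u v w =
      k z ^ 2 * wedgeExtD A A z u v w := by
  have hderiv (v w : E) : fderiv ℝ (fun z => k z • A z) z v w =
      k z * fderiv ℝ A z v w + fderiv ℝ k z v * A z w := by
    rw [fderiv_fun_smul hk hA]
    simp
  simp only [wedgeExtD, extD, hderiv, smul_apply, smul_eq_mul]
  ring

theorem contDiffAt_wedgeExtD (hA : ContDiffAt ℝ ∞ A z) (hB : ContDiffAt ℝ ∞ B z) (u v w : E) :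
    ContDiffAt ℝ ∞ (fun z => wedgeExtD A B z u v w) z := by
  have hA_apply (v : E) : ContDiffAt ℝ ∞ (fun z => A z v) z := hA.clm_apply contDiffAt_const
  have hB_fderiv (v w : E) : ContDiffAt ℝ ∞ (fun z => fderiv ℝ B z v w) z :=
    ((hB.fderiv_right (m := ∞) (by simp)).clm_apply contDiffAt_const).clm_apply contDiffAt_const
  have hB_extD (v w : E) : ContDiffAt ℝ ∞ (fun z => extD B z v w) z :=
    (hB_fderiv v w).sub (hB_fderiv w v)
  exact (((hA_apply u).mul (hB_extD v w)).add ((hA_apply v).mul (hB_extD w u))).add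
    ((hA_apply w).mul (hB_extD u v))

end Forms

section VolumeDensity

/-- The determinant of three vectors of the model space. -/
noncomputable def det₃ (u v w : E3) : ℝ :=
  (EuclideanSpace.basisFun (Fin 3) ℝ).toBasis.det ![u, v, w]

/-- The coefficient of the three-form `A ∧ dB` with respect to the standard volume form. -/
noncomputable def wedgeDensity (A B : E3 → E3 →L[ℝ] ℝ) (z : E3) : ℝ :=
  wedgeExtD A B z (EuclideanSpace.single 0 1) (EuclideanSpace.single 1 1)
    (EuclideanSpace.single 2 1)

theorem det₃_eq (u v w : E3) : det₃ u v w =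
    u 0 * (v 1 * w 2 - v 2 * w 1) + u 1 * (v 2 * w 0 - v 0 * w 2) +
      u 2 * (v 0 * w 1 - v 1 * w 0) := by
  simp [det₃, Module.Basis.det_apply, Matrix.det_fin_three, Module.Basis.toMatrix_apply]
  ring

theorem det₃_single : det₃ (EuclideanSpace.single 0 1) (EuclideanSpace.single 1 1)
    (EuclideanSpace.single 2 1) = 1 := by
  simp [det₃_eq]

theorem det₃_smul_left (t : ℝ) (u v w : E3) : det₃ (t • u) v w = t * det₃ u v w := by
  simp only [det₃_eq, PiLp.smul_apply, smul_eq_mul]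
  ring

theorem det₃_map (L : E3 →L[ℝ] E3) (u v w : E3) :
    det₃ (L u) (L v) (L w) = L.det * det₃ u v w := by
  rw [det₃, det₃, ContinuousLinearMap.det, ← Module.Basis.det_comp]
  congr 1
  ext i : 1
  fin_cases i <;> rfl

variable {A B : E3 → E3 →L[ℝ] ℝ} {z : E3}

theorem wedgeExtD_eq_det₃_mul (A B : E3 → E3 →L[ℝ] ℝ) (z u v w : E3) :
    wedgeExtD A B z u v w = det₃ u v w * wedgeDensity A B z := by
  have hfderiv (v w : E3) : fderiv ℝ B z v w = ∑ i, v i * ∑ j, w j *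
      fderiv ℝ B z (EuclideanSpace.single i 1) (EuclideanSpace.single j 1) := by
    rw [clm_apply_eq_sum_single (fderiv ℝ B z) v, sum_apply]
    exact Finset.sum_congr rfl fun i _ => congrArg (v i * ·) (clm_apply_eq_sum_single _ w)
  have hextD (v w : E3) : extD B z v w = ∑ i, v i * ∑ j, w j *
      extD B z (EuclideanSpace.single i 1) (EuclideanSpace.single j 1) := by
    simp only [extD, hfderiv v w, hfderiv w v, Fin.sum_univ_three]
    ring
  rw [wedgeDensity, wedgeExtD, wedgeExtD, hextD v w, hextD w u, hextD u v,
    clm_apply_eq_sum_single (A z) u, clm_apply_eq_sum_single (A z) v,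
    clm_apply_eq_sum_single (A z) w, det₃_eq]
  simp only [extD, Fin.sum_univ_three, smul_eq_mul]
  ring

theorem wedgeDensity_pullbackForm {φ : E3 → E3} (hφ : ContDiffAt ℝ ∞ φ z)
    (hB : DifferentiableAt ℝ B (φ z)) :
    wedgeDensity (pullbackForm φ A) (pullbackForm φ B) z =
      (fderiv ℝ φ z).det * wedgeDensity A B (φ z) := by
  rw [wedgeDensity, wedgeExtD_pullbackForm hφ hB, wedgeExtD_eq_det₃_mul, det₃_map, det₃_single,
    mul_one]

theorem wedgeDensity_eq_wronskian (hB : DifferentiableAt ℝ B z)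
    (hA2 : A z (EuclideanSpace.single 2 1) = 0)
    (hB2 : ∀ᶠ z in 𝓝 z, B z (EuclideanSpace.single 2 1) = 0) :
    wedgeDensity A B z =
      -(A z (EuclideanSpace.single 0 1) * pd 2 (fun z => B z (EuclideanSpace.single 1 1)) z -
        A z (EuclideanSpace.single 1 1) * pd 2 (fun z => B z (EuclideanSpace.single 0 1)) z) := by
  have hfderiv (v : E3) : fderiv ℝ B z v (EuclideanSpace.single 2 1) = 0 := by
    rw [← fderiv_clm_apply_const hB, Filter.EventuallyEq.fderiv_eq (f := fun _ => 0) hB2]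
    simp
  simp only [wedgeDensity, wedgeExtD, extD, pd, hfderiv, hA2, fderiv_clm_apply_const hB]
  ring

/-- The cross product of two covectors, which spans the intersection of their kernels when they are
linearly independent. -/
noncomputable def crossVector (a b : E3 →L[ℝ] ℝ) : E3 :=
  !₂[a (EuclideanSpace.single 1 1) * b (EuclideanSpace.single 2 1) -
      a (EuclideanSpace.single 2 1) * b (EuclideanSpace.single 1 1),
    a (EuclideanSpace.single 2 1) * b (EuclideanSpace.single 0 1) -
      a (EuclideanSpace.single 0 1) * b (EuclideanSpace.single 2 1),
    a (EuclideanSpace.single 0 1) * b (EuclideanSpace.single 1 1) -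
      a (EuclideanSpace.single 1 1) * b (EuclideanSpace.single 0 1)]

theorem det₃_crossVector (a b : E3 →L[ℝ] ℝ) (u v : E3) :
    det₃ (crossVector a b) u v = a u * b v - a v * b u := by
  rw [clm_apply_eq_sum_single a u, clm_apply_eq_sum_single a v, clm_apply_eq_sum_single b v,
    clm_apply_eq_sum_single b u, det₃_eq]
  simp [crossVector, Fin.sum_univ_three]
  ring

theorem apply_crossVector_left (a b : E3 →L[ℝ] ℝ) : a (crossVector a b) = 0 := by
  rw [clm_apply_eq_sum_single]
  simp [crossVector, Fin.sum_univ_three]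
  ring

theorem apply_crossVector_right (a b : E3 →L[ℝ] ℝ) : b (crossVector a b) = 0 := by
  rw [clm_apply_eq_sum_single]
  simp [crossVector, Fin.sum_univ_three]
  ring

theorem crossVector_ne_zero {a b : E3 →L[ℝ] ℝ} (hab : ∃ u v, a u * b v - a v * b u ≠ 0) :
    crossVector a b ≠ 0 := by
  obtain ⟨u, v, huv⟩ := hab
  intro hzero
  rw [← det₃_crossVector, hzero, det₃_eq] at huv
  simp at huv

theorem contDiffAt_crossVector (hA : ContDiffAt ℝ ∞ A z) (hB : ContDiffAt ℝ ∞ B z) :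
    ContDiffAt ℝ ∞ (fun z => crossVector (A z) (B z)) z := by
  have hA_apply (v : E3) : ContDiffAt ℝ ∞ (fun z => A z v) z := hA.clm_apply contDiffAt_const
  have hB_apply (v : E3) : ContDiffAt ℝ ∞ (fun z => B z v) z := hB.clm_apply contDiffAt_const
  rw [contDiffAt_euclidean]
  intro i
  fin_cases i <;>
    exact ((hA_apply _).mul (hB_apply _)).sub ((hA_apply _).mul (hB_apply _))

end VolumeDensity

section BalancedPair

/-- Two contact forms on the model space near `p` which are balanced with sign `ε`, transverse, and
have constant generating invariant `c`. -/
structure IsBalancedPair (ε c : ℝ) (A A' : E3 → E3 →L[ℝ] ℝ) (p : E3) : Prop where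
  smooth : SmoothNear A p
  smooth' : SmoothNear A' p
  nondeg : ∀ᶠ z in 𝓝 p, wedgeDensity A A z ≠ 0
  balanced : ∀ᶠ z in 𝓝 p, wedgeDensity A' A' z = ε * wedgeDensity A A z
  invariant : ∀ᶠ z in 𝓝 p, wedgeDensity A A' z + wedgeDensity A' A z = c * wedgeDensity A A z
  indep : ∃ u v, A p u * A' p v - A p v * A' p u ≠ 0

namespace IsBalancedPair

variable {ε c : ℝ} {A A' : E3 → E3 →L[ℝ] ℝ} {p : E3}

theorem pullback {φ : E3 → E3} {x : E3} (H : IsBalancedPair ε c A A' (φ x))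
    (hφ : SmoothNear φ x)
    (hφ' : ∀ᶠ z in 𝓝 x, ∃ g : E3 ≃L[ℝ] E3, HasFDerivAt φ (g : E3 →L[ℝ] E3) z) :
    IsBalancedPair ε c (pullbackForm φ A) (pullbackForm φ A') x := by
  have htendsto : Filter.Tendsto φ (𝓝 x) (𝓝 (φ x)) := hφ.continuousAt.tendsto
  have hdensity {B C : E3 → E3 →L[ℝ] ℝ} (hC : SmoothNear C (φ x)) : ∀ᶠ z in 𝓝 x,
      wedgeDensity (pullbackForm φ B) (pullbackForm φ C) z =
        (fderiv ℝ φ z).det * wedgeDensity B C (φ z) := by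
    filter_upwards [hφ, htendsto.eventually hC.eventually_differentiableAt] with z hφz hCz
    exact wedgeDensity_pullbackForm hφz hCz
  refine ⟨hφ.pullbackForm H.smooth, hφ.pullbackForm H.smooth', ?_, ?_, ?_, ?_⟩
  · filter_upwards [hdensity H.smooth, htendsto.eventually H.nondeg, hφ'] with z hz hne ⟨g, hg⟩
    rw [hz, hg.fderiv]
    exact mul_ne_zero g.toLinearEquiv.isUnit_det'.ne_zero hne
  · filter_upwards [hdensity (B := A) H.smooth, hdensity (B := A') H.smooth',
      htendsto.eventually H.balanced] with z hz hz' hbalanced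
    rw [hz, hz', hbalanced, mul_left_comm]
  · filter_upwards [hdensity (B := A) H.smooth, hdensity (B := A) H.smooth',
      hdensity (B := A') H.smooth, htendsto.eventually H.invariant]
      with z hAA hAA' hA'A hinvariant
    rw [hAA, hAA', hA'A, ← mul_add, hinvariant, mul_left_comm]
  · obtain ⟨u, v, huv⟩ := H.indep
    obtain ⟨g, hg⟩ := hφ'.self_of_nhds
    refine ⟨g.symm u, g.symm v, ?_⟩
    simpa [pullbackForm, hg.fderiv] using huv

theorem isBalancedPlanar (H : IsBalancedPair ε c A A' 0)
    (hA : ∀ᶠ z in 𝓝 0, A z (EuclideanSpace.single 2 1) = 0)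
    (hA' : ∀ᶠ z in 𝓝 0, A' z (EuclideanSpace.single 2 1) = 0) :
    IsBalancedPlanar ε c (fun z => A z (EuclideanSpace.single 0 1))
      (fun z => A z (EuclideanSpace.single 1 1)) (fun z => A' z (EuclideanSpace.single 0 1))
      (fun z => A' z (EuclideanSpace.single 1 1)) := by
  have happly {B : E3 → E3 →L[ℝ] ℝ} (hB : SmoothNear B 0) (v : E3) :
      SmoothNear (fun z => B z v) 0 := by
    filter_upwards [hB] with z hz using hz.clm_apply contDiffAt_const
  have hdensity {B C : E3 → E3 →L[ℝ] ℝ} (hC : SmoothNear C 0)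
      (hB2 : ∀ᶠ z in 𝓝 0, B z (EuclideanSpace.single 2 1) = 0)
      (hC2 : ∀ᶠ z in 𝓝 0, C z (EuclideanSpace.single 2 1) = 0) :
      ∀ᶠ z in 𝓝 0, wedgeDensity B C z =
        -(B z (EuclideanSpace.single 0 1) * pd 2 (fun z => C z (EuclideanSpace.single 1 1)) z -
          B z (EuclideanSpace.single 1 1) * pd 2 (fun z => C z (EuclideanSpace.single 0 1)) z) := by
    filter_upwards [hC.eventually_differentiableAt, hB2, hC2.eventually_nhds] with z hCz hB2z hC2z
    exact wedgeDensity_eq_wronskian hCz hB2z hC2z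
  refine ⟨happly H.smooth _, happly H.smooth _, happly H.smooth' _, happly H.smooth' _, ?_, ?_, ?_,
    ?_⟩
  · filter_upwards [H.nondeg, hdensity H.smooth hA hA] with z hne hAA
    rw [hAA] at hne
    exact neg_ne_zero.1 hne
  · filter_upwards [H.balanced, hdensity H.smooth hA hA, hdensity H.smooth' hA' hA']
      with z hbalanced hAA hA'A'
    linear_combination hA'A' - ε * hAA - hbalanced
  · filter_upwards [H.invariant, hdensity H.smooth hA hA, hdensity H.smooth hA' hA,
      hdensity H.smooth' hA hA'] with z hinvariant hAA hA'A hAA'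
    linear_combination hA'A + hAA' - c * hAA - hinvariant
  · obtain ⟨u, v, huv⟩ := H.indep
    refine fun hzero => huv ?_
    rw [clm_apply_eq_sum_single (A 0) u, clm_apply_eq_sum_single (A 0) v,
      clm_apply_eq_sum_single (A' 0) v, clm_apply_eq_sum_single (A' 0) u]
    simp only [Fin.sum_univ_three, hA.self_of_nhds, hA'.self_of_nhds, smul_eq_mul]
    linear_combination (u 0 * v 1 - u 1 * v 0) * hzero

theorem exists_normalForm_of_apply_single_two (H : IsBalancedPair ε c A A' 0)
    (hA : ∀ᶠ z in 𝓝 0, A z (EuclideanSpace.single 2 1) = 0)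
    (hA' : ∀ᶠ z in 𝓝 0, A' z (EuclideanSpace.single 2 1) = 0) :
    ∃ Θ : OpenPartialHomeomorph E3 E3, 0 ∈ Θ.source ∧ IsSmoothLocalDiffeo Θ ∧
      ∀ᶠ z in 𝓝 0, IsNormalFormAt ε c (Θ z) (fderiv ℝ Θ z) (A z) (A' z) := by
  obtain ⟨Θ, h0, hΘs, hΘ⟩ := (H.isBalancedPlanar hA hA').exists_normalForm
  refine ⟨Θ, h0, hΘs, ?_⟩
  have hplanar {B : E3 → E3 →L[ℝ] ℝ} {z : E3} (hB : B z (EuclideanSpace.single 2 1) = 0) :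
      planarForm (fun z => B z (EuclideanSpace.single 0 1))
        (fun z => B z (EuclideanSpace.single 1 1)) z = B z := by
    ext v
    rw [clm_apply_eq_sum_single (B z) v, Fin.sum_univ_three, hB]
    simp [planarForm, mul_comm]
  filter_upwards [hΘ, hA, hA'] with z hz hAz hA'z
  rwa [hplanar hAz, hplanar hA'z] at hz

theorem exists_isSmoothLocalDiffeo_pullbackForm (H : IsBalancedPair ε c A A' p) :
    ∃ e : OpenPartialHomeomorph E3 E3, IsSmoothLocalDiffeo e ∧ 0 ∈ e.source ∧ e 0 = p ∧
      IsBalancedPair ε c (pullbackForm e A) (pullbackForm e A') 0 ∧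
      (∀ᶠ z in 𝓝 0, pullbackForm e A z (EuclideanSpace.single 2 1) = 0) ∧
      ∀ᶠ z in 𝓝 0, pullbackForm e A' z (EuclideanSpace.single 2 1) = 0 := by
  have haxis : SmoothNear (fun z => crossVector (A z) (A' z)) p := by
    filter_upwards [H.smooth, H.smooth'] with z hA hA' using contDiffAt_crossVector hA hA'
  obtain ⟨e, he, h0, rfl, hflow⟩ := haxis.exists_flowBox (crossVector_ne_zero H.indep)
    (w := (EuclideanSpace.single 2 1 : E3)) (by simp)
  have hsource := e.open_source.mem_nhds h0
  refine ⟨e, he, h0, rfl, H.pullback ?_ ?_, ?_, ?_⟩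
  · filter_upwards [hsource] with z hz using he.contDiffAt z hz
  · filter_upwards [hsource] with z hz using he.exists_hasFDerivAt hz
  · filter_upwards [hflow] with z hz
    rw [pullbackForm, ContinuousLinearMap.comp_apply, hz, apply_crossVector_left]
  · filter_upwards [hflow] with z hz
    rw [pullbackForm, ContinuousLinearMap.comp_apply, hz, apply_crossVector_right]

theorem exists_normalForm (H : IsBalancedPair ε c A A' p) :
    ∃ Ψ : OpenPartialHomeomorph E3 E3, p ∈ Ψ.source ∧ IsSmoothLocalDiffeo Ψ ∧
      ∀ᶠ z in 𝓝 p, IsNormalFormAt ε c (Ψ z) (fderiv ℝ Ψ z) (A z) (A' z) := by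
  obtain ⟨e, he, h0, rfl, H', hA, hA'⟩ := H.exists_isSmoothLocalDiffeo_pullbackForm
  obtain ⟨Θ, hΘ0, hΘs, hΘ⟩ := H'.exists_normalForm_of_apply_single_two hA hA'
  have htendsto : Filter.Tendsto e.symm (𝓝 (e 0)) (𝓝 0) := e.tendsto_symm h0
  refine ⟨e.symm.trans Θ, ?_, he.symm.trans hΘs, ?_⟩
  · rw [OpenPartialHomeomorph.trans_source]
    exact ⟨e.map_source h0, by rwa [Set.mem_preimage, e.left_inv h0]⟩
  filter_upwards [e.open_target.mem_nhds (e.map_source h0), htendsto.eventually hΘ,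
    htendsto.eventually (Θ.open_source.mem_nhds hΘ0)] with z hz hnormal hzΘ
  obtain ⟨g, hg⟩ := he.exists_hasFDerivAt (e.map_target hz)
  have hΨ : HasFDerivAt (e.symm.trans Θ)
      ((fderiv ℝ Θ (e.symm z)).comp (g.symm : E3 →L[ℝ] E3)) z :=
    HasFDerivAt.comp (g := Θ) (f := e.symm) z
      ((hΘs.contDiffAt _ hzΘ).differentiableAt (by simp)).hasFDerivAt
      (e.hasFDerivAt_symm hz hg)
  have hpull (B : E3 → E3 →L[ℝ] ℝ) :
      (pullbackForm e B (e.symm z)).comp (g.symm : E3 →L[ℝ] E3) = B z := by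
    ext v
    simp [pullbackForm, hg.fderiv, e.right_inv hz]
  have hcomp := hnormal.comp (g.symm : E3 →L[ℝ] E3)
  rwa [hpull, hpull, ← hΨ.fderiv] at hcomp

end IsBalancedPair

end BalancedPair

/-! ### Coordinate expressions of forms on a manifold -/

section ChartDifferential

variable (E : Type*) [NormedAddCommGroup E] [NormedSpace ℝ E] {M : Type*} [TopologicalSpace M]
  [ChartedSpace E M]

/-- The differential at `m` of the preferred chart at `a`. -/
noncomputable def chartD (a m : M) : TangentSpace 𝓘(ℝ, E) m →L[ℝ] E :=
  mfderiv 𝓘(ℝ, E) 𝓘(ℝ, E) (extChartAt 𝓘(ℝ, E) a) m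

/-- The change of coordinates from the preferred chart at `a` to the preferred chart at `b`. -/
noncomputable def transition (a b : M) : E → E :=
  extChartAt 𝓘(ℝ, E) b ∘ (extChartAt 𝓘(ℝ, E) a).symm

variable {E} {a b m : M}

theorem transition_apply (ha : m ∈ (extChartAt 𝓘(ℝ, E) a).source) :
    transition E a b (extChartAt 𝓘(ℝ, E) a m) = extChartAt 𝓘(ℝ, E) b m := by
  rw [transition, Function.comp_apply, (extChartAt 𝓘(ℝ, E) a).left_inv ha]

theorem tendsto_extChartAt_symm (ha : m ∈ (extChartAt 𝓘(ℝ, E) a).source) :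
    Filter.Tendsto (extChartAt 𝓘(ℝ, E) a).symm (𝓝 (extChartAt 𝓘(ℝ, E) a m)) (𝓝 m) := by
  simpa only [ContinuousAt, (extChartAt 𝓘(ℝ, E) a).left_inv ha] using
    continuousAt_extChartAt_symm' ha

theorem eventually_exists_extChartAt_eq {U : Set M} (hU : U ∈ 𝓝 a) :
    ∀ᶠ z in 𝓝 (extChartAt 𝓘(ℝ, E) a a), ∃ m ∈ U, m ∈ (extChartAt 𝓘(ℝ, E) a).source ∧
      extChartAt 𝓘(ℝ, E) a m = z := by
  filter_upwards [extChartAt_target_mem_nhds a,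
    (tendsto_extChartAt_symm (mem_extChartAt_source a)).eventually hU] with z hz hzU
  exact ⟨_, hzU, (extChartAt 𝓘(ℝ, E) a).map_target hz, (extChartAt 𝓘(ℝ, E) a).right_inv hz⟩

variable [IsManifold 𝓘(ℝ, E) ∞ M]

theorem contDiffAt_transition (ha : m ∈ (extChartAt 𝓘(ℝ, E) a).source)
    (hb : m ∈ (extChartAt 𝓘(ℝ, E) b).source) :
    ContDiffAt ℝ ∞ (transition E a b) (extChartAt 𝓘(ℝ, E) a m) := by
  have hmem : extChartAt 𝓘(ℝ, E) a m ∈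
      ((extChartAt 𝓘(ℝ, E) a).symm.trans (extChartAt 𝓘(ℝ, E) b)).source := by
    rw [PartialEquiv.trans_source]
    exact ⟨(extChartAt 𝓘(ℝ, E) a).map_source ha,
      by rwa [Set.mem_preimage, (extChartAt 𝓘(ℝ, E) a).left_inv ha]⟩
  simpa [transition, contDiffWithinAt_univ] using
    contDiffWithinAt_ext_coord_change (n := ∞) b a hmem

theorem mfderiv_extChartAt_symm_chartD (ha : m ∈ (extChartAt 𝓘(ℝ, E) a).source)
    (v : TangentSpace 𝓘(ℝ, E) m) :
    (mfderiv 𝓘(ℝ, E) 𝓘(ℝ, E) (extChartAt 𝓘(ℝ, E) a).symm (extChartAt 𝓘(ℝ, E) a m)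
      (chartD E a m v) : E) = v := by
  have hid := DFunLike.congr_fun (mfderivWithin_extChartAt_symm_comp_mfderiv_extChartAt' ha) v
  rwa [modelWithCornersSelf_coe, Set.range_id, mfderivWithin_univ] at hid

theorem chartD_surjective (ha : m ∈ (extChartAt 𝓘(ℝ, E) a).source) :
    Function.Surjective (chartD E a m) := by
  obtain ⟨e, he⟩ := isInvertible_mfderiv_extChartAt ha
  rw [chartD, ← he]
  exact e.surjective

theorem fderiv_transition_chartD (ha : m ∈ (extChartAt 𝓘(ℝ, E) a).source)
    (hb : m ∈ (extChartAt 𝓘(ℝ, E) b).source) (v : TangentSpace 𝓘(ℝ, E) m) :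
    fderiv ℝ (transition E a b) (extChartAt 𝓘(ℝ, E) a m) (chartD E a m v) = chartD E b m v := by
  have hcomp : chartD E b m =
      mfderiv 𝓘(ℝ, E) 𝓘(ℝ, E) (transition E a b ∘ extChartAt 𝓘(ℝ, E) a) m := by
    refine Filter.EventuallyEq.mfderiv_eq ?_
    filter_upwards [extChartAt_source_mem_nhds' ha] with x hx
    exact (transition_apply hx).symm
  have hdiff : MDifferentiableAt 𝓘(ℝ, E) 𝓘(ℝ, E) (transition E a b) (extChartAt 𝓘(ℝ, E) a m) :=
    ((contDiffAt_transition ha hb).differentiableAt (by simp)).mdifferentiableAt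
  rw [hcomp, mfderiv_comp m hdiff (mdifferentiableAt_extChartAt (by simpa using ha)),
    mfderiv_eq_fderiv]
  rfl

theorem continuousAt_chartD {X : ∀ m : M, TangentSpace 𝓘(ℝ, E) m}
    (hX : ContinuousAt (fun m : M => (⟨m, X m⟩ : TangentBundle 𝓘(ℝ, E) M)) a) :
    ContinuousAt (fun m => chartD E a m (X m)) a := by
  refine ((FiberBundle.continuousAt_totalSpace E _).1 hX).2.congr ?_
  filter_upwards [(chartAt E a).open_source.mem_nhds (mem_chart_source E a)] with m hm
  refine Eq.trans ?_ (DFunLike.congr_fun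
    (TangentBundle.continuousLinearMapAt_trivializationAt (I := 𝓘(ℝ, E)) hm) (X m))
  exact (Bundle.Trivialization.continuousLinearMapAt_apply_of_mem ℝ _ (by simpa using hm) _).symm

end ChartDifferential

section FormInChart

variable {M : Type*} [TopologicalSpace M] [ChartedSpace E3 M]
  {α γ : ∀ m : M, TangentSpace 𝓘(ℝ, E3) m →L[ℝ] ℝ} {a b m : M}

theorem dForm_eq_extD
    (hγ : DifferentiableAt ℝ (formInChart γ m) (extChartAt 𝓘(ℝ, E3) m m))
    (v w : TangentSpace 𝓘(ℝ, E3) m) :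
    dForm γ m v w =
      extD (formInChart γ m) (extChartAt 𝓘(ℝ, E3) m m) (chartD E3 m m v) (chartD E3 m m w) := by
  rw [dForm]
  exact extDeriv_ofSubsingleton hγ _ _

variable [IsManifold 𝓘(ℝ, E3) ∞ M]

theorem formInChart_chartD (ha : m ∈ (extChartAt 𝓘(ℝ, E3) a).source)
    (v : TangentSpace 𝓘(ℝ, E3) m) :
    formInChart α a (extChartAt 𝓘(ℝ, E3) a m) (chartD E3 a m v) = α m v := by
  have hcongr (x : M) (hx : x = m) (w : E3) (hw : w = v) : (α x : E3 →L[ℝ] ℝ) w = α m v := by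
    subst hx hw
    rfl
  exact hcongr _ ((extChartAt 𝓘(ℝ, E3) a).left_inv ha) _ (mfderiv_extChartAt_symm_chartD ha v)

theorem formInChart_eq_pullbackForm (ha : m ∈ (extChartAt 𝓘(ℝ, E3) a).source)
    (hb : m ∈ (extChartAt 𝓘(ℝ, E3) b).source) :
    formInChart α a (extChartAt 𝓘(ℝ, E3) a m) =
      pullbackForm (transition E3 a b) (formInChart α b) (extChartAt 𝓘(ℝ, E3) a m) := by
  ext v
  obtain ⟨u, rfl⟩ := chartD_surjective ha v
  rw [pullbackForm, ContinuousLinearMap.comp_apply, fderiv_transition_chartD ha hb,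
    transition_apply ha, formInChart_chartD ha, formInChart_chartD hb]

theorem formInChart_eventuallyEq_pullbackForm (ha : m ∈ (extChartAt 𝓘(ℝ, E3) a).source)
    (hb : m ∈ (extChartAt 𝓘(ℝ, E3) b).source) :
    formInChart α a =ᶠ[𝓝 (extChartAt 𝓘(ℝ, E3) a m)]
      pullbackForm (transition E3 a b) (formInChart α b) := by
  filter_upwards [extChartAt_target_mem_nhds' ((extChartAt 𝓘(ℝ, E3) a).map_source ha),
    (tendsto_extChartAt_symm ha).eventually (extChartAt_source_mem_nhds' hb)] with z hz hzb
  simpa only [(extChartAt 𝓘(ℝ, E3) a).right_inv hz] using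
    formInChart_eq_pullbackForm (α := α) ((extChartAt 𝓘(ℝ, E3) a).map_target hz) hzb

theorem contDiffAt_formInChart (ha : m ∈ (extChartAt 𝓘(ℝ, E3) a).source)
    (hb : m ∈ (extChartAt 𝓘(ℝ, E3) b).source)
    (hα : ContDiffAt ℝ ∞ (formInChart α b) (extChartAt 𝓘(ℝ, E3) b m)) :
    ContDiffAt ℝ ∞ (formInChart α a) (extChartAt 𝓘(ℝ, E3) a m) := by
  have htrans := contDiffAt_transition ha hb
  rw [← transition_apply ha] at hα
  exact ContDiffAt.congr_of_eventuallyEq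
    ((hα.comp _ htrans).clm_comp (htrans.fderiv_right (m := ∞) (by simp)))
    (formInChart_eventuallyEq_pullbackForm ha hb)

theorem wedgeD_eq_wedgeExtD_self
    (hγ : DifferentiableAt ℝ (formInChart γ m) (extChartAt 𝓘(ℝ, E3) m m))
    (u v w : TangentSpace 𝓘(ℝ, E3) m) :
    wedgeD α γ m u v w = wedgeExtD (formInChart α m) (formInChart γ m)
      (extChartAt 𝓘(ℝ, E3) m m) (chartD E3 m m u) (chartD E3 m m v) (chartD E3 m m w) := by
  simp only [wedgeD, wedgeExtD, dForm_eq_extD hγ, formInChart_chartD (mem_extChartAt_source m)]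

theorem wedgeD_eq_wedgeExtD (ha : m ∈ (extChartAt 𝓘(ℝ, E3) a).source)
    (hγ : ContDiffAt ℝ ∞ (formInChart γ a) (extChartAt 𝓘(ℝ, E3) a m))
    (u v w : TangentSpace 𝓘(ℝ, E3) m) :
    wedgeD α γ m u v w = wedgeExtD (formInChart α a) (formInChart γ a)
      (extChartAt 𝓘(ℝ, E3) a m) (chartD E3 a m u) (chartD E3 a m v) (chartD E3 a m w) := by
  have hm := mem_extChartAt_source (I := 𝓘(ℝ, E3)) m
  have hself := (contDiffAt_formInChart hm ha hγ).differentiableAt (by simp)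
  have hγ' := hγ.differentiableAt (by simp)
  rw [← transition_apply hm] at hγ'
  rw [wedgeD_eq_wedgeExtD_self hself, wedgeExtD_congr (formInChart_eq_pullbackForm hm ha)
    (formInChart_eventuallyEq_pullbackForm hm ha),
    wedgeExtD_pullbackForm (contDiffAt_transition hm ha) hγ', transition_apply hm,
    fderiv_transition_chartD hm ha, fderiv_transition_chartD hm ha, fderiv_transition_chartD hm ha]

theorem wedgeD_eq_det₃_mul (ha : m ∈ (extChartAt 𝓘(ℝ, E3) a).source)
    (hγ : ContDiffAt ℝ ∞ (formInChart γ a) (extChartAt 𝓘(ℝ, E3) a m))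
    (u v w : TangentSpace 𝓘(ℝ, E3) m) :
    wedgeD α γ m u v w = det₃ (chartD E3 a m u) (chartD E3 a m v) (chartD E3 a m w) *
      wedgeDensity (formInChart α a) (formInChart γ a) (extChartAt 𝓘(ℝ, E3) a m) := by
  rw [wedgeD_eq_wedgeExtD ha hγ, wedgeExtD_eq_det₃_mul]

theorem exists_wedgeD_eq_wedgeDensity (ha : m ∈ (extChartAt 𝓘(ℝ, E3) a).source) :
    ∃ u v w, ∀ {α γ : ∀ m : M, TangentSpace 𝓘(ℝ, E3) m →L[ℝ] ℝ},
      ContDiffAt ℝ ∞ (formInChart γ a) (extChartAt 𝓘(ℝ, E3) a m) → wedgeD α γ m u v w =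
        wedgeDensity (formInChart α a) (formInChart γ a) (extChartAt 𝓘(ℝ, E3) a m) := by
  obtain ⟨u, hu⟩ := chartD_surjective ha (EuclideanSpace.single 0 1)
  obtain ⟨v, hv⟩ := chartD_surjective ha (EuclideanSpace.single 1 1)
  obtain ⟨w, hw⟩ := chartD_surjective ha (EuclideanSpace.single 2 1)
  refine ⟨u, v, w, fun hγ => ?_⟩
  rw [wedgeD_eq_det₃_mul ha hγ, hu, hv, hw, det₃_single, one_mul]

end FormInChart

/-! ### Balanced forms -/

section ContactForm

variable {M : Type*} [TopologicalSpace M] [ChartedSpace E3 M]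
  {ξ ξ' : ∀ m : M, Submodule ℝ (TangentSpace 𝓘(ℝ, E3) m)}
  {α β : ∀ m : M, TangentSpace 𝓘(ℝ, E3) m →L[ℝ] ℝ} {U V : Set M} {k : E3 → ℝ} {a m : M}

namespace IsContactForm

theorem mono (h : IsContactForm ξ α U) (hV : V ⊆ U) : IsContactForm ξ α V :=
  ⟨fun m hm => h.smooth m (hV hm), fun m hm => h.ker_eq m (hV hm), fun m hm => h.nondeg m (hV hm)⟩

theorem exists_apply_ne_zero (h : IsContactForm ξ α U) (hm : m ∈ U) : ∃ v, α m v ≠ 0 := by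
  by_contra! hzero
  refine h.nondeg m hm ?_
  funext u v w
  simp [wedgeD, hzero]

theorem exists_mul_sub_mul_ne_zero (hα : IsContactForm ξ α U) (hβ : IsContactForm ξ' β U)
    (hm : m ∈ U) (ht : ξ m ⊔ ξ' m = ⊤) : ∃ u v, α m u * β m v - α m v * β m u ≠ 0 := by
  obtain ⟨w, hw⟩ := hα.exists_apply_ne_zero hm
  obtain ⟨w', hw'⟩ := hβ.exists_apply_ne_zero hm
  obtain ⟨u, hu, v, hv, rfl⟩ := Submodule.mem_sup.1 (ht ▸ Submodule.mem_top : w ∈ ξ m ⊔ ξ' m)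
  obtain ⟨u', hu', v', hv', rfl⟩ := Submodule.mem_sup.1 (ht ▸ Submodule.mem_top : w' ∈ ξ m ⊔ ξ' m)
  rw [hα.ker_eq m hm] at hu hu'
  rw [hβ.ker_eq m hm] at hv hv'
  rw [map_add, hu, zero_add] at hw
  rw [map_add, hv', add_zero] at hw'
  exact ⟨v, u', by rw [hu', hv, zero_mul, sub_zero]; exact mul_ne_zero hw hw'⟩

variable [IsManifold 𝓘(ℝ, E3) ∞ M]

theorem contDiffAt (h : IsContactForm ξ α U) (hm : m ∈ U)
    (ha : m ∈ (extChartAt 𝓘(ℝ, E3) a).source) :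
    ContDiffAt ℝ ∞ (formInChart α a) (extChartAt 𝓘(ℝ, E3) a m) :=
  contDiffAt_formInChart ha (mem_extChartAt_source m) (h.smooth m hm)

theorem smoothNear (h : IsContactForm ξ α U) (hU : U ∈ 𝓝 a) :
    SmoothNear (formInChart α a) (extChartAt 𝓘(ℝ, E3) a a) := by
  filter_upwards [eventually_exists_extChartAt_eq hU] with z ⟨m, hm, hma, hz⟩
  exact hz ▸ h.contDiffAt hm hma

theorem wedgeDensity_ne_zero (h : IsContactForm ξ α U) (hm : m ∈ U)
    (ha : m ∈ (extChartAt 𝓘(ℝ, E3) a).source) :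
    wedgeDensity (formInChart α a) (formInChart α a) (extChartAt 𝓘(ℝ, E3) a m) ≠ 0 := by
  intro hzero
  refine h.nondeg m hm ?_
  funext u v w
  rw [wedgeD_eq_det₃_mul ha (h.contDiffAt hm ha), hzero, mul_zero]
  rfl

theorem exists_formInChart_mul_sub_mul_ne_zero (hα : IsContactForm ξ α U)
    (hβ : IsContactForm ξ' β U) (hm : m ∈ U) (ha : m ∈ (extChartAt 𝓘(ℝ, E3) a).source)
    (ht : ξ m ⊔ ξ' m = ⊤) :
    ∃ u v, formInChart α a (extChartAt 𝓘(ℝ, E3) a m) u *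
      formInChart β a (extChartAt 𝓘(ℝ, E3) a m) v -
      formInChart α a (extChartAt 𝓘(ℝ, E3) a m) v *
      formInChart β a (extChartAt 𝓘(ℝ, E3) a m) u ≠ 0 := by
  obtain ⟨u, v, huv⟩ := hα.exists_mul_sub_mul_ne_zero hβ hm ht
  refine ⟨chartD E3 a m u, chartD E3 a m v, ?_⟩
  rwa [formInChart_chartD ha, formInChart_chartD ha, formInChart_chartD ha, formInChart_chartD ha]

end IsContactForm

theorem formInChart_smul_eventuallyEq (hm : m ∈ (extChartAt 𝓘(ℝ, E3) a).source) :
    formInChart (fun m => k (extChartAt 𝓘(ℝ, E3) a m) • β m) a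
      =ᶠ[𝓝 (extChartAt 𝓘(ℝ, E3) a m)] fun z => k z • formInChart β a z := by
  filter_upwards [extChartAt_target_mem_nhds' ((extChartAt 𝓘(ℝ, E3) a).map_source hm)] with z hz
  rw [formInChart, (extChartAt 𝓘(ℝ, E3) a).right_inv hz]
  rfl

variable [IsManifold 𝓘(ℝ, E3) ∞ M]

theorem wedgeD_smul_self (hm : m ∈ (extChartAt 𝓘(ℝ, E3) a).source)
    (hk : ContDiffAt ℝ ∞ k (extChartAt 𝓘(ℝ, E3) a m))
    (hβ : ContDiffAt ℝ ∞ (formInChart β a) (extChartAt 𝓘(ℝ, E3) a m)) :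
    wedgeD (fun m => k (extChartAt 𝓘(ℝ, E3) a m) • β m)
      (fun m => k (extChartAt 𝓘(ℝ, E3) a m) • β m) m =
      k (extChartAt 𝓘(ℝ, E3) a m) ^ 2 • wedgeD β β m := by
  have hsmul := formInChart_smul_eventuallyEq (k := k) (β := β) hm
  funext u v w
  rw [wedgeD_eq_wedgeExtD hm ((hk.smul hβ).congr_of_eventuallyEq hsmul),
    wedgeExtD_congr (A' := fun z => k z • formInChart β a z) hsmul.self_of_nhds hsmul,
    wedgeExtD_smul_self (hk.differentiableAt (by simp)) (hβ.differentiableAt (by simp)),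
    ← wedgeD_eq_wedgeExtD hm hβ]
  rfl

theorem IsContactForm.smul (h : IsContactForm ξ β U) (hU : U ⊆ (extChartAt 𝓘(ℝ, E3) a).source)
    (hk : ∀ m ∈ U, ContDiffAt ℝ ∞ k (extChartAt 𝓘(ℝ, E3) a m))
    (hk' : ∀ m ∈ U, k (extChartAt 𝓘(ℝ, E3) a m) ≠ 0) :
    IsContactForm ξ (fun m => k (extChartAt 𝓘(ℝ, E3) a m) • β m) U := by
  refine ⟨fun m hm => ?_, fun m hm v => ?_, fun m hm => ?_⟩
  · exact contDiffAt_formInChart (mem_extChartAt_source m) (hU hm)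
      (((hk m hm).smul (h.contDiffAt hm (hU hm))).congr_of_eventuallyEq
        (formInChart_smul_eventuallyEq (hU hm)))
  · rw [h.ker_eq m hm, smul_apply, smul_eq_zero, or_iff_right (hk' m hm)]
  · rw [wedgeD_smul_self (hU hm) (hk m hm) (h.contDiffAt hm (hU hm))]
    exact smul_ne_zero (pow_ne_zero 2 (hk' m hm)) (h.nondeg m hm)

end ContactForm

section AxisField

/-- The coordinate expression of the vector field `Z` along the axis with `i_Z (A ∧ dA) = A ∧ B`,
for a contact form `A`. -/
noncomputable def axisField (A B : E3 → E3 →L[ℝ] ℝ) (z : E3) : E3 :=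
  (wedgeDensity A A z)⁻¹ • crossVector (A z) (B z)

variable {A B : E3 → E3 →L[ℝ] ℝ} {z : E3}

theorem wedgeExtD_smul_axisField (hA : wedgeDensity A A z ≠ 0) (t : ℝ) (u v : E3) :
    wedgeExtD A A z (t • axisField A B z) u v = t * (A z u * B z v - A z v * B z u) := by
  rw [wedgeExtD_eq_det₃_mul, axisField, smul_smul, det₃_smul_left, det₃_crossVector]
  field_simp

theorem SmoothNear.continuousAt_axisField (hA : SmoothNear A z) (hB : SmoothNear B z)
    (hne : wedgeDensity A A z ≠ 0) : ContinuousAt (axisField A B) z :=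
  ((contDiffAt_wedgeExtD hA.contDiffAt hA.contDiffAt _ _ _).continuousAt.inv₀ hne).smul
    (contDiffAt_crossVector hA.contDiffAt hB.contDiffAt).continuousAt

theorem exists_sign_eventually_eq_pos_smul {V T : Type*} [NormedAddCommGroup V]
    [InnerProductSpace ℝ V] [TopologicalSpace T] {Y W : T → V} {a : T} (hY : ContinuousAt Y a)
    (hW : ContinuousAt W a) (hne : Y a ≠ 0) (hYW : ∀ᶠ m in 𝓝 a, ∃ t : ℝ, Y m = t • W m) :
    ∃ σ : ℝ, σ * σ = 1 ∧ ∀ᶠ m in 𝓝 a, ∃ t : ℝ, 0 < t ∧ σ • Y m = t • W m := by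
  have hinner : inner ℝ (Y a) (W a) ≠ 0 := by
    obtain ⟨t, ht⟩ := hYW.self_of_nhds
    obtain ⟨ht0, hWa⟩ := smul_ne_zero_iff.1 (ht ▸ hne)
    rw [ht, real_inner_smul_left]
    exact mul_ne_zero ht0 (inner_self_ne_zero.2 hWa)
  obtain ⟨σ, hσ, hpos⟩ : ∃ σ : ℝ, σ * σ = 1 ∧ 0 < σ * inner ℝ (Y a) (W a) := by
    rcases lt_or_gt_of_ne hinner with hneg | hpos
    · exact ⟨-1, by norm_num, by linarith⟩
    · exact ⟨1, by norm_num, by linarith⟩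
  have hnear : ∀ᶠ m in 𝓝 a, 0 < σ * inner ℝ (Y m) (W m) :=
    (continuousAt_const.mul (hY.inner (𝕜 := ℝ) hW)).eventually (lt_mem_nhds hpos)
  refine ⟨σ, hσ, ?_⟩
  filter_upwards [hYW, hnear] with m ⟨t, ht⟩ hm
  refine ⟨σ * t, ?_, by rw [ht, smul_smul]⟩
  rw [ht, real_inner_smul_left, ← mul_assoc] at hm
  exact pos_of_mul_pos_left hm real_inner_self_nonneg

end AxisField

section Balanced

variable {M : Type*} [TopologicalSpace M] [ChartedSpace E3 M] [IsManifold 𝓘(ℝ, E3) ∞ M]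
  {ε : ℝ} {ξ ξ' : ∀ m : M, Submodule ℝ (TangentSpace 𝓘(ℝ, E3) m)}
  {α β : ∀ m : M, TangentSpace 𝓘(ℝ, E3) m →L[ℝ] ℝ} {X : ∀ m : M, TangentSpace 𝓘(ℝ, E3) m}
  {U : Set M} {a m : M}

theorem OrientsAxis.exists_axisField_eq_smul (hX : OrientsAxis ξ ξ' X) (hα : IsContactForm ξ α U)
    (hβ : IsContactForm ξ' β U) (hm : m ∈ U) (ha : m ∈ (extChartAt 𝓘(ℝ, E3) a).source) :
    ∃ t : ℝ, axisField (formInChart α a) (formInChart β a) (extChartAt 𝓘(ℝ, E3) a m) =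
      t • chartD E3 a m (X m) := by
  obtain ⟨x, hx⟩ := chartD_surjective ha
    (axisField (formInChart α a) (formInChart β a) (extChartAt 𝓘(ℝ, E3) a m))
  have hmem : x ∈ ξ m ⊓ ξ' m := by
    refine ⟨(hα.ker_eq m hm x).2 ?_, (hβ.ker_eq m hm x).2 ?_⟩
    · rw [← formInChart_chartD ha, hx, axisField, map_smul, apply_crossVector_left, smul_zero]
    · rw [← formInChart_chartD ha, hx, axisField, map_smul, apply_crossVector_right, smul_zero]
  obtain ⟨t, rfl⟩ := Submodule.mem_span_singleton.1 (hX.span_eq m ▸ hmem)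
  exact ⟨t, by rw [← hx, map_smul]⟩

theorem OrientsAxis.exists_sign_eventually_axisField_eq (hX : OrientsAxis ξ ξ' X)
    (hα : IsContactForm ξ α U) (hβ : IsContactForm ξ' β U) (hU : U ∈ 𝓝 a)
    (ht : ξ a ⊔ ξ' a = ⊤) :
    ∃ σ : ℝ, σ * σ = 1 ∧ ∀ᶠ m in 𝓝 a, ∃ t : ℝ, 0 < t ∧
      σ • axisField (formInChart α a) (formInChart β a) (extChartAt 𝓘(ℝ, E3) a m) =
        t • chartD E3 a m (X m) := by
  have haU := mem_of_mem_nhds hU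
  have hsource := mem_extChartAt_source (I := 𝓘(ℝ, E3)) a
  have hne := hα.wedgeDensity_ne_zero haU hsource
  refine exists_sign_eventually_eq_pos_smul
    (ContinuousAt.comp (g := axisField (formInChart α a) (formInChart β a))
      ((hα.smoothNear hU).continuousAt_axisField (hβ.smoothNear hU) hne)
      (continuousAt_extChartAt (I := 𝓘(ℝ, E3)) a))
    (continuousAt_chartD hX.continuous.continuousAt) ?_ ?_
  · exact smul_ne_zero (inv_ne_zero hne) (crossVector_ne_zero
      (hα.exists_formInChart_mul_sub_mul_ne_zero hβ haU hsource ht))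
  · filter_upwards [hU, extChartAt_source_mem_nhds (I := 𝓘(ℝ, E3)) a] with m hm hma
    exact hX.exists_axisField_eq_smul hα hβ hm hma

theorem IsContactForm.wedgeD_eq_wedge₁₁ (hα : IsContactForm ξ α U) (hm : m ∈ U)
    (ha : m ∈ (extChartAt 𝓘(ℝ, E3) a).source) {σ : ℝ} {x : TangentSpace 𝓘(ℝ, E3) m}
    (hx : σ • axisField (formInChart α a) (formInChart β a) (extChartAt 𝓘(ℝ, E3) a m) =
      chartD E3 a m x) :
    wedgeD α α m x = wedge₁₁ α (fun m => σ • β m) m := by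
  funext u v
  rw [wedgeD_eq_wedgeExtD ha (hα.contDiffAt hm ha), ← hx,
    wedgeExtD_smul_axisField (hα.wedgeDensity_ne_zero hm ha), formInChart_chartD ha,
    formInChart_chartD ha, formInChart_chartD ha, formInChart_chartD ha]
  simp only [wedge₁₁, smul_apply, smul_eq_mul]
  ring

namespace IsTransverseContactPair

theorem exists_wedgeD_eq_smul (hpair : IsTransverseContactPair ε ξ ξ') (hε : ε * ε = 1)
    (hU : IsOpen U) (hUa : U ⊆ (extChartAt 𝓘(ℝ, E3) a).source) (hα : IsContactForm ξ α U)
    (hβ : IsContactForm ξ' β U) :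
    ∃ ρ : E3 → ℝ, ∀ m ∈ U, ContDiffAt ℝ ∞ ρ (extChartAt 𝓘(ℝ, E3) a m) ∧
      0 < ρ (extChartAt 𝓘(ℝ, E3) a m) ∧
      wedgeD α α m = (ε * ρ (extChartAt 𝓘(ℝ, E3) a m)) • wedgeD β β m := by
  let A := formInChart α a
  let B := formInChart β a
  refine ⟨fun z => ε * wedgeDensity A A z / wedgeDensity B B z, fun m hm => ?_⟩
  have hA := hα.contDiffAt hm (hUa hm)
  have hB := hβ.contDiffAt hm (hUa hm)
  have hne := hβ.wedgeDensity_ne_zero hm (hUa hm)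
  obtain ⟨r, hr, hratio⟩ := hpair.orientation U α β hU hα hβ m hm
  obtain ⟨u, v, w, hdensity⟩ := exists_wedgeD_eq_wedgeDensity (hUa hm)
  have hAB : wedgeDensity A A (extChartAt 𝓘(ℝ, E3) a m) =
      ε * r * wedgeDensity B B (extChartAt 𝓘(ℝ, E3) a m) := by
    rw [← hdensity hA, ← hdensity hB, hratio]
    rfl
  have hr_eq : ε * wedgeDensity A A (extChartAt 𝓘(ℝ, E3) a m) /
      wedgeDensity B B (extChartAt 𝓘(ℝ, E3) a m) = r := by
    rw [hAB, ← mul_assoc, ← mul_assoc, hε, one_mul, mul_div_cancel_right₀ _ hne]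
  refine ⟨(contDiffAt_const.mul (contDiffAt_wedgeExtD hA hA _ _ _)).div
    (contDiffAt_wedgeExtD hB hB _ _ _) hne, ?_, ?_⟩
  · exact hr.trans_eq hr_eq.symm
  · rw [hratio, ← hr_eq]

theorem exists_isContactForm_wedgeD_eq (hpair : IsTransverseContactPair ε ξ ξ') (hε : ε * ε = 1)
    (a : M) : ∃ (U : Set M) (α α' : ∀ m : M, TangentSpace 𝓘(ℝ, E3) m →L[ℝ] ℝ), IsOpen U ∧ a ∈ U ∧
      U ⊆ (extChartAt 𝓘(ℝ, E3) a).source ∧ IsContactForm ξ α U ∧ IsContactForm ξ' α' U ∧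
      ∀ m ∈ U, wedgeD α α m = ε • wedgeD α' α' m := by
  obtain ⟨U₁, hU₁, haU₁, α, hα⟩ := hpair.contact a
  obtain ⟨U₂, hU₂, haU₂, β, hβ⟩ := hpair.contact' a
  let U := U₁ ∩ U₂ ∩ (extChartAt 𝓘(ℝ, E3) a).source
  have hU : IsOpen U := (hU₁.inter hU₂).inter (isOpen_extChartAt_source a)
  have hUa : U ⊆ (extChartAt 𝓘(ℝ, E3) a).source := Set.inter_subset_right
  have hαU : IsContactForm ξ α U := hα.mono fun m hm => hm.1.1
  have hβU : IsContactForm ξ' β U := hβ.mono fun m hm => hm.1.2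
  obtain ⟨ρ, hρ⟩ := hpair.exists_wedgeD_eq_smul hε hU hUa hαU hβU
  have hsqrt (m : M) (hm : m ∈ U) :
      ContDiffAt ℝ ∞ (fun z => √(ρ z)) (extChartAt 𝓘(ℝ, E3) a m) :=
    (hρ m hm).1.sqrt (hρ m hm).2.1.ne'
  refine ⟨U, α, _, hU, ⟨⟨haU₁, haU₂⟩, mem_extChartAt_source a⟩, hUa, hαU,
    hβU.smul hUa hsqrt fun m hm => (Real.sqrt_pos.2 (hρ m hm).2.1).ne', fun m hm => ?_⟩
  rw [(hρ m hm).2.2, wedgeD_smul_self (hUa hm) (hsqrt m hm) (hβU.contDiffAt hm (hUa hm)),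
    Real.sq_sqrt (hρ m hm).2.1.le, smul_smul]

theorem exists_isBalanced (hpair : IsTransverseContactPair ε ξ ξ') (hε : ε * ε = 1)
    (hX : OrientsAxis ξ ξ' X) (a : M) :
    ∃ (U : Set M) (α α' : ∀ m : M, TangentSpace 𝓘(ℝ, E3) m →L[ℝ] ℝ), IsOpen U ∧ a ∈ U ∧
      IsBalanced ε ξ ξ' X α α' U := by
  obtain ⟨U, α, β, hU, haU, hUa, hα, hβ, hbal⟩ := hpair.exists_isContactForm_wedgeD_eq hε a
  obtain ⟨σ, hσ, haxis⟩ := hX.exists_sign_eventually_axisField_eq hα hβ (hU.mem_nhds haU)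
    (hpair.transverse a)
  obtain ⟨V, hV, hVo, haV⟩ := eventually_nhds_iff.1 (haxis.and (hU.eventually_mem haU))
  have hVU : V ⊆ U := fun m hm => (hV m hm).2
  have hσβ : IsContactForm ξ' (fun m => σ • β m) U := hβ.smul (k := fun _ => σ) hUa
    (fun _ _ => contDiffAt_const) fun _ _ => left_ne_zero_of_mul_eq_one hσ
  refine ⟨V, α, _, hVo, haV, hα.mono hVU, hσβ.mono hVU, fun m hm => ?_, fun m hm => ?_⟩
  · rw [wedgeD_smul_self (k := fun _ => σ) (hUa (hVU hm)) contDiffAt_const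
      (hβ.contDiffAt (hVU hm) (hUa (hVU hm))), sq, hσ, one_smul, hbal m (hVU hm)]
  · obtain ⟨t, ht, heq⟩ := (hV m hm).1
    exact ⟨t, ht, hα.wedgeD_eq_wedge₁₁ (hVU hm) (hUa (hVU hm)) (by rw [heq, map_smul])⟩

end IsTransverseContactPair

theorem IsBalanced.isBalancedPair {c : ℝ} {α' : ∀ m : M, TangentSpace 𝓘(ℝ, E3) m →L[ℝ] ℝ}
    (h : IsBalanced ε ξ ξ' X α α' U) (hε : ε * ε = 1) (hU : U ∈ 𝓝 a) (ht : ξ a ⊔ ξ' a = ⊤)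
    (hc : ∀ m ∈ U, wedgeD α α' m + wedgeD α' α m = c • wedgeD α α m) :
    IsBalancedPair ε c (formInChart α a) (formInChart α' a) (extChartAt 𝓘(ℝ, E3) a a) := by
  have hpoint := eventually_exists_extChartAt_eq (E := E3) hU
  refine ⟨h.contact.smoothNear hU, h.contact'.smoothNear hU, ?_, ?_, ?_,
    h.contact.exists_formInChart_mul_sub_mul_ne_zero h.contact' (mem_of_mem_nhds hU)
      (mem_extChartAt_source a) ht⟩
  all_goals filter_upwards [hpoint] with z ⟨m, hm, hma, hz⟩
  all_goals subst hz
  · exact h.contact.wedgeDensity_ne_zero hm hma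
  · obtain ⟨u, v, w, hdensity⟩ := exists_wedgeD_eq_wedgeDensity hma
    rw [← hdensity (h.contact.contDiffAt hm hma), ← hdensity (h.contact'.contDiffAt hm hma),
      h.balanced m hm, Pi.smul_apply, Pi.smul_apply, Pi.smul_apply, smul_eq_mul, ← mul_assoc, hε,
      one_mul]
  · obtain ⟨u, v, w, hdensity⟩ := exists_wedgeD_eq_wedgeDensity hma
    rw [← hdensity (h.contact.contDiffAt hm hma), ← hdensity (h.contact.contDiffAt hm hma),
      ← hdensity (h.contact'.contDiffAt hm hma)]
    exact congrFun (congrFun (congrFun (hc m hm) u) v) w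

end Balanced

/-! ### Charts in normal form -/

section NormalFormChart

variable {E : Type*} [NormedAddCommGroup E] [NormedSpace ℝ E] {M : Type*} [TopologicalSpace M]
  [ChartedSpace E M] [IsManifold 𝓘(ℝ, E) ∞ M] {Ψ : OpenPartialHomeomorph E E} {a m : M}

theorem IsSmoothLocalDiffeo.chartAt_trans_mem_maximalAtlas (hΨ : IsSmoothLocalDiffeo Ψ) (a : M) :
    (chartAt E a).trans Ψ ∈ IsManifold.maximalAtlas 𝓘(ℝ, E) ∞ M := by
  have hchart := IsManifold.chart_mem_maximalAtlas (I := 𝓘(ℝ, E)) (n := ∞) a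
  refine OpenPartialHomeomorph.mem_maximalAtlas_of_contMDiffOn _ (fun m hm => ?_) fun z hz => ?_
  · rw [OpenPartialHomeomorph.trans_source] at hm
    exact ((hΨ.contDiffAt _ hm.2).contMDiffAt.comp m
      (contMDiffAt_of_mem_maximalAtlas hchart hm.1)).contMDiffWithinAt
  · rw [OpenPartialHomeomorph.trans_target] at hz
    exact ((contMDiffAt_symm_of_mem_maximalAtlas hchart hz.2).comp z
      (hΨ.contDiffAt_symm z hz.1).contMDiffAt).contMDiffWithinAt

theorem IsSmoothLocalDiffeo.mfderiv_chartAt_trans (hΨ : IsSmoothLocalDiffeo Ψ)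
    (hm : m ∈ ((chartAt E a).trans Ψ).source) :
    mfderiv 𝓘(ℝ, E) 𝓘(ℝ, E) ((chartAt E a).trans Ψ) m =
      (fderiv ℝ Ψ (extChartAt 𝓘(ℝ, E) a m)).comp (chartD E a m) := by
  rw [OpenPartialHomeomorph.trans_source] at hm
  have hdiff : MDifferentiableAt 𝓘(ℝ, E) 𝓘(ℝ, E) Ψ (extChartAt 𝓘(ℝ, E) a m) :=
    ((hΨ.contDiffAt _ hm.2).differentiableAt (by simp)).mdifferentiableAt
  exact (mfderiv_comp m hdiff (mdifferentiableAt_extChartAt hm.1)).trans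
    (by rw [mfderiv_eq_fderiv]; rfl)

end NormalFormChart

theorem IsBalanced.exists_normalFormChart {M : Type*} [TopologicalSpace M] [ChartedSpace E3 M]
    [IsManifold 𝓘(ℝ, E3) ∞ M] {ε c : ℝ} {ξ ξ' : ∀ m : M, Submodule ℝ (TangentSpace 𝓘(ℝ, E3) m)}
    {α α' : ∀ m : M, TangentSpace 𝓘(ℝ, E3) m →L[ℝ] ℝ} {X : ∀ m : M, TangentSpace 𝓘(ℝ, E3) m}
    {U : Set M} {a : M} (h : IsBalanced ε ξ ξ' X α α' U) (hε : ε * ε = 1) (hU : U ∈ 𝓝 a)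
    (ht : ξ a ⊔ ξ' a = ⊤)
    (hc : ∀ m ∈ U, wedgeD α α' m + wedgeD α' α m = c • wedgeD α α m) :
    ∃ e ∈ IsManifold.maximalAtlas 𝓘(ℝ, E3) ∞ M, a ∈ e.source ∧ ∀ m ∈ e.source, m ∈ U ∧
      IsNormalFormAt ε c (e m) (mfderiv 𝓘(ℝ, E3) 𝓘(ℝ, E3) e m) (α m) (α' m) := by
  obtain ⟨Ψ, haΨ, hΨ, hnormal⟩ := (h.isBalancedPair hε hU ht hc).exists_normalForm
  obtain ⟨V, hV, hVo, haV⟩ := eventually_nhds_iff.1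
    (((continuousAt_extChartAt a).eventually hnormal).and hU)
  refine ⟨((chartAt E3 a).trans Ψ).restr V,
    restr_mem_maximalAtlas _ (hΨ.chartAt_trans_mem_maximalAtlas a) hVo,
    ⟨⟨mem_chart_source E3 a, haΨ⟩, by rwa [hVo.interior_eq]⟩, fun m hm => ?_⟩
  have hmV := interior_subset hm.2
  have hform (γ : ∀ m : M, TangentSpace 𝓘(ℝ, E3) m →L[ℝ] ℝ) :
      (formInChart γ a (extChartAt 𝓘(ℝ, E3) a m)).comp (chartD E3 a m) = γ m := by
    ext v
    exact formInChart_chartD (by simpa using hm.1.1) v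
  have hcomp := (hV m hmV).1.comp (chartD E3 a m)
  rw [hform, hform, ← hΨ.mfderiv_chartAt_trans hm.1] at hcomp
  exact ⟨(hV m hmV).2, hcomp⟩

theorem mainTheorem4 {M : Type*} [TopologicalSpace M] [ChartedSpace E3 M]
    [IsManifold 𝓘(ℝ, E3) ∞ M] (ε : ℝ) (hε : ε = 1 ∨ ε = -1)
    (ξ ξ' : ∀ m : M, Submodule ℝ (TangentSpace 𝓘(ℝ, E3) m))
    (hpair : IsTransverseContactPair ε ξ ξ')
    (X : ∀ m : M, TangentSpace 𝓘(ℝ, E3) m) (hX : OrientsAxis ξ ξ' X)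
    (I : M → ℝ) (hI : IsGeneratingInvariant ε ξ ξ' X I)
    (c : ℝ) (hc : ∀ m : M, I m = c) :
    ∀ m₀ : M, ∃ e ∈ IsManifold.maximalAtlas 𝓘(ℝ, E3) ∞ M, m₀ ∈ e.source ∧
      ∀ m ∈ e.source, e m 2 + c ≠ 0 ∧
        (∀ v : TangentSpace 𝓘(ℝ, E3) m,
          v ∈ ξ m ↔ coordDiff e 1 m v = e m 2 * coordDiff e 0 m v) ∧
        (∀ v : TangentSpace 𝓘(ℝ, E3) m,
          v ∈ ξ' m ↔ coordDiff e 1 m v + ε * (coordDiff e 0 m v / (e m 2 + c)) = 0) := by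
  intro m₀
  have hε_sq : ε * ε = 1 := mul_self_eq_one_iff.2 hε
  obtain ⟨U, α, α', hU, hmU, hbal⟩ := hpair.exists_isBalanced hε_sq hX m₀
  have hinv (m : M) (hm : m ∈ U) : wedgeD α α' m + wedgeD α' α m = c • wedgeD α α m :=
    hc m ▸ hI U α α' hU hbal m hm
  obtain ⟨e, he, hmem, hnormal⟩ := hbal.exists_normalFormChart hε_sq (hU.mem_nhds hmU)
    (hpair.transverse m₀) hinv
  refine ⟨e, he, hmem, fun m hm => ?_⟩
  obtain ⟨hm', hform⟩ := hnormal m hm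
  exact ⟨hform.add_ne_zero,
    fun v => (hbal.contact.ker_eq m hm' v).trans (hform.apply_eq_zero_iff v),
    fun v => (hbal.contact'.ker_eq m hm' v).trans (hform.apply_eq_zero_iff' v)⟩
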